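/- **Setting.** Put $\epsilon=1/100$ and let $\eta>40$. Let $H$ be holomorphic and even on the strip $|\mathrm{Re}\,\mu|<2\eta$ with $H(\mu)\ll e^{-2\pi|\mu|}$ there. Let $\alpha_1,\alpha_2,\alpha_3\in\mathbb C$ be distinct with $\alpha_1+\alpha_2+\alpha_3=0$ and $|\mathrm{Re}\,\alpha_1|,|\mathrm{Re}\,\alpha_2|<\epsilon/1000$. Write $s=\sigma+it$; $\int_{(c)}$ is the integral over the upward line of real part $c$. Let $W_\mu(y)=2\sqrt y\,K_\mu(2\pi y)$ with $K_\mu$ the modified Bessel function of the second kind, $$h(y)=H^\flat(y)=\frac1{4\pi i}\int_{(0)}H(\mu)W_\mu(y)\frac{d\mu}{|\Gamma(\mu)|^2},\qquad \widetilde h(w)=\int_0^\infty h(y)y^{w}\frac{dy}{y}.$$ For the Weyl elements $w_2,w_4,w_\ell$ let $\alpha^{w}=(\alpha_1^w,\alpha_2^w,\alpha_3^w)$ be $(\alpha_2,\alpha_1,\alpha_3)$, $(\alpha_3,\alpha_1,\alpha_2)$, $(\alpha_3,\alpha_2,\alpha_1)$ respectively. Define $$(J_\alpha h)(s;w)=\int_0^\infty\!\!\int_0^\infty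 h(y_1)\,y_1^{s-\frac{\alpha_3^w}2}y_0^{2s-\alpha_3^w}(1+y_0^2)^{-\frac34(1-\alpha_3^w)}\,W_{(\alpha_1^w-\alpha_2^w)/2}\!\left(y_1\sqrt{1+y_0^2}\right)\frac{dy_0\,dy_1}{y_0y_1^2},$$ $$(\mathcal F_\alpha H)(s_0,s)=\sqrt\pi\int_{(\eta-\frac12)}\widetilde h\!\left(s-s_1-\tfrac12\right)\pi^{-s_1}\frac{\prod_{i=1}^3\Gamma\left(\frac{s_1-\alpha_i}2\right)}{\Gamma\left(\frac{1+s_1}2-s_0\right)}\int_{(\epsilon)}\frac{\Gamma\left(\frac u2\right)\Gamma\left(\frac{s_1-(s_0-u)}2+\frac12-s\right)\prod_{i=1}^3\Gamma\left(\frac{s_0-u+\alpha_i}2\right)\Gamma\left(s-\frac{s_0+u}2\right)}{\Gamma\left(\frac{1-u}2\right)\Gamma\left(\frac{s_0-u+s_1}2\right)}\frac{du}{2\pi i}\frac{ds_1}{2\pi i}.$$ **Theorem.** (1) Let $w\in\{w_2,w_4,w_\ell\}$. For $0<\sigma<1$ with $\sigma>-\mathrm{Re}\,\alpha_1^w$,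 $\sigma>-\mathrm{Re}\,\alpha_2^w$ and $\sigma<1-\mathrm{Re}\,\alpha_3^w$, the integral $(J_\alpha h)(s;w)$ converges absolutely and $$(J_\alpha h)(s;w)=\frac{\pi^{-(s-\alpha_3^w/2)}}8\,\Gamma\!\left(\tfrac{1+\alpha_2^w-\alpha_3^w}2\right)^{-1}\Gamma\!\left(\tfrac{1+\alpha_1^w-\alpha_3^w}2\right)^{-1}\int_{(0)}\frac{H(\mu)}{|\Gamma(\mu)|^2}\prod_\pm\Gamma\!\left(\tfrac{s\pm\mu+\alpha_1^w}2\right)\Gamma\!\left(\tfrac{s\pm\mu+\alpha_2^w}2\right)\Gamma\!\left(\tfrac{1-s\pm\mu-\alpha_3^w}2\right)\frac{d\mu}{2\pi i}.$$ (2) Let $i\in\{1,2,3\}$. The double integral defining $(\mathcal F_\alpha H)(1-\alpha_i,s)$ converges absolutely for $\frac12+\epsilon<\sigma<4$, and as a function of $s$ it continues to $\max(0,\mathrm{Re}\,\alpha_i)<\sigma<4$, holomorphically except for at most a simple pole at $s=(1-\alpha_i)/2$. For $0<\sigma<1$ with $\sigma>\mathrm{Re}\,\alpha_i$, $\sigma<1+\mathrm{Re}\,\alpha_j$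 for $j\ne i$, and $s\neq(1-\alpha_i)/2$, the continuation satisfies $$(\mathcal F_\alpha H)(1-\alpha_i,s)=\pi^{\frac12-s}\,\frac{\Gamma\left(s-\frac12+\frac{\alpha_i}2\right)}{\Gamma\left(1-s-\frac{\alpha_i}2\right)}\int_{(0)}\frac{H(\mu)}{|\Gamma(\mu)|^2}\prod_\pm\Gamma\!\left(\tfrac{s\pm\mu-\alpha_i}2\right)\prod_{j\ne i}\Gamma\!\left(\tfrac{1-s\pm\mu+\alpha_j}2\right)\frac{d\mu}{2\pi i}.$$ (3) The double integral defining $(\mathcal F_\alpha H)(2s-1,s)$ converges absolutely for $\frac12+\epsilon<\sigma<4$, and as a function of $s$ it continues to $0<\sigma<4$, holomorphically except for at most simple poles at $s=(1-\alpha_i)/2$, $i=1,2,3$. For $0<\sigma<1$ with $\sigma<1+\mathrm{Re}\,\alpha_i$ and $s\ne(1-\alpha_i)/2$ for all $i$, the continuation satisfies $$(\mathcal F_\alpha H)(2s-1,s)=\pi^{\frac12-s}\prod_{i=1}^3\frac{\Gamma\left(s-\frac12+\frac{\alpha_i}2\right)}{\Gamma\left(1-s-\frac{\alpha_i}2\right)}\int_{(0)}\frac{H(\mu)}{|\Gamma(\mu)|^2}\prod_{i=1}^3\prod_\pm\Gamma\!\left(\tfrac{1-s\pm\mu+\alpha_i}2\right)\frac{d\mu}{2\pi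 i}.$$ In each case the $\mu$-integral converges absolutely. If the $\alpha_i$ are purely imaginary, the conditions on $\sigma$ in (1), (2), (3) reduce to $0<\sigma<1$. -/

import Mathlib

open Complex MeasureTheory Set

noncomputable section

namespace MellinBarnesSwap

/-- The six elements of the Weyl group of `GL₃`. -/
inductive Weyl : Type
  | I | w2 | w3 | w4 | w5 | wl

/-- The action of the Weyl group on triples of Langlands parameters;
`α 0, α 1, α 2` are the parameters usually called `α₁, α₂, α₃`. -/
def Weyl.act : Weyl → (Fin 3 → ℂ) → (Fin 3 → ℂ)
  | .I, α => ![α 0, α 1, α 2]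
  | .w2, α => ![α 1, α 0, α 2]
  | .w3, α => ![α 0, α 2, α 1]
  | .w4, α => ![α 2, α 0, α 1]
  | .w5, α => ![α 1, α 2, α 0]
  | .wl, α => ![α 2, α 1, α 0]

/-- The fixed constant `ε = 1/100`. -/
def eps : ℝ := 1 / 100

/-- The class `𝒞_η` of test functions: `H` is holomorphic and even on the strip `|Re μ| < 2η`
and satisfies `H(μ) ≪ exp(-2π|μ|)` there. -/
structure TestClass (η : ℝ) (H : ℂ → ℂ) : Prop where
  holo : DifferentiableOn ℂ H {μ : ℂ | |μ.re| < 2 * η}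
  even : ∀ μ : ℂ, |μ.re| < 2 * η → H (-μ) = H μ
  decay : ∃ C : ℝ, ∀ μ : ℂ, |μ.re| < 2 * η → ‖H μ‖ ≤ C * Real.exp (-2 * Real.pi * ‖μ‖)

/-- The integral `∫_{(c)} f(z) dz / (2πi)` over the upward vertical line `Re z = c`. -/
def vint (c : ℝ) (f : ℂ → ℂ) : ℂ :=
  (1 / (2 * Real.pi) : ℂ) * ∫ v : ℝ, f ((c : ℂ) + (v : ℂ) * Complex.I)

/-- The modified Bessel function of the second kind,
`K_μ(x) = ∫_0^∞ exp(-x cosh t) cosh(μ t) dt` for `x > 0` and `μ ∈ ℂ`. -/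
def besselK (μ : ℂ) (x : ℝ) : ℂ :=
  ∫ t in Ioi (0 : ℝ), (Real.exp (-x * Real.cosh t) : ℂ) * Complex.cosh (μ * (t : ℂ))

/-- The Whittaker function of `GL₂(ℝ)`: `W_μ(y) = 2 √y K_μ(2πy)` for `y > 0`. -/
def whittaker (μ : ℂ) (y : ℝ) : ℂ :=
  2 * (Real.sqrt y : ℂ) * besselK μ (2 * Real.pi * y)

/-- The inverse Kontorovich-Lebedev transform
`H^♭(y) = (1/(4πi)) ∫_{(0)} H(μ) W_μ(y) dμ / |Γ(μ)|²`. -/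
def flat (H : ℂ → ℂ) (y : ℝ) : ℂ :=
  (1 / 2 : ℂ) * vint 0 (fun μ => H μ * whittaker μ y / ((‖Gamma μ‖ ^ 2 : ℝ) : ℂ))

/-- The integrand of `(J_α h)(s; w)` (as a function of `(y₀, y₁)`), where `β = α^w`. -/
def swapIntegrand (β : Fin 3 → ℂ) (h : ℝ → ℂ) (s : ℂ) (y₀ y₁ : ℝ) : ℂ :=
  h y₁ * (y₁ : ℂ) ^ (s - β 2 / 2) * (y₀ : ℂ) ^ (2 * s - β 2)
    * ((1 + y₀ ^ 2 : ℝ) : ℂ) ^ (-(3 / 4 : ℂ) * (1 - β 2))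
    * whittaker ((β 0 - β 1) / 2) (y₁ * Real.sqrt (1 + y₀ ^ 2))
    / ((y₀ : ℂ) * (y₁ : ℂ) ^ 2)

/-- The `1`-swap integral `(J_α h)(s; w)`. -/
def swapJ (α : Fin 3 → ℂ) (h : ℝ → ℂ) (s : ℂ) (w : Weyl) : ℂ :=
  ∫ y₁ in Ioi (0 : ℝ), ∫ y₀ in Ioi (0 : ℝ), swapIntegrand (w.act α) h s y₀ y₁

/-- The integrand (without the factor `√π`) of the Mellin-Barnes integral defining
`(ℱ_α H)(s₀, s)`, as a function of `(s₁, u)`. The Mellin transform of `h = H^♭` is Mathlib's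
`mellin h w = ∫_0^∞ h(y) y^{w-1} dy`. -/
def dualIntegrand (α : Fin 3 → ℂ) (H : ℂ → ℂ) (s₀ s s₁ u : ℂ) : ℂ :=
  mellin (flat H) (s - s₁ - 1 / 2) * (Real.pi : ℂ) ^ (-s₁)
    * ((∏ i, Gamma ((s₁ - α i) / 2)) / Gamma ((1 + s₁) / 2 - s₀))
    * ((Gamma (u / 2) * Gamma ((s₁ - (s₀ - u)) / 2 + 1 / 2 - s)
          * (∏ i, Gamma ((s₀ - u + α i) / 2)) * Gamma (s - (s₀ + u) / 2))
        / (Gamma ((1 - u) / 2) * Gamma ((s₀ - u + s₁) / 2)))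

/-- The dual transform `(ℱ_α H)(s₀, s)` for `H ∈ 𝒞_η`, as an iterated integral over the lines
`Re s₁ = η - 1/2` and `Re u = ε`. -/
def dualTransform (η : ℝ) (α : Fin 3 → ℂ) (H : ℂ → ℂ) (s₀ s : ℂ) : ℂ :=
  (Real.sqrt Real.pi : ℂ) *
    vint (η - 1 / 2) (fun s₁ => vint eps (fun u => dualIntegrand α H s₀ s s₁ u))

/-- Absolute convergence of the double integral defining `(ℱ_α H)(s₀, s)`. -/
def DualConverges (η : ℝ) (α : Fin 3 → ℂ) (H : ℂ → ℂ) (s₀ s : ℂ) : Prop :=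
  Integrable (fun p : ℝ × ℝ =>
    dualIntegrand α H s₀ s (((η - 1 / 2 : ℝ) : ℂ) + (p.1 : ℂ) * Complex.I)
      ((eps : ℂ) + (p.2 : ℂ) * Complex.I))

/-- `F` continues the function `f`, given on `U ⊆ V`, to the domain `V`; it is holomorphic on `V`
except for the points of `P`, at which it has at most simple poles. -/
structure IsContinuation (f F : ℂ → ℂ) (U V P : Set ℂ) : Prop where
  subset : U ⊆ V
  eqOn : EqOn F f U
  holo : DifferentiableOn ℂ F (V \ P)
  pole : ∀ p ∈ P, MeromorphicAt F p ∧ (-1 : WithTop ℤ) ≤ meromorphicOrderAt F p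

/-- The vertical strip `a < Re s < b`. -/
def strip (a b : ℝ) : Set ℂ := {s : ℂ | a < s.re ∧ s.re < b}

/-- The product `∏_± Γ((a ± μ)/2)`. -/
def gammaPM (a μ : ℂ) : ℂ := Gamma ((a + μ) / 2) * Gamma ((a - μ) / 2)

/-- The integrand of the `1`-swap Mellin-Barnes integral, where `β = α^w`. -/
def oneSwap (β : Fin 3 → ℂ) (H : ℂ → ℂ) (s μ : ℂ) : ℂ :=
  H μ / ((‖Gamma μ‖ ^ 2 : ℝ) : ℂ)
    * (gammaPM (s + β 0) μ * gammaPM (s + β 1) μ * gammaPM (1 - s - β 2) μ)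

/-- The integrand of the `2`-swap Mellin-Barnes integral. -/
def twoSwap (α : Fin 3 → ℂ) (i : Fin 3) (H : ℂ → ℂ) (s μ : ℂ) : ℂ :=
  H μ / ((‖Gamma μ‖ ^ 2 : ℝ) : ℂ)
    * (gammaPM (s - α i) μ * ∏ j ∈ Finset.univ.erase i, gammaPM (1 - s + α j) μ)

/-- The integrand of the `3`-swap Mellin-Barnes integral. -/
def threeSwap (α : Fin 3 → ℂ) (H : ℂ → ℂ) (s μ : ℂ) : ℂ :=
  H μ / ((‖Gamma μ‖ ^ 2 : ℝ) : ℂ) * ∏ i, gammaPM (1 - s + α i) μ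

end MellinBarnesSwap

end

/-!
On the line `Re μ = 0` one has `1 / |Γ(μ)|² = -μ sin(πμ) / π`, so the spectral weight
`H(μ) / |Γ(μ)|²` continues holomorphically to the strip where `H` lives, and it vanishes at the
integers. The moments against which the Taylor expansion of the exponential in the integral for
`K_μ` is paired are therefore zero, so that `H^♭(y) = O(y^N)` as `y → 0` for every integer
`N < 2η`, and the Mellin transform of `H^♭` is holomorphic in a wide half-plane.

Both transforms reduce to one-dimensional integrals
`∫ (mellin H^♭)(s - p - 1/2) π^(-p) Γ(a₁ + p/2) Γ(a₂ + p/2) Γ(a₃ + p/2) / Γ(e + p/2) dp` with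
`e = s + a₁ + a₂ + a₃`. For the one-swap integral, write the Whittaker function as an inverse
Mellin transform; the `y₀`-integral becomes a Beta function. For the dual transform at
`s₀ = 1 - αᵢ` or `s₀ = 2s - 1`, two Gamma factors of the `u`-integrand cancel and Barnes' second
lemma evaluates the `u`-integral. If the line of integration lies far enough to the left, the
Mellin transform may be written as an integral over `μ`, and Barnes' second lemma evaluates the
`p`-integral for each `μ`. Further to the right the integral still converges locally uniformly in
`s`, which gives the continuation; the poles come from the factors `Γ(s - (1 - αᵢ)/2)` in front
of it.
-/

namespace MellinBarnesSwap

/-! ### Integrals over vertical lines -/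

section VerticalIntegrals

lemma vint_congr {c : ℝ} {f g : ℂ → ℂ} (h : ∀ z : ℂ, z.re = c → f z = g z) :
    vint c f = vint c g := by
  simp only [vint]
  congr 2
  ext v
  exact h _ (by simp)

lemma vint_const_mul (c : ℝ) (a : ℂ) (f : ℂ → ℂ) :
    vint c (fun z => a * f z) = a * vint c f := by
  simp only [vint, integral_const_mul]
  ring

lemma vint_mul_const (c : ℝ) (f : ℂ → ℂ) (a : ℂ) :
    vint c (fun z => f z * a) = vint c f * a := by
  simp only [mul_comm _ a, vint_const_mul]

lemma vint_comp_add_left (c : ℝ) (d : ℂ) (f : ℂ → ℂ) :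
    vint c (fun z => f (d + z)) = vint (d.re + c) f := by
  simp only [vint]
  rw [← integral_add_left_eq_self (fun v : ℝ => f (((d.re + c : ℝ) : ℂ) + v * I)) d.im]
  congr 3
  ext v
  congr 1
  apply Complex.ext <;> simp

lemma vint_comp_neg (c : ℝ) (f : ℂ → ℂ) : vint c (fun z => f (-z)) = vint (-c) f := by
  simp only [vint]
  rw [← integral_neg_eq_self]
  congr 3
  ext v
  congr 1
  push_cast
  ring

lemma vint_comp_mul_left {b : ℝ} (hb : 0 < b) (c : ℝ) (f : ℂ → ℂ) :
    b * vint c (fun z => f (b * z)) = vint (b * c) f := by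
  have hscale := Measure.integral_comp_mul_left (fun v : ℝ => f ((b * c : ℝ) + v * I)) b
  have hline : ∀ v : ℝ, (b : ℂ) * (c + v * I) = (b * c : ℝ) + (b * v : ℝ) * I := by
    intro v
    push_cast
    ring
  have hb' : (b : ℂ) ≠ 0 := ofReal_ne_zero.mpr hb.ne'
  simp only [vint, hline, hscale, abs_inv, abs_of_pos hb, real_smul, ofReal_inv]
  rw [mul_left_comm, mul_inv_cancel_left₀ hb']

lemma integral_vint {X : Type*} [MeasurableSpace X] {m : Measure X} [SFinite m] {c : ℝ}
    {f : X → ℂ → ℂ}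
    (hf : Integrable (fun q : X × ℝ => f q.1 (c + q.2 * I)) (m.prod volume)) :
    ∫ x, vint c (f x) ∂m = vint c fun z => ∫ x, f x z ∂m := by
  simp only [vint, integral_const_mul]
  rw [integral_integral_swap hf]

lemma vint_comm {c d : ℝ} {f : ℂ → ℂ → ℂ}
    (hf : Integrable fun q : ℝ × ℝ => f (c + q.1 * I) (d + q.2 * I)) :
    vint c (fun z => vint d (f z)) = vint d fun w => vint c fun z => f z w := by
  have := integral_vint (f := fun (v : ℝ) w => f (c + v * I) w) hf
  simp only [vint] at this ⊢
  rw [this, integral_const_mul]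

lemma verticalIntegrable_of_norm_le {f : ℂ → ℂ} {c C : ℝ}
    (hf : Continuous fun v : ℝ => f (c + v * I))
    (hC : ∀ v : ℝ, ‖f (c + v * I)‖ ≤ C * (1 + v ^ 2)⁻¹) : VerticalIntegrable f c :=
  (integrable_inv_one_add_sq.const_mul C).mono' hf.aestronglyMeasurable (.of_forall hC)

lemma tendsto_horizontal_integral_zero {f : ℂ → ℂ} {a b C : ℝ} (hab : a ≤ b)
    (hC : ∀ z : ℂ, a ≤ z.re → z.re ≤ b → ‖f z‖ ≤ C * (1 + z.im ^ 2)⁻¹) :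
    Filter.Tendsto (fun T : ℝ => ∫ x in a..b, f (x + T * I)) (Filter.cocompact ℝ) (nhds 0) := by
  have hdecay : Filter.Tendsto (fun T : ℝ => C * (1 + T ^ 2)⁻¹ * |b - a|)
      (Filter.cocompact ℝ) (nhds 0) := by
    have hsq : Filter.Tendsto (fun T : ℝ => (1 + ‖T‖ ^ 2)⁻¹) (Filter.cocompact ℝ) (nhds 0) :=
      tendsto_inv_atTop_zero.comp (Filter.tendsto_atTop_add_const_left _ _
        ((Filter.tendsto_pow_atTop two_ne_zero).comp tendsto_norm_cocompact_atTop))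
    simpa using (hsq.const_mul C).mul_const |b - a|
  refine squeeze_zero_norm (fun T => ?_) hdecay
  refine intervalIntegral.norm_integral_le_of_norm_le_const fun x hx => ?_
  rw [uIoc_of_le hab] at hx
  simpa using hC (x + T * I) (by simpa using hx.1.le) (by simpa using hx.2)

lemma integral_vertical_sub_integral_vertical {f : ℂ → ℂ} {a b : ℝ} (hab : a ≤ b)
    (hf : DifferentiableOn ℂ f {z | a ≤ z.re ∧ z.re ≤ b}) (T : ℝ) :
    I • (∫ v in (-T)..T, f (b + v * I)) - I • (∫ v in (-T)..T, f (a + v * I)) =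
      (∫ x in a..b, f (x + T * I)) - ∫ x in a..b, f (x + (-T : ℝ) * I) := by
  have hrect := integral_boundary_rect_eq_zero_of_differentiableOn f ⟨a, -T⟩ ⟨b, T⟩ <|
    hf.mono fun z hz => by
      rw [mem_reProdIm, uIcc_of_le hab] at hz
      exact hz.1
  simp only at hrect
  linear_combination hrect

theorem vint_eq_vint_of_differentiableOn {f : ℂ → ℂ} {a b C : ℝ} (hab : a ≤ b)
    (hf : DifferentiableOn ℂ f {z | a ≤ z.re ∧ z.re ≤ b})
    (hC : ∀ z : ℂ, a ≤ z.re → z.re ≤ b → ‖f z‖ ≤ C * (1 + z.im ^ 2)⁻¹) :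
    vint a f = vint b f := by
  have hlim : ∀ c, a ≤ c → c ≤ b →
      Filter.Tendsto (fun T : ℝ => I • ∫ v in (-T)..T, f (c + v * I)) Filter.atTop
        (nhds (I • ∫ v : ℝ, f (c + v * I))) := fun c h₁ h₂ => by
    have hint : VerticalIntegrable f c := verticalIntegrable_of_norm_le
      (hf.continuousOn.comp_continuous (by fun_prop) fun v => by simp [h₁, h₂])
      fun v => by simpa using hC (c + v * I) (by simpa) (by simpa)
    exact (intervalIntegral_tendsto_integral hint Filter.tendsto_neg_atTop_atBot
      Filter.tendsto_id).const_smul I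
  have hhor := tendsto_horizontal_integral_zero hab hC
  have hzero := (hhor.mono_left atTop_le_cocompact).sub
    ((hhor.mono_left atBot_le_cocompact).comp Filter.tendsto_neg_atTop_atBot)
  have heq := tendsto_nhds_unique
    (((hlim b hab le_rfl).sub (hlim a le_rfl hab)).congr
      (integral_vertical_sub_integral_vertical hab hf)) hzero
  rw [sub_zero, ← smul_sub, smul_eq_mul, mul_eq_zero, or_iff_right I_ne_zero, sub_eq_zero] at heq
  rw [vint, vint, heq]

end VerticalIntegrals

section ParametricIntegrals

variable {β E : Type*} [MeasurableSpace β] {m : Measure β} [NormedAddCommGroup E] [NormedSpace ℂ E]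

lemma aestronglyMeasurable_of_hasDerivAt {U : Set ℂ} {f : ℂ → β → E} {f' : β → E} {s₀ : ℂ}
    (hU : U ∈ nhds s₀) (hm : ∀ s ∈ U, AEStronglyMeasurable (f s) m)
    (hf' : ∀ v, HasDerivAt (fun s => f s v) (f' v) s₀) : AEStronglyMeasurable f' m := by
  have hUne : U ∈ nhdsWithin s₀ {s₀}ᶜ := mem_nhdsWithin_of_mem_nhds hU
  have : (Filter.comap ((↑) : U → ℂ) (nhdsWithin s₀ {s₀}ᶜ)).NeBot :=
    Filter.NeBot.comap_of_range_mem inferInstance (by rwa [Subtype.range_coe])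
  refine aestronglyMeasurable_of_tendsto_ae (Filter.comap ((↑) : U → ℂ) (nhdsWithin s₀ {s₀}ᶜ))
    (f := fun s v => slope (fun z => f z v) s₀ s) (fun s => ?_) (.of_forall fun v => ?_)
  · simp only [slope, vsub_eq_sub]
    exact ((hm s s.2).sub (hm s₀ (mem_of_mem_nhds hU))).const_smul ((s : ℂ) - s₀)⁻¹
  · exact (hasDerivAt_iff_tendsto_slope.mp (hf' v)).comp Filter.tendsto_comap

theorem differentiableOn_integral_of_locally_dominated {U : Set ℂ}
    {f : ℂ → β → E} (hU : IsOpen U) (hm : ∀ s ∈ U, AEStronglyMeasurable (f s) m)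
    (hd : ∀ v, DifferentiableOn ℂ (fun s => f s v) U)
    (hb : ∀ s₀ ∈ U, ∃ r > 0, ∃ g : β → ℝ, Integrable g m ∧
      ∀ s ∈ Metric.ball s₀ r, ∀ v, ‖f s v‖ ≤ g v) :
    DifferentiableOn ℂ (fun s => ∫ v, f s v ∂m) U := by
  intro s₀ hs₀
  obtain ⟨r₁, hr₁, g, hg, hfg⟩ := hb s₀ hs₀
  obtain ⟨r, hr, hball⟩ := Metric.isOpen_iff.mp (Metric.isOpen_ball.inter hU) s₀
    ⟨Metric.mem_ball_self hr₁, hs₀⟩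
  have hsub : ∀ s ∈ Metric.ball s₀ (r / 2), Metric.closedBall s (r / 3) ⊆ Metric.ball s₀ r₁ ∩ U :=
    fun s hs => (Metric.closedBall_subset_ball' (by
      linarith [Metric.mem_ball.mp hs])).trans hball
  have hderiv : ∀ v, ∀ s ∈ Metric.ball s₀ (r / 2),
      HasDerivAt (fun s => f s v) (deriv (fun s => f s v) s) s := fun v s hs =>
    ((hd v).differentiableAt (hU.mem_nhds
      (hsub s hs (Metric.mem_closedBall_self (by positivity))).2)).hasDerivAt
  have hs₀r : s₀ ∈ Metric.ball s₀ (r / 2) := Metric.mem_ball_self (by positivity)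
  -- Cauchy's estimate on circles of radius `r / 3` dominates the derivative.
  have hcauchy : ∀ v, ∀ s ∈ Metric.ball s₀ (r / 2), ‖deriv (fun s => f s v) s‖ ≤ g v / (r / 3) := by
    intro v s hs
    refine norm_deriv_le_of_forall_mem_sphere_norm_le (by positivity) ?_ fun z hz =>
      hfg z (hsub s hs (Metric.sphere_subset_closedBall hz)).1 v
    refine DifferentiableOn.diffContOnCl ((hd v).mono ?_)
    rw [closure_ball _ (by positivity)]
    exact fun z hz => (hsub s hs hz).2
  exact (hasDerivAt_integral_of_dominated_loc_of_deriv_le (Metric.ball_mem_nhds s₀ (by positivity))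
    (Filter.eventually_of_mem (hU.mem_nhds hs₀) hm)
    (hg.mono' (hm s₀ hs₀) (.of_forall (hfg s₀ (Metric.mem_ball_self hr₁))))
    (aestronglyMeasurable_of_hasDerivAt (hU.mem_nhds hs₀) hm fun v => hderiv v s₀ hs₀r)
    (.of_forall hcauchy) (hg.div_const _)
    (.of_forall hderiv)).2.differentiableAt.differentiableWithinAt

end ParametricIntegrals

section MellinParseval

lemma mellinInv_eq_vint (κ : ℝ) (F : ℂ → ℂ) (x : ℝ) :
    mellinInv κ F x = vint κ fun z => (x : ℂ) ^ (-z) * F z := by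
  simp [mellinInv, vint]

lemma integrable_cpow_neg_mul_mul {κ : ℝ} {F : ℂ → ℂ} {k : ℝ → ℂ} (hF : VerticalIntegrable F κ)
    (hk : MellinConvergent k (1 - κ)) :
    Integrable (fun q : ℝ × ℝ => (q.1 : ℂ) ^ (-((κ : ℂ) + q.2 * I)) * F (κ + q.2 * I) * k q.1)
      ((volume.restrict (Ioi 0)).prod volume) := by
  have hpos : ∀ᵐ q : ℝ × ℝ ∂((volume.restrict (Ioi 0)).prod volume), 0 < q.1 :=
    Measure.quasiMeasurePreserving_fst.ae (ae_restrict_mem measurableSet_Ioi)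
  have hint := (Integrable.mul_prod (L := ℂ) hk hF).bdd_mul
    (f := fun q : ℝ × ℝ => (q.1 : ℂ) ^ (-((q.2 : ℂ) * I))) (c := 1)
    (Measurable.aestronglyMeasurable (by fun_prop)) <| by
      filter_upwards [hpos] with q hq
      simp [norm_cpow_eq_rpow_re_of_pos hq]
  refine hint.congr ?_
  filter_upwards [hpos] with q hq
  rw [neg_add, cpow_add _ _ (ofReal_ne_zero.mpr hq.ne'), smul_eq_mul, sub_sub_cancel_left]
  ring

theorem vint_mellin_mul_mellin {κ : ℝ} {f k : ℝ → ℂ} (hfc : ∀ x, 0 < x → ContinuousAt f x)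
    (hf : MellinConvergent f κ) (hF : VerticalIntegrable (mellin f) κ)
    (hk : MellinConvergent k (1 - κ)) :
    vint κ (fun z => mellin f z * mellin k (1 - z)) = ∫ x in Ioi (0 : ℝ), f x * k x := by
  calc vint κ (fun z => mellin f z * mellin k (1 - z))
      = vint κ (fun z => ∫ x in Ioi (0 : ℝ), (x : ℂ) ^ (-z) * mellin f z * k x) := by
        refine vint_congr fun z _ => ?_
        rw [mellin.eq_1 k, ← integral_const_mul, sub_sub_cancel_left]
        exact integral_congr_ae (.of_forall fun x => by simp only [smul_eq_mul]; ring)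
    _ = ∫ x in Ioi (0 : ℝ), mellinInv κ (mellin f) x * k x := by
        simp only [mellinInv_eq_vint, ← vint_mul_const]
        rw [integral_vint (integrable_cpow_neg_mul_mul hF hk)]
    _ = ∫ x in Ioi (0 : ℝ), f x * k x :=
        setIntegral_congr_fun measurableSet_Ioi fun x hx => by
          simp only [mellinInv_mellin_eq κ f hx hf hF (hfc x hx)]

end MellinParseval

/-! ### The Gamma and Beta functions -/

section GammaBounds

lemma norm_Gamma_le_Gamma_re {z : ℂ} (hz : 0 < z.re) : ‖Gamma z‖ ≤ Real.Gamma z.re := by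
  rw [Gamma_eq_integral hz, Real.Gamma_eq_integral hz, GammaIntegral]
  refine (norm_integral_le_integral_norm _).trans_eq ?_
  refine setIntegral_congr_fun measurableSet_Ioi fun x (hx : 0 < x) => ?_
  simp [norm_cpow_eq_rpow_re_of_pos hx, Complex.norm_exp]

lemma Gamma_le_Gamma_add_Gamma {x a b : ℝ} (ha : 0 < a) (hax : a ≤ x) (hxb : x ≤ b) :
    Real.Gamma x ≤ Real.Gamma a + Real.Gamma b := by
  have hx := ha.trans_le hax
  have hb := hx.trans_le hxb
  rw [Real.Gamma_eq_integral hx, Real.Gamma_eq_integral ha, Real.Gamma_eq_integral hb,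
    ← integral_add (Real.GammaIntegral_convergent ha) (Real.GammaIntegral_convergent hb)]
  refine setIntegral_mono_on (Real.GammaIntegral_convergent hx)
    ((Real.GammaIntegral_convergent ha).add (Real.GammaIntegral_convergent hb))
    measurableSet_Ioi fun t (ht : 0 < t) => ?_
  rw [← mul_add]
  refine mul_le_mul_of_nonneg_left ?_ (Real.exp_pos _).le
  rcases le_total t 1 with h | h
  · linarith [Real.rpow_le_rpow_of_exponent_ge ht h (by linarith : a - 1 ≤ x - 1),
      Real.rpow_nonneg ht.le (b - 1)]
  · linarith [Real.rpow_le_rpow_of_exponent_le h (by linarith : x - 1 ≤ b - 1),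
      Real.rpow_nonneg ht.le (a - 1)]

lemma norm_le_norm_add_one {z : ℂ} (hz : 0 ≤ z.re) : ‖z‖ ≤ ‖z + 1‖ := by
  rw [← abs_norm z, ← abs_norm (z + 1), ← sq_le_sq, Complex.sq_norm, Complex.sq_norm]
  simp only [normSq_apply, add_re, one_re, add_im, one_im]
  nlinarith

theorem exists_norm_Gamma_mul_pow_le (n : ℕ) {a b : ℝ} (ha : 0 < a) :
    ∃ C : ℝ, 0 ≤ C ∧ ∀ z : ℂ, a ≤ z.re → z.re ≤ b → ‖Gamma z‖ * (1 + ‖z‖) ^ n ≤ C := by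
  induction n generalizing b with
  | zero =>
    refine ⟨max 0 (Real.Gamma a + Real.Gamma b), le_max_left _ _, fun z h₁ h₂ => ?_⟩
    rw [pow_zero, mul_one]
    exact ((norm_Gamma_le_Gamma_re (ha.trans_le h₁)).trans
      (Gamma_le_Gamma_add_Gamma ha h₁ h₂)).trans (le_max_right _ _)
  | succ n ih =>
    obtain ⟨C, hC, hbound⟩ := ih (b := b + 1)
    refine ⟨C * (1 + 1 / a), by positivity, fun z h₁ h₂ => ?_⟩
    have hz : a ≤ ‖z‖ := h₁.trans (re_le_norm z)
    have hz₀ : z ≠ 0 := norm_pos_iff.mp (ha.trans_le hz)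
    have hshift := hbound (z + 1) (by simp; linarith) (by simpa)
    rw [Gamma_add_one _ hz₀, norm_mul] at hshift
    have hnorm : ‖z‖ ≤ ‖z + 1‖ := norm_le_norm_add_one (ha.le.trans h₁)
    have hone : 1 + ‖z‖ ≤ (1 + 1 / a) * ‖z‖ := by
      have : 1 ≤ 1 / a * ‖z‖ := by rwa [one_div, ← div_eq_inv_mul, one_le_div ha]
      linarith
    calc ‖Gamma z‖ * (1 + ‖z‖) ^ (n + 1) = ‖Gamma z‖ * (1 + ‖z‖) ^ n * (1 + ‖z‖) := by ring
      _ ≤ ‖Gamma z‖ * (1 + ‖z + 1‖) ^ n * ((1 + 1 / a) * ‖z‖) := by gcongr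
      _ = (‖z‖ * ‖Gamma z‖ * (1 + ‖z + 1‖) ^ n) * (1 + 1 / a) := by ring
      _ ≤ C * (1 + 1 / a) := by gcongr

lemma norm_betaIntegral_le {u v : ℂ} {δ : ℝ} (hδ : 0 < δ) (hu : δ ≤ u.re) (hv : δ ≤ v.re) :
    ‖betaIntegral u v‖ ≤
      ∫ x : ℝ in (0 : ℝ)..1, ‖(x : ℂ) ^ ((δ : ℂ) - 1) * (1 - (x : ℂ)) ^ ((δ : ℂ) - 1)‖ := by
  rw [betaIntegral]
  refine (intervalIntegral.norm_integral_le_integral_norm zero_le_one).trans ?_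
  refine intervalIntegral.integral_mono_on_of_le_Ioo zero_le_one
    (betaIntegral_convergent (hδ.trans_le hu) (hδ.trans_le hv)).norm
    (betaIntegral_convergent (u := δ) (v := δ) (by simpa) (by simpa)).norm fun x hx => ?_
  have hx' : 0 < 1 - x := by linarith [hx.2]
  have hcast : 1 - (x : ℂ) = ((1 - x : ℝ) : ℂ) := by push_cast; rfl
  rw [hcast, norm_mul, norm_mul, norm_cpow_eq_rpow_re_of_pos hx.1,
    norm_cpow_eq_rpow_re_of_pos hx', norm_cpow_eq_rpow_re_of_pos hx.1,
    norm_cpow_eq_rpow_re_of_pos hx']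
  simp only [sub_re, one_re, ofReal_re]
  exact mul_le_mul (Real.rpow_le_rpow_of_exponent_ge hx.1 hx.2.le (by linarith))
    (Real.rpow_le_rpow_of_exponent_ge hx' (by linarith [hx.1]) (by linarith))
    (Real.rpow_nonneg hx'.le _) (Real.rpow_nonneg hx.1.le _)

lemma exists_norm_Gamma_div_Gamma_le_const {δ : ℝ} (hδ : 0 < δ) (M : ℝ) :
    ∃ C : ℝ, 0 ≤ C ∧ ∀ X Y : ℂ, δ ≤ X.re → δ ≤ (Y - X).re → ‖Y - X‖ ≤ M →
      ‖Gamma X / Gamma Y‖ ≤ C := by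
  obtain ⟨K, hK⟩ := (isCompact_closedBall (0 : ℂ) M).exists_bound_of_continuousOn
    differentiable_one_div_Gamma.continuous.continuousOn
  refine ⟨(∫ x : ℝ in (0 : ℝ)..1, ‖(x : ℂ) ^ ((δ : ℂ) - 1) * (1 - (x : ℂ)) ^ ((δ : ℂ) - 1)‖) * |K|,
    mul_nonneg (intervalIntegral.integral_nonneg zero_le_one fun _ _ => norm_nonneg _)
      (abs_nonneg K), fun X Y hX hYX hM => ?_⟩
  have hbeta := betaIntegral_eq_Gamma_mul_div X (Y - X) (hδ.trans_le hX) (hδ.trans_le hYX)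
  rw [add_sub_cancel] at hbeta
  have hquot : Gamma X / Gamma Y = betaIntegral X (Y - X) * (Gamma (Y - X))⁻¹ := by
    rw [hbeta]; field_simp [Gamma_ne_zero_of_re_pos (hδ.trans_le hYX)]
  rw [hquot, norm_mul]
  exact mul_le_mul (norm_betaIntegral_le hδ hX hYX)
    ((hK (Y - X) (by simpa using hM)).trans (le_abs_self _)) (norm_nonneg _)
    ((norm_nonneg _).trans (norm_betaIntegral_le hδ hX hYX))

theorem exists_norm_Gamma_div_Gamma_le (k : ℕ) {δ : ℝ} (hδ : 0 < δ) (M : ℝ) :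
    ∃ C : ℝ, 0 ≤ C ∧ ∀ X Y : ℂ, k + δ ≤ X.re → δ ≤ (Y - X).re + k → ‖Y - X‖ ≤ M →
      ‖Gamma X / Gamma Y‖ ≤ C * (1 + ‖X‖) ^ k := by
  induction k generalizing M with
  | zero => simpa using exists_norm_Gamma_div_Gamma_le_const hδ M
  | succ k ih =>
    obtain ⟨C, hC, hbound⟩ := ih (M + 1)
    refine ⟨C * 2 ^ k, by positivity, fun X Y hX hYX hM => ?_⟩
    push_cast at hX hYX
    have hX₀ : 0 < (X - 1).re := by
      have : (0 : ℝ) ≤ k := k.cast_nonneg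
      simp only [sub_re, one_re]
      linarith
    have hnorm : ‖Y - (X - 1)‖ ≤ M + 1 := by
      rw [show Y - (X - 1) = (Y - X) + 1 by ring]
      exact (norm_add_le _ _).trans (by simpa)
    have hprev := hbound (X - 1) Y (by simp; linarith) (by simp at hYX ⊢; linarith) hnorm
    have hrec : Gamma X = (X - 1) * Gamma (X - 1) := by
      rw [← Gamma_add_one _ (ne_zero_of_re_pos hX₀), sub_add_cancel]
    have hX₁ : ‖X - 1‖ ≤ 1 + ‖X‖ := by
      simpa [add_comm] using norm_sub_le X 1
    rw [hrec, mul_div_assoc, norm_mul]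
    calc ‖X - 1‖ * ‖Gamma (X - 1) / Gamma Y‖ ≤ (1 + ‖X‖) * (C * (1 + ‖X - 1‖) ^ k) := by gcongr
      _ ≤ (1 + ‖X‖) * (C * (2 * (1 + ‖X‖)) ^ k) := by gcongr; linarith [norm_nonneg X]
      _ = C * 2 ^ k * (1 + ‖X‖) ^ (k + 1) := by rw [mul_pow]; ring

end GammaBounds

section GammaLines

lemma differentiableAt_Gamma_of_re_pos {z : ℂ} (hz : 0 < z.re) : DifferentiableAt ℂ Gamma z :=
  differentiableAt_Gamma z fun m hm => by
    have hre : z.re = -m := by simp [hm]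
    linarith [(m.cast_nonneg : (0 : ℝ) ≤ m)]

lemma continuous_Gamma_comp {X : Type*} [TopologicalSpace X] {f : X → ℂ} (hf : Continuous f)
    (hpos : ∀ x, 0 < (f x).re) : Continuous fun x => Gamma (f x) :=
  continuous_iff_continuousAt.mpr fun x =>
    (differentiableAt_Gamma_of_re_pos (hpos x)).continuousAt.comp (f := f) hf.continuousAt

lemma integrable_mul_Gamma {X : Type*} [TopologicalSpace X] [MeasurableSpace X]
    [OpensMeasurableSpace X] [SecondCountableTopologyEither X ℂ] {m : Measure X} {g f : X → ℂ}
    {x : ℝ} (hg : Integrable g m) (hf : Continuous f) (hx : 0 < x) (hre : ∀ v, (f v).re = x) :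
    Integrable (fun v => g v * Gamma (f v)) m :=
  hg.mul_bdd (continuous_Gamma_comp hf fun v => hx.trans_eq (hre v).symm).aestronglyMeasurable
    (.of_forall fun v => (norm_Gamma_le_Gamma_re (hx.trans_eq (hre v).symm)).trans_eq
      (congrArg Real.Gamma (hre v)))

lemma integrable_Gamma_line {a : ℂ} {b : ℝ} (hb : b ≠ 0) (ha : 0 < a.re) :
    Integrable fun v : ℝ => Gamma (a + (b * v : ℝ) * I) := by
  obtain ⟨C, -, hbound⟩ := exists_norm_Gamma_mul_pow_le 2 (b := a.re) ha
  have hmaj : Integrable fun v : ℝ => C * (1 + (a.im + b * v) ^ 2)⁻¹ :=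
    ((integrable_inv_one_add_sq.comp_add_left a.im).comp_mul_left' hb).const_mul C
  refine hmaj.mono' (continuous_Gamma_comp (by fun_prop) (by simp [ha])).aestronglyMeasurable
    (.of_forall fun v => ?_)
  set z : ℂ := a + (b * v : ℝ) * I with hz
  have him : (a.im + b * v) ^ 2 ≤ ‖z‖ ^ 2 :=
    sq_le_sq.mpr (by simpa [hz] using abs_im_le_norm z)
  rw [← div_eq_mul_inv, le_div_iff₀ (by positivity)]
  refine (mul_le_mul_of_nonneg_left ?_ (norm_nonneg _)).trans
    (hbound z (by simp [hz]) (by simp [hz]))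
  nlinarith [norm_nonneg z]

lemma verticalIntegrable_Gamma_add {a : ℂ} {c : ℝ} (ha : 0 < a.re + c) :
    VerticalIntegrable (fun z => Gamma (a + z)) c :=
  (integrable_Gamma_line one_ne_zero (a := a + c) (by simpa)).congr
    (.of_forall fun v => by simp [add_assoc])

lemma verticalIntegrable_mul_Gamma_add {g : ℂ → ℂ} {a : ℂ} {c : ℝ} (hg : VerticalIntegrable g c)
    (ha : 0 < a.re + c) : VerticalIntegrable (fun z => g z * Gamma (a + z)) c :=
  integrable_mul_Gamma hg (by fun_prop) ha (by simp)

lemma verticalIntegrable_mul_Gamma_sub {g : ℂ → ℂ} {a : ℂ} {c : ℝ} (hg : VerticalIntegrable g c)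
    (ha : 0 < a.re - c) : VerticalIntegrable (fun z => g z * Gamma (a - z)) c :=
  integrable_mul_Gamma hg (by fun_prop) ha (by simp)

end GammaLines

section BetaMellin

lemma cpow_eq_exp_log {r : ℝ} (hr : 0 < r) (a : ℂ) : (r : ℂ) ^ a = cexp (Real.log r * a) := by
  rw [cpow_def_of_ne_zero (ofReal_ne_zero.mpr hr.ne'), ofReal_log hr.le]

lemma image_div_one_sub_Ioo : (fun t : ℝ => t / (1 - t)) '' Ioo 0 1 = Ioi 0 := by
  ext x
  constructor
  · rintro ⟨t, ht, rfl⟩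
    exact div_pos ht.1 (by linarith [ht.2])
  · intro (hx : 0 < x)
    refine ⟨x / (1 + x), ⟨by positivity, by rw [div_lt_one (by positivity)]; linarith⟩, ?_⟩
    field_simp
    ring

lemma injOn_div_one_sub : InjOn (fun t : ℝ => t / (1 - t)) (Ioo 0 1) := by
  intro t ht t' ht' h
  have h₁ : 1 - t ≠ 0 := by linarith [ht.2]
  have h₂ : 1 - t' ≠ 0 := by linarith [ht'.2]
  rw [div_eq_div_iff h₁ h₂] at h
  linarith

lemma hasDerivAt_div_one_sub {t : ℝ} (ht : 1 - t ≠ 0) :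
    HasDerivAt (fun t : ℝ => t / (1 - t)) (1 / (1 - t) ^ 2) t := by
  refine ((hasDerivAt_id t).div ((hasDerivAt_id t).const_sub 1) ht).congr_deriv ?_
  simp

lemma mellin_kernel_div_one_sub (p w : ℂ) {t : ℝ} (ht : t ∈ Ioo (0 : ℝ) 1) :
    |1 / (1 - t) ^ 2| •
        (((t / (1 - t) : ℝ) : ℂ) ^ (w - 1) • ((1 + t / (1 - t) : ℝ) : ℂ) ^ (-p)) =
      (t : ℂ) ^ (w - 1) * (1 - (t : ℂ)) ^ (p - w - 1) := by
  have h₁ : 0 < 1 - t := by linarith [ht.2]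
  have hadd : 1 + t / (1 - t) = (1 - t)⁻¹ := by field_simp; ring
  have hcast : 1 - (t : ℂ) = ((1 - t : ℝ) : ℂ) := by push_cast; rfl
  have hjac : |1 / (1 - t) ^ 2| = Real.exp (Real.log (1 - t) * (-2)) := by
    rw [abs_of_pos (by positivity), mul_comm, ← Real.log_rpow h₁, Real.exp_log (by positivity),
      Real.rpow_neg h₁.le]
    simp
  rw [hadd, hcast, hjac, cpow_eq_exp_log (inv_pos.mpr h₁) (-p), cpow_eq_exp_log h₁,
    cpow_eq_exp_log ht.1, cpow_eq_exp_log (div_pos ht.1 h₁), Real.log_inv,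
    Real.log_div ht.1.ne' h₁.ne', real_smul, smul_eq_mul, ofReal_exp]
  simp only [← Complex.exp_add]
  congr 1
  push_cast
  ring

theorem hasMellin_one_add_cpow {p w : ℂ} (hw : 0 < w.re) (hp : w.re < p.re) :
    HasMellin (fun x : ℝ => ((1 + x : ℝ) : ℂ) ^ (-p)) w (Gamma w * Gamma (p - w) / Gamma p) := by
  have hpw : 0 < (p - w).re := by simpa using hp
  have hder : ∀ t ∈ Ioo (0 : ℝ) 1,
      HasDerivWithinAt (fun t : ℝ => t / (1 - t)) (1 / (1 - t) ^ 2) (Ioo 0 1) t := fun t ht =>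
    (hasDerivAt_div_one_sub (by linarith [ht.2])).hasDerivWithinAt
  constructor
  · rw [MellinConvergent, ← image_div_one_sub_Ioo,
      integrableOn_image_iff_integrableOn_abs_deriv_smul measurableSet_Ioo hder injOn_div_one_sub]
    exact ((intervalIntegrable_iff_integrableOn_Ioo_of_le zero_le_one).mp
      (betaIntegral_convergent hw hpw)).congr_fun
        (fun t ht => (mellin_kernel_div_one_sub p w ht).symm) measurableSet_Ioo
  · have hbeta := betaIntegral_eq_Gamma_mul_div w (p - w) hw hpw
    rw [add_sub_cancel] at hbeta
    rw [mellin, ← image_div_one_sub_Ioo,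
      integral_image_eq_integral_abs_deriv_smul measurableSet_Ioo hder injOn_div_one_sub,
      setIntegral_congr_fun measurableSet_Ioo fun t ht => mellin_kernel_div_one_sub p w ht,
      ← integral_Ioc_eq_integral_Ioo, ← intervalIntegral.integral_of_le zero_le_one, ← hbeta,
      betaIntegral]

lemma hasMellin_cpow_mul_one_add_cpow {a p w : ℂ} (hw : 0 < (a + w).re)
    (hp : (a + w).re < p.re) :
    HasMellin (fun x : ℝ => (x : ℂ) ^ a • ((1 + x : ℝ) : ℂ) ^ (-p)) w
      (Gamma (a + w) * Gamma (p - a - w) / Gamma p) := by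
  rw [add_comm a w] at hw hp
  have h := hasMellin_one_add_cpow hw hp
  refine ⟨MellinConvergent.cpow_smul.mpr h.1, ?_⟩
  rw [mellin_cpow_smul, h.2, add_comm a w, sub_sub p a w, add_comm a w]

end BetaMellin

/-! ### Barnes' lemmas -/

section Barnes

lemma setIntegral_beta_kernel_mul_beta_kernel {a b p q : ℂ} (ha : 0 < (a + b).re)
    (hb : (a + b).re < (p + q).re) :
    ∫ x in Ioi (0 : ℝ), ((x : ℂ) ^ a • ((1 + x : ℝ) : ℂ) ^ (-p)) *
        ((x : ℂ) ^ (b - 1) • ((1 + x : ℝ) : ℂ) ^ (-q)) =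
      Gamma (a + b) * Gamma (p + q - (a + b)) / Gamma (p + q) := by
  rw [← (hasMellin_one_add_cpow ha hb).2, mellin]
  refine setIntegral_congr_fun measurableSet_Ioi fun x (hx : 0 < x) => ?_
  have hx₀ : (x : ℂ) ≠ 0 := ofReal_ne_zero.mpr hx.ne'
  have hx₁ : ((1 + x : ℝ) : ℂ) ≠ 0 := ofReal_ne_zero.mpr (by positivity)
  simp only [smul_eq_mul]
  rw [add_sub_assoc, cpow_add _ _ hx₀, neg_add (p : ℂ) q, cpow_add _ _ hx₁]
  exact mul_mul_mul_comm _ _ _ _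

theorem barnes_first {a₁ a₂ b₁ b₂ : ℂ} (ha₁ : 0 < a₁.re) (ha₂ : 0 < a₂.re) (hb₁ : 0 < b₁.re)
    (hb₂ : 0 < b₂.re) :
    vint 0 (fun z => Gamma (a₁ + z) * Gamma (a₂ + z) * Gamma (b₁ - z) * Gamma (b₂ - z)) =
      Gamma (a₁ + b₁) * Gamma (a₁ + b₂) * Gamma (a₂ + b₁) * Gamma (a₂ + b₂) /
        Gamma (a₁ + a₂ + b₁ + b₂) := by
  have hp₀ : Gamma (a₁ + b₁) ≠ 0 := Gamma_ne_zero_of_re_pos (by simp; linarith)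
  have hq₀ : Gamma (a₂ + b₂) ≠ 0 := Gamma_ne_zero_of_re_pos (by simp; linarith)
  set f : ℝ → ℂ := fun x => (x : ℂ) ^ a₁ • ((1 + x : ℝ) : ℂ) ^ (-(a₁ + b₁))
  set k : ℝ → ℂ := fun x => (x : ℂ) ^ (b₂ - 1) • ((1 + x : ℝ) : ℂ) ^ (-(a₂ + b₂))
  have hfm : ∀ z : ℂ, z.re = 0 →
      HasMellin f z (Gamma (a₁ + z) * Gamma (b₁ - z) / Gamma (a₁ + b₁)) := fun z hz => by
    have h := hasMellin_cpow_mul_one_add_cpow (a := a₁) (p := a₁ + b₁) (w := z) (by simpa [hz])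
      (by simp [hz]; linarith)
    rwa [add_sub_cancel_left] at h
  have hkm : ∀ z : ℂ, z.re = 0 →
      HasMellin k (1 - z) (Gamma (b₂ - z) * Gamma (a₂ + z) / Gamma (a₂ + b₂)) := fun z hz => by
    have h := hasMellin_cpow_mul_one_add_cpow (a := b₂ - 1) (p := a₂ + b₂) (w := 1 - z)
      (by simpa [hz]) (by simp [hz]; linarith)
    rwa [show b₂ - 1 + (1 - z) = b₂ - z by ring,
      show a₂ + b₂ - (b₂ - 1) - (1 - z) = a₂ + z by ring] at h
  have hfc : ∀ x : ℝ, 0 < x → ContinuousAt f x := fun x hx =>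
    (continuousAt_ofReal_cpow_const _ _ (Or.inr hx.ne')).fun_smul <|
      ContinuousAt.comp (f := fun x : ℝ => 1 + x)
        (continuousAt_ofReal_cpow_const _ _ (Or.inr (by positivity))) (by fun_prop)
  have hF : VerticalIntegrable (mellin f) 0 := by
    have hint := verticalIntegrable_mul_Gamma_sub (verticalIntegrable_Gamma_add (c := 0)
      (by simpa using ha₁)) (by simpa using hb₁)
    refine (hint.div_const (Gamma (a₁ + b₁))).congr (.of_forall fun v => ?_)
    exact ((hfm _ (by simp : (((0 : ℝ) : ℂ) + v * I).re = 0)).2).symm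
  have hparseval := vint_mellin_mul_mellin hfc (by simpa using (hfm 0 zero_re).1) hF
    (by simpa using (hkm 0 zero_re).1)
  rw [setIntegral_beta_kernel_mul_beta_kernel (by simp; linarith) (by simp; linarith),
    show a₁ + b₁ + (a₂ + b₂) - (a₁ + b₂) = a₂ + b₁ by ring,
    show a₁ + b₁ + (a₂ + b₂) = a₁ + a₂ + b₁ + b₂ by ring] at hparseval
  calc _ = Gamma (a₁ + b₁) * Gamma (a₂ + b₂) * vint 0 (fun z => mellin f z * mellin k (1 - z)) := by
        rw [← vint_const_mul]
        refine vint_congr fun z hz => ?_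
        rw [(hfm z hz).2, (hkm z hz).2]
        field_simp
    _ = _ := by
        rw [hparseval]
        ring

lemma vint_vint_mul_Gamma_comm {Q P : ℂ → ℂ} {c d : ℝ} {a : ℂ} (hQ : VerticalIntegrable Q c)
    (hP : VerticalIntegrable P d) (ha : 0 < a.re + c - d) :
    vint c (fun z => Q z * vint d fun w => P w * Gamma (a + z - w)) =
      vint d fun w => P w * vint c fun z => Q z * Gamma (a + z - w) := by
  simp only [← vint_const_mul, ← mul_assoc]
  rw [vint_comm (integrable_mul_Gamma (hQ.mul_prod hP) (by fun_prop) ha (by simp))]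
  simp only [mul_comm (P _)]

lemma vint_vint_barnes_left {a₁ a₂ a₃ b₁ b₂ : ℂ} {δ : ℝ} (hδ : 0 < δ) (hδ₁ : δ < a₁.re)
    (hδ₂ : δ < a₂.re) (hc : 0 < (a₃ + b₁ + b₂ + δ).re) :
    vint 0 (fun z => Gamma (a₃ + z) * Gamma (b₁ - z) * Gamma (b₂ - z) * vint 0 fun w =>
        Gamma (a₁ - δ + w) * Gamma (a₂ - δ + w) * Gamma (a₃ + b₁ + b₂ + δ - w) *
          Gamma (δ + z - w)) =
      Gamma (a₂ + a₃ + b₁ + b₂) * Gamma (a₁ + a₃ + b₁ + b₂) *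
        vint 0 (fun z => Gamma (a₁ + z) * Gamma (a₂ + z) * Gamma (a₃ + z) * Gamma (b₁ - z) *
          Gamma (b₂ - z) / Gamma (a₁ + a₂ + a₃ + b₁ + b₂ + z)) := by
  rw [← vint_const_mul]
  refine vint_congr fun z hz => ?_
  rw [barnes_first (by simpa) (by simpa) hc (by simpa [hz])]
  ring_nf

lemma vint_vint_barnes_right {a₁ a₂ a₃ b₁ b₂ : ℂ} {δ : ℝ} (hδ : 0 < δ) (hδ₁ : δ < a₁.re)
    (hδ₂ : δ < a₂.re) (ha₃ : 0 < a₃.re) (hb₁ : 0 < b₁.re) (hb₂ : 0 < b₂.re) :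
    vint 0 (fun w => Gamma (a₁ - δ + w) * Gamma (a₂ - δ + w) * Gamma (a₃ + b₁ + b₂ + δ - w) *
        vint 0 fun z => Gamma (a₃ + z) * Gamma (b₁ - z) * Gamma (b₂ - z) * Gamma (δ + z - w)) =
      Gamma (a₃ + b₁) * Gamma (a₃ + b₂) * (Gamma (a₁ + b₁) * Gamma (a₁ + b₂) * Gamma (a₂ + b₁) *
        Gamma (a₂ + b₂) / Gamma (a₁ + a₂ + b₁ + b₂)) := by
  have inner : ∀ w : ℂ, w.re = 0 →
      vint 0 (fun z => Gamma (a₃ + z) * Gamma (b₁ - z) * Gamma (b₂ - z) * Gamma (δ + z - w)) =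
      Gamma (a₃ + b₁) * Gamma (a₃ + b₂) * Gamma (b₁ + δ - w) * Gamma (b₂ + δ - w) /
        Gamma (a₃ + b₁ + b₂ + δ - w) := fun w hw => by
    have h := barnes_first (a₂ := δ - w) ha₃ (by simpa [hw]) hb₁ hb₂
    rw [vint_congr fun z _ => by rw [sub_add_eq_add_sub, mul_right_comm (Gamma (a₃ + z)),
      mul_right_comm (Gamma (a₃ + z) * Gamma (b₁ - z))]] at h
    rw [h]
    ring_nf
  have outer := barnes_first (a₁ := a₁ - δ) (a₂ := a₂ - δ) (b₁ := b₁ + δ) (b₂ := b₂ + δ)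
    (by simpa) (by simpa) (by simp; linarith) (by simp; linarith)
  calc _ = vint 0 (fun w => Gamma (a₃ + b₁) * Gamma (a₃ + b₂) * (Gamma (a₁ - δ + w) *
          Gamma (a₂ - δ + w) * Gamma (b₁ + δ - w) * Gamma (b₂ + δ - w))) := by
        refine vint_congr fun w hw => ?_
        have h₀ : Gamma (a₃ + b₁ + b₂ + δ - w) ≠ 0 :=
          Gamma_ne_zero_of_re_pos (by simp [hw]; linarith)
        rw [inner w hw]
        field_simp
    _ = _ := by
        rw [vint_const_mul, outer]
        ring_nf

-- Barnes' first lemma expands the quotient of Gamma functions as an integral over `w`, and after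
-- exchanging the integrals evaluates the integral over `z`; what remains is a third instance of it.
lemma barnes_second_zero {a₁ a₂ a₃ b₁ b₂ : ℂ} (ha₁ : 0 < a₁.re) (ha₂ : 0 < a₂.re)
    (ha₃ : 0 < a₃.re) (hb₁ : 0 < b₁.re) (hb₂ : 0 < b₂.re) :
    vint 0 (fun z => Gamma (a₁ + z) * Gamma (a₂ + z) * Gamma (a₃ + z) * Gamma (b₁ - z) *
        Gamma (b₂ - z) / Gamma (a₁ + a₂ + a₃ + b₁ + b₂ + z)) =
      Gamma (a₁ + b₁) * Gamma (a₁ + b₂) * Gamma (a₂ + b₁) * Gamma (a₂ + b₂) * Gamma (a₃ + b₁) *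
        Gamma (a₃ + b₂) / (Gamma (a₂ + a₃ + b₁ + b₂) * Gamma (a₁ + a₃ + b₁ + b₂) *
          Gamma (a₁ + a₂ + b₁ + b₂)) := by
  obtain ⟨δ, hδ, hδm⟩ := exists_between (lt_min ha₁ ha₂)
  obtain ⟨hδ₁, hδ₂⟩ := lt_min_iff.mp hδm
  have hN₁ : Gamma (a₁ + a₃ + b₁ + b₂) ≠ 0 := Gamma_ne_zero_of_re_pos (by simp; linarith)
  have hN₂ : Gamma (a₂ + a₃ + b₁ + b₂) ≠ 0 := Gamma_ne_zero_of_re_pos (by simp; linarith)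
  have hc : 0 < (a₃ + b₁ + b₂ + δ).re := by simp; linarith
  have hz : VerticalIntegrable (fun z => Gamma (a₃ + z) * Gamma (b₁ - z) * Gamma (b₂ - z)) 0 :=
    verticalIntegrable_mul_Gamma_sub (verticalIntegrable_mul_Gamma_sub
      (verticalIntegrable_Gamma_add (by simpa)) (by simpa)) (by simpa)
  have hw : VerticalIntegrable (fun w => Gamma (a₁ - δ + w) * Gamma (a₂ - δ + w) *
      Gamma (a₃ + b₁ + b₂ + δ - w)) 0 :=
    verticalIntegrable_mul_Gamma_sub (verticalIntegrable_mul_Gamma_add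
      (verticalIntegrable_Gamma_add (by simpa)) (by simpa)) (by simpa using hc)
  have hswap := vint_vint_mul_Gamma_comm hz hw (a := δ) (by simpa)
  rw [vint_vint_barnes_left hδ hδ₁ hδ₂ hc, vint_vint_barnes_right hδ hδ₁ hδ₂ ha₃ hb₁ hb₂,
    mul_comm, ← eq_div_iff (mul_ne_zero hN₂ hN₁)] at hswap
  rw [hswap]
  ring

theorem barnes_second {a₁ a₂ a₃ b₁ b₂ : ℂ} {c : ℝ} (ha₁ : 0 < a₁.re + c) (ha₂ : 0 < a₂.re + c)
    (ha₃ : 0 < a₃.re + c) (hb₁ : c < b₁.re) (hb₂ : c < b₂.re) :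
    vint c (fun z => Gamma (a₁ + z) * Gamma (a₂ + z) * Gamma (a₃ + z) * Gamma (b₁ - z) *
        Gamma (b₂ - z) / Gamma (a₁ + a₂ + a₃ + b₁ + b₂ + z)) =
      Gamma (a₁ + b₁) * Gamma (a₁ + b₂) * Gamma (a₂ + b₁) * Gamma (a₂ + b₂) * Gamma (a₃ + b₁) *
        Gamma (a₃ + b₂) / (Gamma (a₂ + a₃ + b₁ + b₂) * Gamma (a₁ + a₃ + b₁ + b₂) *
          Gamma (a₁ + a₂ + b₁ + b₂)) := by
  have h := barnes_second_zero (a₁ := a₁ + c) (a₂ := a₂ + c) (a₃ := a₃ + c) (b₁ := b₁ - c)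
    (b₂ := b₂ - c) (by simpa) (by simpa) (by simpa) (by simpa) (by simpa)
  have hshift := vint_comp_add_left 0 c fun z => Gamma (a₁ + z) * Gamma (a₂ + z) * Gamma (a₃ + z) *
    Gamma (b₁ - z) * Gamma (b₂ - z) / Gamma (a₁ + a₂ + a₃ + b₁ + b₂ + z)
  rw [ofReal_re, add_zero] at hshift
  rw [← hshift]
  convert h using 1
  · exact vint_congr fun z _ => by ring_nf
  · ring_nf

end Barnes

/-! ### The modified Bessel function of the second kind -/

section BesselK

lemma mellin_kernel_exp (f : ℝ → ℂ) (w : ℂ) (t : ℝ) :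
    |Real.exp t| • ((Real.exp t : ℂ) ^ (w - 1) • f (Real.exp t)) =
      cexp (w * t) * f (Real.exp t) := by
  rw [abs_of_pos (Real.exp_pos t), cpow_eq_exp_log (Real.exp_pos t), Real.log_exp, real_smul,
    smul_eq_mul, ofReal_exp, ← mul_assoc, ← Complex.exp_add]
  ring_nf

lemma hasMellin_iff_exp {f : ℝ → ℂ} {w m : ℂ} :
    HasMellin f w m ↔ (Integrable fun t : ℝ => cexp (w * t) * f (Real.exp t)) ∧
      ∫ t : ℝ, cexp (w * t) * f (Real.exp t) = m := by
  have himage : Real.exp '' univ = Ioi 0 := by rw [image_univ, Real.range_exp]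
  have hderiv : ∀ t ∈ univ, HasDerivWithinAt Real.exp (Real.exp t) univ t := fun t _ =>
    (Real.hasDerivAt_exp t).hasDerivWithinAt
  rw [HasMellin, MellinConvergent, mellin, ← himage,
    integrableOn_image_iff_integrableOn_abs_deriv_smul .univ hderiv Real.exp_injective.injOn,
    integral_image_eq_integral_abs_deriv_smul .univ hderiv Real.exp_injective.injOn,
    integrableOn_congr_fun (fun t _ => mellin_kernel_exp f w t) .univ,
    setIntegral_congr_fun .univ (fun t _ => mellin_kernel_exp f w t),
    integrableOn_univ, setIntegral_univ]

lemma hasMellin_congr {f g : ℝ → ℂ} {w m : ℂ} (h : ∀ x, 0 < x → f x = g x)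
    (hg : HasMellin g w m) : HasMellin f w m := by
  have hker : EqOn (fun x : ℝ => (x : ℂ) ^ (w - 1) • f x) (fun x => (x : ℂ) ^ (w - 1) • g x)
      (Ioi 0) := fun x hx => by simp only [h x hx]
  exact ⟨hg.1.congr_fun hker.symm measurableSet_Ioi,
    (setIntegral_congr_fun measurableSet_Ioi hker).trans hg.2⟩

theorem hasMellin_one_add_sq_cpow {q c : ℂ} (hc : 0 < c.re) (hq : c.re < q.re) :
    HasMellin (fun y : ℝ => ((1 + y ^ 2 : ℝ) : ℂ) ^ (-q)) (2 * c)
      (1 / 2 * (Gamma c * Gamma (q - c) / Gamma q)) := by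
  have h := hasMellin_one_add_cpow hc hq
  have hhalf : 2 * c / ((2 : ℝ) : ℂ) = c := by push_cast; field_simp
  simp only [← Real.rpow_two]
  constructor
  · rw [MellinConvergent.comp_rpow (f := fun x : ℝ => ((1 + x : ℝ) : ℂ) ^ (-q)) two_ne_zero, hhalf]
    exact h.1
  · rw [mellin_comp_rpow (fun x : ℝ => ((1 + x : ℝ) : ℂ) ^ (-q)), hhalf, h.2, real_smul]
    norm_num

lemma exp_mul_one_add_exp_sq_cpow (p μ : ℂ) (t : ℝ) :
    cexp ((p + μ) * t) * ((1 + Real.exp t ^ 2 : ℝ) : ℂ) ^ (-p) =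
      2 ^ (-p) * (cexp (μ * t) * (Real.cosh t : ℂ) ^ (-p)) := by
  have hcosh : 1 + Real.exp t ^ 2 = Real.exp t * (2 * Real.cosh t) := by
    rw [Real.cosh_eq, Real.exp_neg]
    field_simp
    ring
  have htwo : (2 : ℂ) ^ (-p) = ((2 : ℝ) : ℂ) ^ (-p) := by simp
  rw [hcosh, htwo, ofReal_mul, mul_cpow_ofReal_nonneg (Real.exp_pos t).le
    (by have := Real.cosh_pos t; positivity), ofReal_mul, mul_cpow_ofReal_nonneg zero_le_two
    (Real.cosh_pos t).le, cpow_eq_exp_log (Real.exp_pos t), Real.log_exp, ← mul_assoc,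
    ← Complex.exp_add]
  ring_nf

theorem integrable_exp_mul_cosh_cpow {p μ : ℂ} (hp : |μ.re| < p.re) :
    Integrable fun t : ℝ => cexp (μ * t) * (Real.cosh t : ℂ) ^ (-p) := by
  obtain ⟨h₁, h₂⟩ := abs_lt.mp hp
  have h := (hasMellin_iff_exp.mp (hasMellin_one_add_sq_cpow (q := p) (c := (p + μ) / 2)
    (by simp; linarith) (by simp; linarith))).1
  simp only [mul_div_cancel₀ (p + μ) two_ne_zero, exp_mul_one_add_exp_sq_cpow] at h
  exact (integrable_const_mul_iff (by simp [cpow_eq_zero_iff]) _).mp h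

theorem integral_exp_mul_cosh_cpow {p μ : ℂ} (hp : |μ.re| < p.re) :
    ∫ t : ℝ, cexp (μ * t) * (Real.cosh t : ℂ) ^ (-p) =
      2 ^ (p - 1) * (Gamma ((p + μ) / 2) * Gamma ((p - μ) / 2) / Gamma p) := by
  obtain ⟨h₁, h₂⟩ := abs_lt.mp hp
  have h := (hasMellin_iff_exp.mp (hasMellin_one_add_sq_cpow (q := p) (c := (p + μ) / 2)
    (by simp; linarith) (by simp; linarith))).2
  simp only [mul_div_cancel₀ (p + μ) two_ne_zero, exp_mul_one_add_exp_sq_cpow] at h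
  rw [integral_const_mul, cpow_neg, inv_mul_eq_iff_eq_mul₀ (by simp [cpow_eq_zero_iff])] at h
  rw [h, cpow_sub _ _ two_ne_zero, cpow_one]
  ring_nf

-- The bound is `u / κ ≤ exp (u / κ)`, raised to the power `κ`.
lemma exp_neg_le_mul_rpow_neg {κ u : ℝ} (hκ : 0 < κ) (hu : 0 < u) :
    Real.exp (-u) ≤ κ ^ κ * u ^ (-κ) := by
  have h : (u / κ) ^ κ ≤ Real.exp u := calc
    (u / κ) ^ κ ≤ Real.exp (u / κ) ^ κ := by
      gcongr
      linarith [Real.add_one_le_exp (u / κ)]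
    _ = Real.exp u := by rw [← Real.exp_mul, div_mul_cancel₀ _ hκ.ne']
  rw [Real.exp_neg, Real.rpow_neg hu.le, ← div_eq_mul_inv, ← inv_div, ← Real.div_rpow hu.le hκ.le]
  exact inv_anti₀ (by positivity) h

lemma norm_exp_neg_mul_mul_exp (x : ℝ) (μ : ℂ) (t : ℝ) :
    ‖(Real.exp (-x * Real.cosh t) : ℂ) * cexp (μ * t)‖ =
      Real.exp (-x * Real.cosh t) * Real.exp (μ.re * t) := by
  rw [norm_mul, norm_real, Real.norm_of_nonneg (Real.exp_pos _).le, Complex.norm_exp]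
  simp

lemma norm_besselK_kernel_le {κ x : ℝ} (hκ : 0 < κ) (hx : 0 < x) (μ : ℂ) (t : ℝ) :
    ‖(Real.exp (-x * Real.cosh t) : ℂ) * cexp (μ * t)‖ ≤
      κ ^ κ * x ^ (-κ) * ‖cexp (μ * t) * (Real.cosh t : ℂ) ^ (-κ : ℂ)‖ := by
  have hcosh := Real.cosh_pos t
  have h := exp_neg_le_mul_rpow_neg hκ (mul_pos hx hcosh)
  rw [norm_mul, norm_mul, norm_real, Real.norm_of_nonneg (Real.exp_pos _).le,
    norm_cpow_eq_rpow_re_of_pos hcosh, neg_mul]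
  calc _ ≤ κ ^ κ * (x * Real.cosh t) ^ (-κ) * ‖cexp (μ * t)‖ := by gcongr
    _ = _ := by rw [Real.mul_rpow hx.le hcosh.le, neg_re, ofReal_re]; ring

lemma integrable_besselK_kernel {x : ℝ} (hx : 0 < x) (μ : ℂ) :
    Integrable fun t : ℝ => (Real.exp (-x * Real.cosh t) : ℂ) * cexp (μ * t) := by
  obtain ⟨κ, hκ⟩ := exists_gt |μ.re|
  have hκ₀ : 0 < κ := (abs_nonneg _).trans_lt hκ
  exact ((integrable_exp_mul_cosh_cpow (p := κ) (by simpa)).norm.const_mul _).mono'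
    (Continuous.aestronglyMeasurable (by fun_prop)) (.of_forall (norm_besselK_kernel_le hκ₀ hx μ))

lemma integral_eq_setIntegral_Ioi_add_comp_neg {f : ℝ → ℂ} (hf : Integrable f) :
    ∫ t, f t = ∫ t in Ioi (0 : ℝ), (f t + f (-t)) := by
  rw [integral_add hf.integrableOn hf.comp_neg.integrableOn, integral_comp_neg_Ioi, neg_zero,
    add_comm, ← compl_Iic, integral_add_compl measurableSet_Iic hf]

theorem besselK_eq_integral_exp (μ : ℂ) {x : ℝ} (hx : 0 < x) :
    besselK μ x = 1 / 2 * ∫ t : ℝ, (Real.exp (-x * Real.cosh t) : ℂ) * cexp (μ * t) := by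
  rw [besselK, integral_eq_setIntegral_Ioi_add_comp_neg (integrable_besselK_kernel hx μ),
    ← integral_const_mul]
  congr 1 with t
  rw [Real.cosh_neg, Complex.cosh]
  push_cast
  ring_nf

lemma stronglyMeasurable_besselK : StronglyMeasurable fun q : ℂ × ℝ => besselK q.1 q.2 := by
  unfold besselK
  refine StronglyMeasurable.integral_prod_right' (f := fun r : (ℂ × ℝ) × ℝ =>
    (Real.exp (-r.1.2 * Real.cosh r.2) : ℂ) * Complex.cosh (r.1.1 * (r.2 : ℂ))) ?_
  exact Continuous.stronglyMeasurable (by fun_prop)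

theorem norm_besselK_le (μ : ℂ) {x : ℝ} (hx : 0 < x) : ‖besselK μ x‖ ≤ ‖besselK μ.re x‖ := by
  have hreal : besselK μ.re x =
      ((1 / 2 * ∫ t : ℝ, Real.exp (-x * Real.cosh t) * Real.exp (μ.re * t) : ℝ) : ℂ) := by
    rw [besselK_eq_integral_exp _ hx, ofReal_mul, ← integral_complex_ofReal]
    push_cast
    rfl
  rw [hreal, norm_real, norm_mul, Real.norm_of_nonneg (integral_nonneg fun t => by positivity),
    besselK_eq_integral_exp μ hx, norm_mul]
  gcongr
  · norm_num
  · exact (norm_integral_le_integral_norm _).trans_eq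
      (integral_congr_ae (.of_forall (norm_exp_neg_mul_mul_exp x μ)))

lemma continuousAt_besselK (μ : ℂ) {x : ℝ} (hx : 0 < x) : ContinuousAt (besselK μ) x := by
  have h : ContinuousAt (fun y : ℝ =>
      1 / 2 * ∫ t : ℝ, (Real.exp (-y * Real.cosh t) : ℂ) * cexp (μ * t)) x := by
    refine continuousAt_const.mul (continuousAt_of_dominated (bound := fun t =>
      ‖(Real.exp (-(x / 2) * Real.cosh t) : ℂ) * cexp (μ * t)‖) ?_ ?_ ?_ ?_)
    · exact .of_forall fun y => Continuous.aestronglyMeasurable (by fun_prop)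
    · filter_upwards [lt_mem_nhds (half_lt_self hx)] with y hy
      refine .of_forall fun t => ?_
      have := Real.cosh_pos t
      rw [norm_exp_neg_mul_mul_exp, norm_exp_neg_mul_mul_exp]
      gcongr
    · exact (integrable_besselK_kernel (half_pos hx) μ).norm
    · exact .of_forall fun t => by fun_prop
  refine h.congr ?_
  filter_upwards [lt_mem_nhds hx] with y hy using (besselK_eq_integral_exp μ hy).symm

section

variable {α : Type*} [MeasurableSpace α] {ν : Measure α} [SFinite ν] {g : α → ℂ} {c : α → ℝ}
  {p : ℂ}

lemma hasMellin_exp_neg_mul {c : ℝ} (hc : 0 < c) (hp : 0 < p.re) :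
    HasMellin (fun x : ℝ => (Real.exp (-x * c) : ℂ)) p (Gamma p * (c : ℂ) ^ (-p)) := by
  have hconv : MellinConvergent (fun x : ℝ => (Real.exp (-x) : ℂ)) p :=
    (GammaIntegral_convergent hp).congr_fun
      (fun x _ => by simp only [smul_eq_mul, mul_comm]) measurableSet_Ioi
  have hmellin : mellin (fun x : ℝ => (Real.exp (-x) : ℂ)) p = Gamma p := by
    rw [← GammaIntegral_eq_mellin, Gamma_eq_integral hp]
  have hscale : (fun x : ℝ => (Real.exp (-x * c) : ℂ)) =
      fun x => (fun y : ℝ => (Real.exp (-y) : ℂ)) (c * x) := by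
    funext x
    simp only [neg_mul, mul_comm x c]
  rw [hscale]
  refine ⟨(MellinConvergent.comp_mul_left hc).mpr hconv, ?_⟩
  rw [mellin_comp_mul_left (fun y : ℝ => (Real.exp (-y) : ℂ)) _ hc, hmellin, smul_eq_mul, mul_comm]

lemma integral_norm_cpow_mul_exp_neg_mul {c : ℝ} (hc : 0 < c) (hp : 0 < p.re) :
    ∫ x in Ioi (0 : ℝ), ‖(x : ℂ) ^ (p - 1) * (Real.exp (-x * c) : ℂ)‖ =
      Real.Gamma p.re * ‖(c : ℂ) ^ (-p)‖ := by
  rw [norm_cpow_eq_rpow_re_of_pos hc, neg_re, Real.rpow_neg hc.le, ← Real.inv_rpow hc.le,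
    ← one_div, mul_comm, ← Real.integral_rpow_mul_exp_neg_mul_Ioi hp hc]
  refine setIntegral_congr_fun measurableSet_Ioi fun x hx => ?_
  simp only [norm_mul, norm_cpow_eq_rpow_re_of_pos hx, norm_real,
    Real.norm_of_nonneg (Real.exp_pos _).le, sub_re, one_re, neg_mul, mul_comm x c]

lemma integrable_prod_cpow_mul_exp_neg_mul (hc : ∀ t, 0 < c t) (hcm : Measurable c)
    (hgm : AEStronglyMeasurable g ν) (hp : 0 < p.re)
    (hg : Integrable (fun t => g t * (c t : ℂ) ^ (-p)) ν) :
    Integrable (fun q : ℝ × α => (q.1 : ℂ) ^ (p - 1) * ((Real.exp (-q.1 * c q.2) : ℂ) * g q.2))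
      ((volume.restrict (Ioi 0)).prod ν) := by
  have hmeas : AEStronglyMeasurable
      (fun q : ℝ × α => (q.1 : ℂ) ^ (p - 1) * ((Real.exp (-q.1 * c q.2) : ℂ) * g q.2))
      ((volume.restrict (Ioi 0)).prod ν) := by
    refine AEStronglyMeasurable.mul (Measurable.aestronglyMeasurable (by fun_prop))
      (AEStronglyMeasurable.mul (Measurable.aestronglyMeasurable (by fun_prop)) hgm.comp_snd)
  rw [integrable_prod_iff' hmeas]
  constructor
  · exact .of_forall fun t =>
      ((hasMellin_exp_neg_mul (hc t) hp).1.mul_const (g t)).congr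
        (.of_forall fun x => by simp only [smul_eq_mul, mul_assoc])
  · refine (hg.norm.const_mul (Real.Gamma p.re)).congr (.of_forall fun t => ?_)
    simp only [← mul_assoc, norm_mul _ (g t)]
    rw [integral_mul_const, integral_norm_cpow_mul_exp_neg_mul (hc t) hp, norm_mul]
    ring

theorem hasMellin_integral_exp_neg_mul (hc : ∀ t, 0 < c t) (hcm : Measurable c)
    (hgm : AEStronglyMeasurable g ν) (hp : 0 < p.re)
    (hg : Integrable (fun t => g t * (c t : ℂ) ^ (-p)) ν) :
    HasMellin (fun x : ℝ => ∫ t, (Real.exp (-x * c t) : ℂ) * g t ∂ν) p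
      (Gamma p * ∫ t, g t * (c t : ℂ) ^ (-p) ∂ν) := by
  have hint := integrable_prod_cpow_mul_exp_neg_mul hc hcm hgm hp hg
  rw [HasMellin, MellinConvergent, mellin]
  simp only [smul_eq_mul, ← integral_const_mul]
  refine ⟨hint.integral_prod_left, ?_⟩
  rw [integral_integral_swap hint]
  congr 1 with t
  simp only [← mul_assoc]
  rw [integral_mul_const]
  have := (hasMellin_exp_neg_mul (hc t) hp).2
  simp only [mellin, smul_eq_mul] at this
  rw [this]
  ring

end

theorem hasMellin_besselK {p μ : ℂ} (hp : |μ.re| < p.re) :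
    HasMellin (besselK μ) p (2 ^ (p - 2) * (Gamma ((p + μ) / 2) * Gamma ((p - μ) / 2))) := by
  have hp₀ : 0 < p.re := (abs_nonneg _).trans_lt hp
  have h := hasMellin_integral_exp_neg_mul (c := Real.cosh) (ν := volume) Real.cosh_pos
    Real.measurable_cosh (Continuous.aestronglyMeasurable (by fun_prop)) hp₀
    (integrable_exp_mul_cosh_cpow hp)
  have hhalf := hasMellin_const_smul h.1 (1 / 2 : ℂ)
  rw [h.2, integral_exp_mul_cosh_cpow hp] at hhalf
  have hΓ := Gamma_ne_zero_of_re_pos hp₀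
  have hvalue : (1 / 2 : ℂ) • (Gamma p * (2 ^ (p - 1) *
      (Gamma ((p + μ) / 2) * Gamma ((p - μ) / 2) / Gamma p))) =
      2 ^ (p - 2) * (Gamma ((p + μ) / 2) * Gamma ((p - μ) / 2)) := by
    rw [smul_eq_mul, show p - 1 = (p - 2) + 1 by ring, cpow_add _ _ two_ne_zero, cpow_one]
    field_simp
  rw [hvalue] at hhalf
  exact hasMellin_congr (fun x hx => besselK_eq_integral_exp μ hx) hhalf

end BesselK

/-! ### The spectral density and its Fourier transform -/

/-- The function `-H(μ) μ sin(πμ) / π`, entire in the factor next to `H`, which agrees with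
`H(μ) / |Γ(μ)|²` on the imaginary axis and allows contours to be moved off that axis. -/
noncomputable def spectral (H : ℂ → ℂ) (μ : ℂ) : ℂ :=
  H μ * (-μ * Complex.sin (Real.pi * μ) / Real.pi)

/-- The Fourier transform of the spectral density along the imaginary axis. -/
noncomputable def spectralFourier (H : ℂ → ℂ) (t : ℝ) : ℂ :=
  vint 0 fun μ => spectral H μ * cexp (μ * t)

lemma Gamma_ne_zero_of_re_eq_zero {z : ℂ} (hz : z.re = 0) (h₀ : z ≠ 0) : Gamma z ≠ 0 := by
  refine Gamma_ne_zero fun m hm => h₀ ?_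
  have hm₀ : (m : ℝ) = 0 := by simpa [hm] using hz
  simp [hm, show (m : ℂ) = 0 by exact_mod_cast hm₀]

theorem inv_norm_Gamma_sq {μ : ℂ} (hμ : μ.re = 0) :
    ((‖Gamma μ‖ ^ 2 : ℝ) : ℂ)⁻¹ = -μ * Complex.sin (Real.pi * μ) / Real.pi := by
  rcases eq_or_ne μ 0 with rfl | h₀
  · simp
  have hconj : (starRingEnd ℂ) μ = -μ := by
    apply Complex.ext <;> simp [hμ]
  have hsq : ((‖Gamma μ‖ ^ 2 : ℝ) : ℂ) = Gamma μ * Gamma (-μ) := by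
    rw [← hconj, Gamma_conj, mul_conj, Complex.normSq_eq_norm_sq]
  have hrefl := Gamma_mul_Gamma_one_sub μ
  rw [show 1 - μ = -μ + 1 by ring, Gamma_add_one _ (neg_ne_zero.mpr h₀)] at hrefl
  have hΓ : Gamma μ * Gamma (-μ) ≠ 0 := mul_ne_zero (Gamma_ne_zero_of_re_eq_zero hμ h₀)
    (Gamma_ne_zero_of_re_eq_zero (by simp [hμ]) (by simpa))
  have hpi : (Real.pi : ℂ) ≠ 0 := ofReal_ne_zero.mpr Real.pi_ne_zero
  have hsin : Complex.sin (Real.pi * μ) ≠ 0 := fun h => by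
    rw [h, div_zero] at hrefl
    exact mul_ne_zero hΓ (neg_ne_zero.mpr h₀) (by rw [← hrefl]; ring)
  rw [hsq]
  refine inv_eq_of_mul_eq_one_right ?_
  rw [eq_div_iff hsin] at hrefl
  rw [← mul_div_assoc, div_eq_one_iff_eq hpi]
  linear_combination hrefl

theorem div_norm_Gamma_sq {μ : ℂ} (hμ : μ.re = 0) (H : ℂ → ℂ) :
    H μ / ((‖Gamma μ‖ ^ 2 : ℝ) : ℂ) = spectral H μ := by
  rw [div_eq_mul_inv, inv_norm_Gamma_sq hμ, spectral]

lemma norm_sin_le_exp (z : ℂ) : ‖Complex.sin z‖ ≤ Real.exp ‖z‖ := by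
  have h₁ : ‖cexp (-z * I)‖ ≤ Real.exp ‖z‖ := (norm_exp_le_exp_norm _).trans (by simp)
  have h₂ : ‖cexp (z * I)‖ ≤ Real.exp ‖z‖ := (norm_exp_le_exp_norm _).trans (by simp)
  rw [Complex.sin, norm_div, norm_mul, norm_I, mul_one, Complex.norm_ofNat]
  linarith [norm_sub_le (cexp (-z * I)) (cexp (z * I))]

lemma norm_neg_mul_sin_div_pi_le (μ : ℂ) :
    ‖-μ * Complex.sin (Real.pi * μ) / Real.pi‖ ≤ ‖μ‖ * Real.exp (Real.pi * ‖μ‖) := by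
  have hsin : ‖Complex.sin (Real.pi * μ)‖ ≤ Real.exp (Real.pi * ‖μ‖) := by
    simpa [abs_of_pos Real.pi_pos] using norm_sin_le_exp (Real.pi * μ)
  rw [norm_div, norm_mul, norm_neg, norm_real, Real.norm_of_nonneg Real.pi_pos.le]
  refine (div_le_self (by positivity) (by linarith [Real.pi_gt_three])).trans ?_
  gcongr

lemma mul_one_add_sq_le_mul_exp {r : ℝ} (hr : 0 ≤ r) : r * (1 + r ^ 2) ≤ 7 * Real.exp r := by
  have hlin := Real.add_one_le_exp r
  have hcube : r ^ 3 / 6 ≤ Real.exp r := by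
    simpa [Nat.factorial] using Real.pow_div_factorial_le_exp r hr 3
  nlinarith

lemma spectral_intCast (H : ℂ → ℂ) (n : ℤ) : spectral H n = 0 := by
  rw [spectral, mul_comm (Real.pi : ℂ), Complex.sin_int_mul_pi]
  simp

namespace TestClass

section

variable {η : ℝ} {H : ℂ → ℂ}

theorem differentiableOn_spectral (hH : TestClass η H) :
    DifferentiableOn ℂ (spectral H) {μ : ℂ | |μ.re| < 2 * η} :=
  hH.holo.mul (Differentiable.differentiableOn (by fun_prop))

theorem spectral_neg (hH : TestClass η H) {μ : ℂ} (hμ : |μ.re| < 2 * η) :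
    spectral H (-μ) = spectral H μ := by
  simp [spectral, hH.even μ hμ]

theorem exists_norm_spectral_le (hH : TestClass η H) :
    ∃ C : ℝ, 0 ≤ C ∧ ∀ μ : ℂ, |μ.re| < 2 * η → ‖spectral H μ‖ ≤ C * (1 + μ.im ^ 2)⁻¹ := by
  obtain ⟨C, hC⟩ := hH.decay
  refine ⟨|C| * 7, by positivity, fun μ hμ => ?_⟩
  have him : μ.im ^ 2 ≤ ‖μ‖ ^ 2 := sq_le_sq.mpr (by rw [abs_norm]; exact abs_im_le_norm μ)
  have hdecay : ‖H μ‖ ≤ |C| * Real.exp (-2 * Real.pi * ‖μ‖) :=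
    (hC μ hμ).trans (by gcongr; exact le_abs_self C)
  have hpoly : ‖μ‖ * (1 + ‖μ‖ ^ 2) ≤ 7 * Real.exp (Real.pi * ‖μ‖) := by
    refine (mul_one_add_sq_le_mul_exp (norm_nonneg μ)).trans ?_
    gcongr
    nlinarith [Real.pi_gt_three, norm_nonneg μ]
  rw [← div_eq_mul_inv, le_div_iff₀ (by positivity)]
  calc ‖spectral H μ‖ * (1 + μ.im ^ 2)
      ≤ |C| * Real.exp (-2 * Real.pi * ‖μ‖) * (‖μ‖ * Real.exp (Real.pi * ‖μ‖))
          * (1 + ‖μ‖ ^ 2) := by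
        rw [spectral, norm_mul]
        gcongr
        exact norm_neg_mul_sin_div_pi_le μ
    _ = |C| * Real.exp (-2 * Real.pi * ‖μ‖) * Real.exp (Real.pi * ‖μ‖)
          * (‖μ‖ * (1 + ‖μ‖ ^ 2)) := by ring
    _ ≤ |C| * Real.exp (-2 * Real.pi * ‖μ‖) * Real.exp (Real.pi * ‖μ‖)
          * (7 * Real.exp (Real.pi * ‖μ‖)) := by gcongr
    _ = |C| * 7 * (Real.exp (-2 * Real.pi * ‖μ‖) * Real.exp (Real.pi * ‖μ‖)
          * Real.exp (Real.pi * ‖μ‖)) := by ring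
    _ = |C| * 7 := by
        rw [← Real.exp_add, ← Real.exp_add]
        ring_nf
        rw [Real.exp_zero, mul_one]

theorem continuous_spectral_line (hH : TestClass η H) {c : ℝ} (hc : |c| < 2 * η) :
    Continuous fun v : ℝ => spectral H (c + v * I) :=
  hH.differentiableOn_spectral.continuousOn.comp_continuous (by fun_prop) fun v => by simpa

theorem verticalIntegrable_spectral (hH : TestClass η H) {c : ℝ} (hc : |c| < 2 * η) :
    VerticalIntegrable (spectral H) c := by
  obtain ⟨C, -, h⟩ := hH.exists_norm_spectral_le
  exact verticalIntegrable_of_norm_le (hH.continuous_spectral_line hc) fun v => by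
    simpa using h (c + v * I) (by simpa)

theorem spectralFourier_neg (hH : TestClass η H) (hη : 0 < η) (t : ℝ) :
    spectralFourier H (-t) = spectralFourier H t := by
  simp only [spectralFourier, vint]
  rw [← integral_neg_eq_self]
  congr 2 with v
  have := hH.spectral_neg (μ := v * I) (by simp; linarith)
  simp only [ofReal_zero, zero_add, ofReal_neg, neg_mul, this]
  ring_nf

lemma vint_spectral_mul_exp_congr (hH : TestClass η H) {a b : ℝ} (hab : a ≤ b)
    (ha : |a| < 2 * η) (hb : |b| < 2 * η) (t : ℝ) :
    vint a (fun μ => spectral H μ * cexp (μ * t)) =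
      vint b (fun μ => spectral H μ * cexp (μ * t)) := by
  obtain ⟨C, hC₀, hC⟩ := hH.exists_norm_spectral_le
  have hre : ∀ z : ℂ, a ≤ z.re → z.re ≤ b → |z.re| < 2 * η := fun z h₁ h₂ =>
    abs_lt.mpr ⟨(abs_lt.mp ha).1.trans_le h₁, h₂.trans_lt (abs_lt.mp hb).2⟩
  refine vint_eq_vint_of_differentiableOn (C := C * Real.exp (2 * η * |t|)) hab
    ((hH.differentiableOn_spectral.mono fun z hz => hre z hz.1 hz.2).mul
      (Differentiable.differentiableOn (by fun_prop))) fun z h₁ h₂ => ?_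
  have hexp : ‖cexp (z * t)‖ ≤ Real.exp (2 * η * |t|) := by
    rw [Complex.norm_exp, re_mul_ofReal]
    refine Real.exp_le_exp.mpr ((le_abs_self _).trans ?_)
    rw [abs_mul]
    have := (hre z h₁ h₂).le
    gcongr
  calc ‖spectral H z * cexp (z * t)‖
      ≤ C * (1 + z.im ^ 2)⁻¹ * Real.exp (2 * η * |t|) := by
        rw [norm_mul]
        gcongr
        exact hC z (hre z h₁ h₂)
    _ = C * Real.exp (2 * η * |t|) * (1 + z.im ^ 2)⁻¹ := by ring

theorem spectralFourier_eq_vint (hH : TestClass η H) {c : ℝ} (hc : |c| < 2 * η) (t : ℝ) :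
    spectralFourier H t = vint c fun μ => spectral H μ * cexp (μ * t) := by
  have h₀ : |(0 : ℝ)| < 2 * η := by rw [abs_zero]; exact (abs_nonneg c).trans_lt hc
  rcases le_total 0 c with h | h
  · exact hH.vint_spectral_mul_exp_congr h h₀ hc t
  · exact (hH.vint_spectral_mul_exp_congr h hc h₀ t).symm

theorem exists_norm_spectralFourier_le (hH : TestClass η H) {c : ℝ} (hc₀ : 0 ≤ c)
    (hc : c < 2 * η) :
    ∃ C : ℝ, 0 ≤ C ∧ ∀ t : ℝ, ‖spectralFourier H t‖ ≤ C * Real.exp (-c * |t|) := by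
  have hc' : |(-c)| < 2 * η := by rwa [abs_neg, abs_of_nonneg hc₀]
  refine ⟨‖(1 / (2 * Real.pi) : ℂ)‖ * ∫ v : ℝ, ‖spectral H ((-c : ℝ) + v * I)‖,
    mul_nonneg (norm_nonneg _) (integral_nonneg fun _ => norm_nonneg _), ?_⟩
  have hpos : ∀ t : ℝ, 0 ≤ t → ‖spectralFourier H t‖ ≤ ‖(1 / (2 * Real.pi) : ℂ)‖ *
      (∫ v : ℝ, ‖spectral H ((-c : ℝ) + v * I)‖) * Real.exp (-c * t) := fun t _ => by
    rw [hH.spectralFourier_eq_vint hc', vint, norm_mul, mul_assoc]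
    gcongr
    refine (norm_integral_le_integral_norm _).trans (le_of_eq ?_)
    rw [← integral_mul_const]
    congr 1 with v
    rw [norm_mul, Complex.norm_exp]
    simp
  intro t
  rcases le_total 0 t with h | h
  · rw [abs_of_nonneg h]
    exact hpos t h
  · rw [abs_of_nonpos h, ← hH.spectralFourier_neg (by linarith)]
    exact hpos (-t) (by linarith)

theorem continuous_spectralFourier (hH : TestClass η H) (hη : 0 < η) :
    Continuous (spectralFourier H) := by
  have hc : |(0 : ℝ)| < 2 * η := by rw [abs_zero]; linarith
  refine continuous_const.mul (continuous_of_dominated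
    (bound := fun v : ℝ => ‖spectral H ((0 : ℝ) + v * I)‖) (fun t => ?_)
    (fun t => .of_forall fun v => ?_) (hH.verticalIntegrable_spectral hc).norm
    (.of_forall fun v => by fun_prop))
  · exact ((hH.continuous_spectral_line hc).mul (by fun_prop)).aestronglyMeasurable
  · rw [norm_mul, Complex.norm_exp]
    simp

end

end TestClass

lemma integrable_exp_neg_mul_abs {c : ℝ} (hc : 0 < c) :
    Integrable fun t : ℝ => Real.exp (-c * |t|) := by
  have hpos : IntegrableOn (fun t : ℝ => Real.exp (-c * t)) (Ioi 0) := by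
    simpa using integrableOn_exp_mul_Ioi (by linarith : -c < 0) 0
  have hneg : IntegrableOn (fun t : ℝ => Real.exp (c * t)) (Iic 0) := by
    simpa using integrableOn_exp_mul_Iic hc 0
  rw [← integrableOn_univ, ← Iic_union_Ioi (a := (0 : ℝ))]
  refine (hneg.congr_fun (fun t ht => ?_) measurableSet_Iic).union
    (hpos.congr_fun (fun t ht => ?_) measurableSet_Ioi)
  · rw [abs_of_nonpos ht, neg_mul_neg]
  · beta_reduce
    rw [abs_of_pos ht]

lemma cosh_pow_eq_sum_exp (k : ℕ) (t : ℝ) : (Real.cosh t : ℂ) ^ k =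
    ∑ m ∈ Finset.range (k + 1), (2 : ℂ)⁻¹ ^ k * k.choose m *
      cexp (((2 * m - k : ℝ) : ℂ) * t) := by
  have hcosh : (Real.cosh t : ℂ) = 2⁻¹ * (cexp t + cexp (-t)) := by
    rw [ofReal_cosh, Complex.cosh]
    ring
  rw [hcosh, mul_pow, add_pow, Finset.mul_sum]
  refine Finset.sum_congr rfl fun m hm => ?_
  rw [← Complex.exp_nat_mul, ← Complex.exp_nat_mul, ← Complex.exp_add,
    Nat.cast_sub (Finset.mem_range_succ_iff.mp hm)]
  push_cast
  ring_nf

namespace TestClass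

section

variable {η : ℝ} {H : ℂ → ℂ}

theorem integrable_mul_spectralFourier (hH : TestClass η H) {c A : ℝ} (hc₀ : 0 ≤ c)
    (hc : c < 2 * η) {f : ℝ → ℂ} (hf : Continuous f)
    (hfA : ∀ t, ‖f t‖ ≤ A * Real.exp (c * |t|)) :
    Integrable fun t => f t * spectralFourier H t := by
  obtain ⟨d, hcd, hd⟩ := exists_between hc
  obtain ⟨C, -, hC⟩ := hH.exists_norm_spectralFourier_le (hc₀.trans hcd.le) hd
  refine ((integrable_exp_neg_mul_abs (sub_pos.mpr hcd)).const_mul (A * C)).mono'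
    (hf.mul (hH.continuous_spectralFourier (by linarith))).aestronglyMeasurable
    (.of_forall fun t => ?_)
  calc ‖f t * spectralFourier H t‖ ≤ A * Real.exp (c * |t|) * (C * Real.exp (-d * |t|)) := by
        rw [norm_mul]
        exact mul_le_mul (hfA t) (hC t) (norm_nonneg _) ((norm_nonneg _).trans (hfA t))
    _ = A * C * Real.exp (-(d - c) * |t|) := by
        rw [mul_mul_mul_comm, ← Real.exp_add]
        ring_nf

theorem integrable_exp_mul_spectralFourier (hH : TestClass η H) {c : ℝ} (hc : |c| < 2 * η) :
    Integrable fun t : ℝ => cexp (c * t) * spectralFourier H t := by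
  refine hH.integrable_mul_spectralFourier (abs_nonneg c) hc (by fun_prop) (A := 1) fun t => ?_
  rw [← ofReal_mul, norm_exp_ofReal, one_mul, ← abs_mul]
  exact Real.exp_le_exp.mpr (le_abs_self _)

lemma fourierInv_spectral_line (hH : TestClass η H) {c : ℝ} (hc : |c| < 2 * η) (w : ℝ) :
    FourierTransformInv.fourierInv (fun v : ℝ => spectral H (c + v * I)) w =
      2 * Real.pi * (cexp ((-c : ℝ) * (2 * Real.pi * w : ℝ)) *
        spectralFourier H (2 * Real.pi * w)) := by
  have hpi : (Real.pi : ℂ) ≠ 0 := ofReal_ne_zero.mpr Real.pi_ne_zero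
  rw [Real.fourierInv_eq', hH.spectralFourier_eq_vint hc, vint, mul_left_comm (cexp _), ← mul_assoc,
    mul_one_div_cancel (by simp [hpi]), one_mul, ← integral_const_mul]
  congr 1 with v
  rw [smul_eq_mul, mul_left_comm, ← Complex.exp_add, mul_comm]
  congr 2
  simp only [RCLike.inner_apply, conj_trivial]
  push_cast
  ring

theorem integral_exp_mul_spectralFourier (hH : TestClass η H) {c : ℝ} (hc : |c| < 2 * η) :
    ∫ t : ℝ, cexp (c * t) * spectralFourier H t = spectral H c := by
  have hc' : |(-c)| < 2 * η := by rwa [abs_neg]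
  set f : ℝ → ℂ := fun v => spectral H ((-c : ℝ) + v * I) with hf
  have hinvf : FourierTransformInv.fourierInv f = fun w : ℝ => (fun t : ℝ => (2 * Real.pi : ℂ) *
      (cexp (c * t) * spectralFourier H t)) (2 * Real.pi * w) := by
    ext w
    rw [hH.fourierInv_spectral_line hc', neg_neg]
  have hint : Integrable (FourierTransformInv.fourierInv f) := by
    rw [hinvf]
    exact ((hH.integrable_exp_mul_spectralFourier hc).const_mul _).comp_mul_left'
      (by simp [Real.pi_ne_zero])
  have hint' : Integrable (FourierTransform.fourier f) :=
    hint.comp_neg.congr (.of_forall fun w => by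
      simp only [Real.fourierInv_eq_fourier_neg, neg_neg])
  have hinversion := (hH.verticalIntegrable_spectral hc').fourier_fourierInv_eq hint' (v := 0)
    (hH.continuous_spectral_line hc').continuousAt
  change FourierTransform.fourier (FourierTransformInv.fourierInv f) 0 = f 0 at hinversion
  rw [Real.fourier_eq', hinvf] at hinversion
  simp only [inner_zero_right, mul_zero, ofReal_zero, zero_mul, Complex.exp_zero, one_smul]
    at hinversion
  rw [Measure.integral_comp_mul_left (fun t : ℝ => (2 * Real.pi : ℂ) *
    (cexp (c * t) * spectralFourier H t)), integral_const_mul, real_smul,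
    abs_of_pos (by positivity)] at hinversion
  have hpi : (Real.pi : ℂ) ≠ 0 := ofReal_ne_zero.mpr Real.pi_ne_zero
  have hvalue : f 0 = spectral H c := by
    simpa [hf] using hH.spectral_neg (μ := c) (by simpa)
  rw [← hvalue, ← hinversion]
  push_cast
  field_simp

theorem integrable_cosh_pow_mul_spectralFourier (hH : TestClass η H) {k : ℕ}
    (hk : (k : ℝ) < 2 * η) :
    Integrable fun t : ℝ => (Real.cosh t : ℂ) ^ k * spectralFourier H t := by
  refine hH.integrable_mul_spectralFourier (A := 1) k.cast_nonneg hk (by fun_prop) fun t => ?_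
  rw [norm_pow, norm_real, Real.norm_of_nonneg (Real.cosh_pos t).le, one_mul, Real.exp_nat_mul]
  have := Real.cosh_pos t
  gcongr
  rw [← Real.cosh_abs, Real.cosh_eq]
  linarith [Real.exp_le_exp.mpr (neg_le_self (abs_nonneg t))]

-- The zeros of `sin (πμ)` make the exponential moments at integers vanish.
theorem integral_cosh_pow_mul_spectralFourier (hH : TestClass η H) {k : ℕ}
    (hk : (k : ℝ) < 2 * η) :
    ∫ t : ℝ, (Real.cosh t : ℂ) ^ k * spectralFourier H t = 0 := by
  have hm : ∀ m ∈ Finset.range (k + 1), |(2 * m - k : ℝ)| < 2 * η := fun m hm => by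
    have : (m : ℝ) ≤ k := by exact_mod_cast Finset.mem_range_succ_iff.mp hm
    exact (abs_le.mpr ⟨by linarith [m.cast_nonneg (α := ℝ)], by linarith⟩).trans_lt hk
  simp only [cosh_pow_eq_sum_exp, Finset.sum_mul, mul_assoc _ _ (spectralFourier H _)]
  rw [integral_finsetSum _ fun m h => (hH.integrable_exp_mul_spectralFourier (hm m h)).const_mul _]
  refine Finset.sum_eq_zero fun m h => ?_
  have hzero := spectral_intCast H (2 * m - k)
  push_cast at hzero
  rw [integral_const_mul, hH.integral_exp_mul_spectralFourier (hm m h)]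
  push_cast
  rw [hzero, mul_zero]

end

end TestClass

/-! ### The Whittaker function and the inverse Kontorovich–Lebedev transform -/

section Whittaker

theorem hasMellin_whittaker {μ w : ℂ} (hw : |μ.re| < w.re + 1 / 2) :
    HasMellin (whittaker μ) w
      (1 / 2 * (Real.pi : ℂ) ^ (-w - 1 / 2) * gammaPM (w + 1 / 2) μ) := by
  have hK := hasMellin_besselK (p := w + 1 / 2) (μ := μ) (by simpa using hw)
  have h₂pi : (0 : ℝ) < 2 * Real.pi := by positivity
  refine hasMellin_congr (g := fun y : ℝ => (2 : ℂ) • ((y : ℂ) ^ (1 / 2 : ℂ) •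
    besselK μ (2 * Real.pi * y))) (fun y hy => ?_) ⟨?_, ?_⟩
  · rw [whittaker, Real.sqrt_eq_rpow, ofReal_cpow hy.le]
    simp only [smul_eq_mul]
    push_cast
    ring
  · exact (MellinConvergent.cpow_smul.mpr
      ((MellinConvergent.comp_mul_left h₂pi).mpr hK.1)).const_smul _
  · have hscale : ((2 * Real.pi : ℝ) : ℂ) ^ (-(w + 1 / 2)) =
        2 ^ (-(w + 1 / 2)) * (Real.pi : ℂ) ^ (-w - 1 / 2) := by
      rw [ofReal_mul, mul_cpow_ofReal_nonneg zero_le_two Real.pi_pos.le]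
      push_cast
      ring_nf
    have htwo : (2 : ℂ) ^ (-(w + 1 / 2)) * 2 ^ (w + 1 / 2 - 2) = 1 / 4 := by
      rw [← cpow_add _ _ two_ne_zero,
        show -(w + 1 / 2) + (w + 1 / 2 - 2) = ((-2 : ℤ) : ℂ) by push_cast; ring, cpow_intCast]
      norm_num
    rw [mellin_const_smul, mellin_cpow_smul, mellin_comp_mul_left _ _ h₂pi, hK.2, hscale, gammaPM]
    simp only [smul_eq_mul]
    linear_combination 2 * (Real.pi : ℂ) ^ (-w - 1 / 2) *
      (Gamma ((w + 1 / 2 + μ) / 2) * Gamma ((w + 1 / 2 - μ) / 2)) * htwo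

lemma continuousAt_whittaker (μ : ℂ) {y : ℝ} (hy : 0 < y) : ContinuousAt (whittaker μ) y :=
  ContinuousAt.mul (by fun_prop) (ContinuousAt.comp (f := fun y => 2 * Real.pi * y)
    (continuousAt_besselK μ (by positivity)) (by fun_prop))

lemma norm_whittaker_le (μ : ℂ) {y : ℝ} (hy : 0 < y) : ‖whittaker μ y‖ ≤ ‖whittaker μ.re y‖ := by
  rw [whittaker, whittaker, norm_mul, norm_mul (2 * _) (besselK μ.re _)]
  gcongr
  exact norm_besselK_le μ (by positivity)

lemma measurable_whittaker : Measurable fun q : ℂ × ℝ => whittaker q.1 q.2 :=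
  Measurable.mul (by fun_prop) (stronglyMeasurable_besselK.measurable.comp
    (f := fun q : ℂ × ℝ => (q.1, 2 * Real.pi * q.2)) (by fun_prop))

theorem verticalIntegrable_mellin_whittaker {μ : ℂ} {κ : ℝ} (hκ : |μ.re| < κ + 1 / 2) :
    VerticalIntegrable (mellin (whittaker μ)) κ := by
  obtain ⟨h₁, h₂⟩ := abs_lt.mp hκ
  have hpi : (Real.pi : ℂ) ≠ 0 := ofReal_ne_zero.mpr Real.pi_ne_zero
  have hline : Integrable fun v : ℝ => Gamma ((κ + 1 / 2 + μ) / 2 + ((1 / 2 : ℝ) * v : ℝ) * I) *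
      Gamma ((κ + 1 / 2 - μ) / 2 + ((1 / 2 : ℝ) * v : ℝ) * I) :=
    integrable_mul_Gamma (x := (κ + 1 / 2 - μ.re) / 2)
      (integrable_Gamma_line (by norm_num) (by simp; linarith)) (by fun_prop) (by linarith)
      (by simp)
  refine ((hline.bdd_mul (c := Real.pi ^ (-κ - 1 / 2))
    (f := fun v : ℝ => (Real.pi : ℂ) ^ (-((κ : ℂ) + v * I) - 1 / 2))
    (Continuous.aestronglyMeasurable (Continuous.const_cpow (by fun_prop) (.inl hpi)))
    (.of_forall fun v => ?_)).const_mul (1 / 2)).congr (.of_forall fun v => ?_)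
  · simp [norm_cpow_eq_rpow_re_of_pos Real.pi_pos]
  · beta_reduce
    rw [(hasMellin_whittaker (by simpa using hκ)).2, gammaPM]
    push_cast
    ring_nf

theorem whittaker_eq_vint {μ : ℂ} {κ y : ℝ} (hκ : |μ.re| < κ + 1 / 2) (hy : 0 < y) :
    whittaker μ y = vint κ fun z => (y : ℂ) ^ (-z) * mellin (whittaker μ) z := by
  rw [← mellinInv_eq_vint, mellinInv_mellin_eq κ _ hy (hasMellin_whittaker (by simpa using hκ)).1
    (verticalIntegrable_mellin_whittaker hκ) (continuousAt_whittaker μ hy)]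

end Whittaker

theorem flat_eq_vint_spectral (H : ℂ → ℂ) (y : ℝ) :
    flat H y = (1 / 2 : ℂ) * vint 0 (fun μ => spectral H μ * whittaker μ y) := by
  rw [flat]
  congr 1
  refine vint_congr fun μ hμ => ?_
  rw [← div_norm_Gamma_sq hμ]
  ring

theorem exists_norm_exp_neg_sub_sum_le (N : ℕ) : ∃ C : ℝ, 0 ≤ C ∧ ∀ z : ℝ, 0 ≤ z →
    ‖cexp (-(z : ℂ)) - ∑ k ∈ Finset.range N, (-(z : ℂ)) ^ k / (k.factorial : ℂ)‖ ≤ C * z ^ N := by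
  refine ⟨Real.exp 1 + N + 1, by positivity, fun z hz => ?_⟩
  rcases le_total z 1 with h | h
  · refine (norm_exp_sub_sum_le_norm_mul_exp (-(z : ℂ)) N).trans ?_
    rw [norm_neg, norm_real, Real.norm_of_nonneg hz, mul_comm]
    have : Real.exp z ≤ Real.exp 1 := Real.exp_le_exp.mpr h
    gcongr
    linarith [N.cast_nonneg (α := ℝ)]
  · have hexp : ‖cexp (-(z : ℂ))‖ ≤ 1 := by
      rw [Complex.norm_exp]
      simpa
    have hsum : ‖∑ k ∈ Finset.range N, (-(z : ℂ)) ^ k / (k.factorial : ℂ)‖ ≤ N * z ^ N := by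
      refine (norm_sum_le_of_le (n := fun _ => z ^ N) _ fun k hk => ?_).trans_eq (by simp)
      rw [norm_div, norm_pow, norm_neg, norm_real, Real.norm_of_nonneg hz, Complex.norm_natCast]
      have : (1 : ℝ) ≤ k.factorial := by exact_mod_cast k.factorial_pos
      exact (div_le_self (by positivity) this).trans
        (pow_le_pow_right₀ h (Finset.mem_range.mp hk).le)
    have hpow : 1 ≤ z ^ N := one_le_pow₀ h
    have := Real.exp_pos 1
    nlinarith [norm_sub_le (cexp (-(z : ℂ)))
      (∑ k ∈ Finset.range N, (-(z : ℂ)) ^ k / (k.factorial : ℂ))]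

namespace TestClass

section Flat

variable {η : ℝ} {H : ℂ → ℂ}

lemma integrable_exp_neg_mul_cosh_mul_spectralFourier (hH : TestClass η H) (hη : 0 < η) {x : ℝ}
    (hx : 0 ≤ x) :
    Integrable fun t : ℝ => (Real.exp (-x * Real.cosh t) : ℂ) * spectralFourier H t := by
  refine hH.integrable_mul_spectralFourier (c := 0) (A := 1) le_rfl (by linarith) (by fun_prop)
    fun t => ?_
  have := Real.cosh_pos t
  rw [norm_real, Real.norm_of_nonneg (Real.exp_pos _).le, zero_mul, Real.exp_zero, mul_one,
    Real.exp_le_one_iff, neg_mul, neg_nonpos]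
  positivity

lemma integrable_spectralFourier (hH : TestClass η H) (hη : 0 < η) :
    Integrable (spectralFourier H) := by
  simpa using hH.integrable_exp_neg_mul_cosh_mul_spectralFourier hη (le_refl 0)

theorem flat_eq_integral_exp (hH : TestClass η H) (hη : 0 < η) {y : ℝ} (hy : 0 < y) :
    flat H y = (1 / 2 : ℂ) * (Real.sqrt y : ℂ) *
      ∫ t : ℝ, (Real.exp (-(2 * Real.pi * y) * Real.cosh t) : ℂ) * spectralFourier H t := by
  set x := 2 * Real.pi * y
  have hx₀ : 0 < x := by positivity
  have hc : |(0 : ℝ)| < 2 * η := by rw [abs_zero]; linarith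
  have hker : Integrable fun t : ℝ => (Real.exp (-x * Real.cosh t) : ℂ) := by
    simpa using integrable_besselK_kernel hx₀ 0
  have hint : Integrable (fun q : ℝ × ℝ => (Real.exp (-x * Real.cosh q.1) : ℂ) *
      (spectral H ((0 : ℝ) + q.2 * I) * cexp (((0 : ℝ) + q.2 * I) * q.1)))
      (volume.prod volume) := by
    simp only [← mul_assoc]
    refine (hker.mul_prod (hH.verticalIntegrable_spectral hc)).mul_bdd (c := 1)
      (Continuous.aestronglyMeasurable (by fun_prop)) (.of_forall fun q => ?_)
    rw [Complex.norm_exp]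
    simp
  calc flat H y = (1 / 2 : ℂ) * vint 0 (fun μ => (Real.sqrt y : ℂ) *
        ∫ t : ℝ, (Real.exp (-x * Real.cosh t) : ℂ) * (spectral H μ * cexp (μ * t))) := by
        rw [flat_eq_vint_spectral]
        congr 1
        refine vint_congr fun μ _ => ?_
        simp only [mul_left_comm _ (spectral H μ)]
        rw [integral_const_mul, whittaker, besselK_eq_integral_exp μ hx₀]
        ring
    _ = (1 / 2 : ℂ) * (Real.sqrt y : ℂ) *
        ∫ t : ℝ, (Real.exp (-x * Real.cosh t) : ℂ) * spectralFourier H t := by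
        rw [vint_const_mul, ← integral_vint (f := fun (t : ℝ) μ =>
          (Real.exp (-x * Real.cosh t) : ℂ) * (spectral H μ * cexp (μ * t))) hint, ← mul_assoc]
        simp only [vint_const_mul, spectralFourier]

lemma integral_exp_eq_integral_exp_sub_sum (hH : TestClass η H) {N : ℕ} (hN : (N : ℝ) < 2 * η)
    {x : ℝ} (hx : 0 ≤ x) :
    ∫ t : ℝ, (Real.exp (-x * Real.cosh t) : ℂ) * spectralFourier H t =
      ∫ t : ℝ, (cexp (-((x * Real.cosh t : ℝ) : ℂ)) - ∑ k ∈ Finset.range N,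
        (-((x * Real.cosh t : ℝ) : ℂ)) ^ k / (k.factorial : ℂ)) * spectralFourier H t := by
  have hη : 0 < η := by linarith [N.cast_nonneg (α := ℝ)]
  have hterm : ∀ (k : ℕ) (t : ℝ),
      (-((x * Real.cosh t : ℝ) : ℂ)) ^ k / (k.factorial : ℂ) * spectralFourier H t =
        (-x : ℂ) ^ k / (k.factorial : ℂ) * ((Real.cosh t : ℂ) ^ k * spectralFourier H t) :=
    fun k t => by
      rw [ofReal_mul, ← neg_mul, mul_pow]
      ring
  have hk : ∀ k ∈ Finset.range N, (k : ℝ) < 2 * η := fun k hk =>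
    (Nat.cast_lt.mpr (Finset.mem_range.mp hk)).trans hN
  have hint : ∀ k ∈ Finset.range N, Integrable fun t : ℝ =>
      (-x : ℂ) ^ k / (k.factorial : ℂ) * ((Real.cosh t : ℂ) ^ k * spectralFourier H t) :=
    fun k h => (hH.integrable_cosh_pow_mul_spectralFourier (hk k h)).const_mul _
  have hexp : ∀ t : ℝ, cexp (-((x * Real.cosh t : ℝ) : ℂ)) = (Real.exp (-x * Real.cosh t) : ℂ) :=
    fun t => by rw [ofReal_exp, ← ofReal_neg, neg_mul]
  simp only [sub_mul, Finset.sum_mul, hterm, hexp]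
  rw [integral_sub (hH.integrable_exp_neg_mul_cosh_mul_spectralFourier hη hx)
    (integrable_finsetSum _ hint), integral_finsetSum _ hint, Finset.sum_eq_zero fun k h => ?_,
    sub_zero]
  rw [integral_const_mul, hH.integral_cosh_pow_mul_spectralFourier (hk k h), mul_zero]

-- Subtracting the Taylor polynomial of the exponential costs nothing, since the moments vanish,
-- and gains the factor `y ^ N`.
theorem exists_norm_flat_le_rpow (hH : TestClass η H) {N : ℕ} (hN : (N : ℝ) < 2 * η) :
    ∃ C : ℝ, ∀ y : ℝ, 0 < y → ‖flat H y‖ ≤ C * y ^ ((N : ℝ) + 1 / 2) := by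
  have hη : 0 < η := by linarith [N.cast_nonneg (α := ℝ)]
  obtain ⟨A, _, hA⟩ := exists_norm_exp_neg_sub_sum_le N
  refine ⟨1 / 2 * (A * (2 * Real.pi) ^ N *
    ∫ t : ℝ, ‖(Real.cosh t : ℂ) ^ N * spectralFourier H t‖), fun y hy => ?_⟩
  set x := 2 * Real.pi * y with hx
  have hx₀ : 0 < x := by positivity
  have hbound : ‖∫ t : ℝ, (Real.exp (-x * Real.cosh t) : ℂ) * spectralFourier H t‖ ≤
      A * x ^ N * ∫ t : ℝ, ‖(Real.cosh t : ℂ) ^ N * spectralFourier H t‖ := by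
    rw [hH.integral_exp_eq_integral_exp_sub_sum hN hx₀.le, ← integral_const_mul]
    refine norm_integral_le_of_norm_le
      ((hH.integrable_cosh_pow_mul_spectralFourier hN).norm.const_mul _) (.of_forall fun t => ?_)
    have hcosh := Real.cosh_pos t
    rw [norm_mul, norm_mul, norm_pow, norm_real, Real.norm_of_nonneg hcosh.le]
    calc _ ≤ A * (x * Real.cosh t) ^ N * ‖spectralFourier H t‖ := by
          gcongr
          exact hA _ (by positivity)
      _ = _ := by rw [mul_pow]; ring
  rw [hH.flat_eq_integral_exp hη hy, norm_mul, norm_mul, norm_real,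
    Real.norm_of_nonneg (Real.sqrt_nonneg y), Real.rpow_add hy, Real.rpow_natCast,
    ← Real.sqrt_eq_rpow]
  calc _ ≤ ‖(1 / 2 : ℂ)‖ * √y *
          (A * x ^ N * ∫ t : ℝ, ‖(Real.cosh t : ℂ) ^ N * spectralFourier H t‖) := by gcongr
    _ = _ := by
        rw [hx, mul_pow, show ‖(1 / 2 : ℂ)‖ = 1 / 2 by norm_num]
        ring

theorem norm_flat_le_mul_exp (hH : TestClass η H) (hη : 0 < η) {y : ℝ} (hy : 0 < y) :
    ‖flat H y‖ ≤ √y * Real.exp (-y) * ∫ t : ℝ, ‖spectralFourier H t‖ := by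
  have hker : ∀ t : ℝ, -(2 * Real.pi * y) * Real.cosh t ≤ -y := fun t => by
    rw [neg_mul, neg_le_neg_iff]
    have hcoef : (1 : ℝ) ≤ 2 * Real.pi * Real.cosh t := by
      nlinarith [Real.pi_gt_three, Real.one_le_cosh t]
    nlinarith
  rw [hH.flat_eq_integral_exp hη hy, norm_mul, norm_mul, norm_real,
    Real.norm_of_nonneg (Real.sqrt_nonneg y), mul_assoc √y]
  have hbound : ‖∫ t : ℝ, (Real.exp (-(2 * Real.pi * y) * Real.cosh t) : ℂ) *
      spectralFourier H t‖ ≤ Real.exp (-y) * ∫ t : ℝ, ‖spectralFourier H t‖ := by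
    rw [← integral_const_mul]
    refine norm_integral_le_of_norm_le ((hH.integrable_spectralFourier hη).norm.const_mul _)
      (.of_forall fun t => ?_)
    rw [norm_mul, norm_real, Real.norm_of_nonneg (Real.exp_pos _).le]
    gcongr
    exact hker t
  have hhalf : ‖(1 / 2 : ℂ)‖ ≤ 1 := by norm_num
  gcongr
  exact mul_le_of_le_one_left (Real.sqrt_nonneg y) hhalf

theorem continuousOn_flat (hH : TestClass η H) (hη : 0 < η) :
    ContinuousOn (flat H) (Ioi 0) := by
  have hcont : Continuous fun y : ℝ => (1 / 2 : ℂ) * (Real.sqrt y : ℂ) *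
      ∫ t : ℝ, (Real.exp (-(2 * Real.pi * |y|) * Real.cosh t) : ℂ) * spectralFourier H t := by
    refine Continuous.mul (by fun_prop) (continuous_of_dominated
      (bound := fun t => ‖spectralFourier H t‖) (fun y => ?_) (fun y => .of_forall fun t => ?_)
      (hH.integrable_spectralFourier hη).norm (.of_forall fun t => by fun_prop))
    · have := hH.continuous_spectralFourier hη
      exact Continuous.aestronglyMeasurable (by fun_prop)
    · have := Real.cosh_pos t
      rw [norm_mul, norm_real, Real.norm_of_nonneg (Real.exp_pos _).le]
      refine mul_le_of_le_one_left (norm_nonneg _) (Real.exp_le_one_iff.mpr ?_)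
      rw [neg_mul, neg_nonpos]
      positivity
  refine hcont.continuousOn.congr fun y (hy : 0 < y) => ?_
  simp only [hH.flat_eq_integral_exp hη hy, abs_of_pos hy]

lemma isBigO_flat_atTop (hH : TestClass η H) (hη : 0 < η) (a : ℝ) :
    flat H =O[Filter.atTop] fun y : ℝ => y ^ (-a) := by
  have hdecay : (fun y : ℝ => √y * Real.exp (-y)) =O[Filter.atTop] fun y : ℝ => y ^ (-a) := by
    have h := (isLittleO_exp_neg_mul_rpow_atTop one_pos (-(a + 1 / 2))).isBigO
    refine (h.mul (Asymptotics.isBigO_refl (fun y : ℝ => √y) Filter.atTop)).congr'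
      (.of_forall fun y => by beta_reduce; rw [neg_one_mul, mul_comm]) ?_
    filter_upwards [Filter.eventually_gt_atTop 0] with y hy
    rw [Real.sqrt_eq_rpow, ← Real.rpow_add hy]
    ring_nf
  refine Asymptotics.IsBigO.trans (Asymptotics.IsBigO.of_bound
    (∫ t : ℝ, ‖spectralFourier H t‖) ?_) hdecay
  filter_upwards [Filter.eventually_gt_atTop 0] with y hy
  rw [Real.norm_of_nonneg (by positivity), mul_comm]
  exact hH.norm_flat_le_mul_exp hη hy

lemma isBigO_flat_zero (hH : TestClass η H) {N : ℕ} (hN : (N : ℝ) < 2 * η) :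
    flat H =O[nhdsWithin 0 (Ioi 0)] fun y : ℝ => y ^ (-(-((N : ℝ) + 1 / 2))) := by
  obtain ⟨C, hC⟩ := hH.exists_norm_flat_le_rpow hN
  refine Asymptotics.IsBigO.of_bound C ?_
  filter_upwards [self_mem_nhdsWithin] with y (hy : 0 < y)
  rw [neg_neg, Real.norm_of_nonneg (Real.rpow_nonneg hy.le _)]
  exact hC y hy

theorem mellinConvergent_flat (hH : TestClass η H) {N : ℕ} (hN : (N : ℝ) < 2 * η) {w : ℂ}
    (hw : -((N : ℝ) + 1 / 2) < w.re) : MellinConvergent (flat H) w := by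
  have hη : 0 < η := by linarith [N.cast_nonneg (α := ℝ)]
  exact mellinConvergent_of_isBigO_rpow
    ((hH.continuousOn_flat hη).locallyIntegrableOn measurableSet_Ioi)
    (hH.isBigO_flat_atTop hη (w.re + 1)) (by linarith) (hH.isBigO_flat_zero hN) hw

theorem differentiableAt_mellin_flat (hH : TestClass η H) {N : ℕ} (hN : (N : ℝ) < 2 * η) {w : ℂ}
    (hw : -((N : ℝ) + 1 / 2) < w.re) : DifferentiableAt ℂ (mellin (flat H)) w := by
  have hη : 0 < η := by linarith [N.cast_nonneg (α := ℝ)]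
  exact mellin_differentiableAt_of_isBigO_rpow
    ((hH.continuousOn_flat hη).locallyIntegrableOn measurableSet_Ioi)
    (hH.isBigO_flat_atTop hη (w.re + 1)) (by linarith) (hH.isBigO_flat_zero hN) hw

end Flat

end TestClass

theorem exists_norm_mellin_le {E : Type*} [NormedAddCommGroup E] [NormedSpace ℂ E] {f : ℝ → E}
    {a b : ℝ} (ha : MellinConvergent f a) (hb : MellinConvergent f b) :
    ∃ C : ℝ, ∀ w : ℂ, a ≤ w.re → w.re ≤ b → ‖mellin f w‖ ≤ C := by
  refine ⟨(∫ y in Ioi (0 : ℝ), ‖(y : ℂ) ^ ((a : ℂ) - 1) • f y‖) +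
    ∫ y in Ioi (0 : ℝ), ‖(y : ℂ) ^ ((b : ℂ) - 1) • f y‖, fun w h₁ h₂ => ?_⟩
  rw [mellin, ← integral_add ha.norm hb.norm]
  refine norm_integral_le_of_norm_le (ha.norm.add hb.norm)
    (ae_restrict_of_forall_mem measurableSet_Ioi fun y (hy : 0 < y) => ?_)
  simp only [norm_smul, norm_cpow_eq_rpow_re_of_pos hy, ← add_mul, sub_re, one_re, ofReal_re]
  gcongr
  have hay := Real.rpow_nonneg hy.le (a - 1)
  have hby := Real.rpow_nonneg hy.le (b - 1)
  rcases le_total y 1 with h | h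
  · linarith [Real.rpow_le_rpow_of_exponent_ge hy h (by linarith : a - 1 ≤ w.re - 1)]
  · linarith [Real.rpow_le_rpow_of_exponent_le h (by linarith : w.re - 1 ≤ b - 1)]

namespace TestClass

section MellinFlat

variable {η : ℝ} {H : ℂ → ℂ}

lemma integrable_cpow_mul_spectral_mul_whittaker (hH : TestClass η H) (hη : 0 < η) {w : ℂ}
    (hw : -(1 / 2) < w.re) :
    Integrable (fun q : ℝ × ℝ => (q.1 : ℂ) ^ (w - 1) *
        (spectral H ((0 : ℝ) + q.2 * I) * whittaker ((0 : ℝ) + q.2 * I) q.1))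
      ((volume.restrict (Ioi 0)).prod volume) := by
  have hc : |(0 : ℝ)| < 2 * η := by rw [abs_zero]; linarith
  have hW := (hasMellin_whittaker (μ := 0) (w := w) (by simp; linarith)).1
  refine (Integrable.mul_prod (L := ℂ) hW (hH.verticalIntegrable_spectral hc)).norm.mono' ?_ ?_
  · refine Measurable.aestronglyMeasurable (Measurable.mul (by fun_prop) (Measurable.mul ?_ ?_))
    · exact (hH.continuous_spectral_line hc).measurable.comp measurable_snd
    · exact measurable_whittaker.comp
        (f := fun q : ℝ × ℝ => (((0 : ℝ) + q.2 * I : ℂ), q.1)) (by fun_prop)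
  · filter_upwards [Measure.quasiMeasurePreserving_fst.ae (ae_restrict_mem measurableSet_Ioi)]
      with q (hq : 0 < q.1)
    have hle : ‖whittaker ((0 : ℝ) + q.2 * I) q.1‖ ≤ ‖whittaker 0 q.1‖ := by
      simpa using norm_whittaker_le ((0 : ℝ) + q.2 * I) hq
    rw [smul_eq_mul, norm_mul, norm_mul, norm_mul, norm_mul, mul_right_comm, mul_assoc]
    gcongr

theorem mellin_flat (hH : TestClass η H) (hη : 0 < η) {w : ℂ} (hw : -(1 / 2) < w.re) :
    mellin (flat H) w = (1 / 4 : ℂ) * (Real.pi : ℂ) ^ (-w - 1 / 2) *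
      vint 0 (fun μ => spectral H μ * gammaPM (w + 1 / 2) μ) := by
  calc mellin (flat H) w = 1 / 2 * ∫ y in Ioi (0 : ℝ), vint 0 fun μ =>
        (y : ℂ) ^ (w - 1) * (spectral H μ * whittaker μ y) := by
        rw [mellin, ← integral_const_mul]
        congr 1 with y
        rw [vint_const_mul, flat_eq_vint_spectral, smul_eq_mul]
        ring
    _ = 1 / 2 * vint 0 fun μ => spectral H μ * mellin (whittaker μ) w := by
        rw [integral_vint (f := fun (y : ℝ) μ => (y : ℂ) ^ (w - 1) *
          (spectral H μ * whittaker μ y)) (hH.integrable_cpow_mul_spectral_mul_whittaker hη hw)]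
        simp only [mellin, smul_eq_mul, ← integral_const_mul, mul_left_comm (spectral H _)]
    _ = _ := by
        rw [mul_assoc, ← vint_const_mul, ← vint_const_mul, ← vint_const_mul]
        refine vint_congr fun μ hμ => ?_
        rw [(hasMellin_whittaker (by rw [hμ, abs_zero]; linarith)).2]
        ring

end MellinFlat

end TestClass

/-! ### Moving the contour of the one-dimensional Mellin–Barnes integral -/

/-- The quotient `Γ(a₁ + p/2) Γ(a₂ + p/2) Γ(a₃ + p/2) / Γ(e + p/2)`, the part of a Barnes integrand
that decreases along upward lines. The last numerator factor is grouped with the denominator, since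
their ratio grows at most polynomially. -/
noncomputable def gammaQuot (a₁ a₂ a₃ e p : ℂ) : ℂ :=
  Gamma (a₁ + p / 2) * Gamma (a₂ + p / 2) * (Gamma (a₃ + p / 2) / Gamma (e + p / 2))

section GammaQuot

variable {a a₁ a₂ a₃ e p : ℂ}

lemma re_add_div_two (a p : ℂ) : (a + p / 2).re = a.re + p.re / 2 := by simp

lemma one_add_im_sq_le {M : ℝ} (ha : ‖a‖ ≤ M) :
    1 + p.im ^ 2 ≤ (2 * (1 + M)) ^ 2 * (1 + ‖a + p / 2‖) ^ 2 := by
  have hM : 0 ≤ M := (norm_nonneg a).trans ha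
  have him : |p.im| ≤ 2 * ‖a + p / 2‖ + 2 * M := by
    have hp : p = 2 * ((a + p / 2) - a) := by ring
    calc |p.im| ≤ ‖p‖ := abs_im_le_norm p
      _ = 2 * ‖(a + p / 2) - a‖ := by
          conv_lhs => rw [hp]
          simp
      _ ≤ 2 * ‖a + p / 2‖ + 2 * M := by linarith [norm_sub_le (a + p / 2) a]
  have hlin : 1 + |p.im| ≤ 2 * (1 + M) * (1 + ‖a + p / 2‖) := by
    nlinarith [mul_nonneg hM (norm_nonneg (a + p / 2))]
  rw [← sq_abs p.im, ← mul_pow]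
  nlinarith [pow_le_pow_left₀ (by positivity) hlin 2, abs_nonneg p.im]

theorem exists_norm_gammaQuot_le (k : ℕ) {δ M : ℝ} (hδ : 0 < δ) (hM : 0 ≤ M) :
    ∃ C : ℝ, 0 ≤ C ∧ ∀ a₁ a₂ a₃ e p : ℂ, ‖a₁‖ ≤ M → ‖a₃‖ ≤ M → ‖e‖ ≤ M →
      δ ≤ (a₁ + p / 2).re → (a₁ + p / 2).re ≤ M → δ ≤ (a₂ + p / 2).re → (a₂ + p / 2).re ≤ M →
      k + δ ≤ (a₃ + p / 2).re → δ ≤ (e - a₃).re + k →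
      ‖gammaQuot a₁ a₂ a₃ e p‖ ≤ C * (1 + p.im ^ 2)⁻¹ := by
  obtain ⟨C₁, hC₁, hΓ₁⟩ := exists_norm_Gamma_mul_pow_le (k + 2) (b := M) hδ
  obtain ⟨C₂, hC₂, hΓ₂⟩ := exists_norm_Gamma_mul_pow_le 0 (b := M) hδ
  obtain ⟨C₃, hC₃, hΓ₃⟩ := exists_norm_Gamma_div_Gamma_le k hδ (2 * M)
  refine ⟨C₁ * C₂ * C₃ * (1 + 2 * M) ^ k * (2 * (1 + M)) ^ 2, by positivity, ?_⟩
  intro a₁ a₂ a₃ e p ha₁ ha₃ he h₁ h₁' h₂ h₂' h₃ h₄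
  set X := ‖a₁ + p / 2‖
  have hX : 0 ≤ X := norm_nonneg _
  have hbound₁ : ‖Gamma (a₁ + p / 2)‖ * (1 + X) ^ (k + 2) ≤ C₁ := hΓ₁ _ h₁ h₁'
  have hbound₂ : ‖Gamma (a₂ + p / 2)‖ ≤ C₂ := by simpa using hΓ₂ _ h₂ h₂'
  have hshift : 1 + ‖a₃ + p / 2‖ ≤ (1 + 2 * M) * (1 + X) := by
    have hsplit : a₃ + p / 2 = (a₃ - a₁) + (a₁ + p / 2) := by ring
    have htri := norm_add_le (a₃ - a₁) (a₁ + p / 2)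
    rw [← hsplit] at htri
    nlinarith [norm_sub_le a₃ a₁]
  have hbound₃ : ‖Gamma (a₃ + p / 2) / Gamma (e + p / 2)‖ ≤ C₃ * ((1 + 2 * M) * (1 + X)) ^ k := by
    refine (hΓ₃ (a₃ + p / 2) (e + p / 2) h₃ (by rwa [add_sub_add_right_eq_sub]) ?_).trans
      (by gcongr)
    rw [add_sub_add_right_eq_sub]
    linarith [norm_sub_le e a₃]
  rw [← div_eq_mul_inv, le_div_iff₀ (by positivity), gammaQuot, norm_mul, norm_mul]
  calc _ ≤ ‖Gamma (a₁ + p / 2)‖ * C₂ * (C₃ * ((1 + 2 * M) * (1 + X)) ^ k) *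
        ((2 * (1 + M)) ^ 2 * (1 + X) ^ 2) := by
        gcongr
        exact one_add_im_sq_le ha₁
    _ = ‖Gamma (a₁ + p / 2)‖ * (1 + X) ^ (k + 2) * C₂ * C₃ * (1 + 2 * M) ^ k *
        (2 * (1 + M)) ^ 2 := by
        rw [mul_pow, pow_add]
        ring
    _ ≤ _ := by gcongr

theorem exists_norm_gammaQuot_le_of_strip {κ : ℝ} (h₁ : 0 < a₁.re + κ / 2)
    (h₂ : 0 < a₂.re + κ / 2) (h₃ : 0 < a₃.re + κ / 2) (he : 0 < (e - a₃).re) (c : ℝ) :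
    ∃ C : ℝ, 0 ≤ C ∧ ∀ z : ℂ, κ ≤ z.re → z.re ≤ c →
      ‖gammaQuot a₁ a₂ a₃ e z‖ ≤ C * (1 + z.im ^ 2)⁻¹ := by
  obtain ⟨δ, hδ, hδ'⟩ := exists_between (lt_min (lt_min h₁ h₂) (lt_min h₃ he))
  simp only [lt_min_iff] at hδ'
  obtain ⟨⟨hδ₁, hδ₂⟩, hδ₃, hδe⟩ := hδ'
  set M := ‖a₁‖ + ‖a₂‖ + ‖a₃‖ + ‖e‖ + |c|
  have hn₁ := norm_nonneg a₁
  have hn₂ := norm_nonneg a₂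
  have hn₃ := norm_nonneg a₃
  have hne := norm_nonneg e
  have hc := le_abs_self c
  have hc₀ := abs_nonneg c
  obtain ⟨C, hC, hbound⟩ := exists_norm_gammaQuot_le 0 hδ (M := M) (by positivity)
  refine ⟨C, hC, fun z hz₁ hz₂ => hbound a₁ a₂ a₃ e z ?_ ?_ ?_ ?_ ?_ ?_ ?_ ?_ ?_⟩
  all_goals
    try rw [re_add_div_two]
    try rw [Nat.cast_zero]
    linarith [re_le_norm a₁, re_le_norm a₂]

theorem differentiableAt_gammaQuot (h₁ : 0 < (a₁ + p / 2).re) (h₂ : 0 < (a₂ + p / 2).re)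
    (h₃ : 0 < (a₃ + p / 2).re) : DifferentiableAt ℂ (gammaQuot a₁ a₂ a₃ e) p := by
  have hΓ : ∀ a : ℂ, 0 < (a + p / 2).re → DifferentiableAt ℂ (fun p => Gamma (a + p / 2)) p :=
    fun a ha => (differentiableAt_Gamma_of_re_pos ha).comp p (f := fun p => a + p / 2) (by fun_prop)
  have hΓinv : DifferentiableAt ℂ (fun p => (Gamma (e + p / 2))⁻¹) p :=
    (differentiable_one_div_Gamma (e + p / 2)).comp p (f := fun p => e + p / 2) (by fun_prop)
  exact ((hΓ a₁ h₁).mul (hΓ a₂ h₂)).mul ((hΓ a₃ h₃).mul hΓinv)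

theorem verticalIntegrable_gammaQuot {κ : ℝ} (h₁ : 0 < a₁.re + κ / 2) (h₂ : 0 < a₂.re + κ / 2)
    (h₃ : 0 < a₃.re + κ / 2) (he : 0 < (e - a₃).re) :
    VerticalIntegrable (gammaQuot a₁ a₂ a₃ e) κ := by
  obtain ⟨C, -, hC⟩ := exists_norm_gammaQuot_le_of_strip h₁ h₂ h₃ he κ
  refine verticalIntegrable_of_norm_le (C := C) (continuous_iff_continuousAt.mpr fun v => ?_)
    fun v => by simpa using hC (κ + v * I) (by simp) (by simp)
  refine ContinuousAt.comp (f := fun v : ℝ => (κ + v * I : ℂ)) (g := gammaQuot a₁ a₂ a₃ e)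
    (differentiableAt_gammaQuot ?_ ?_ ?_).continuousAt (by fun_prop)
  all_goals simpa

end GammaQuot

section BarnesSecond

variable {s a₁ a₂ a₃ : ℂ} {κ : ℝ}

theorem vint_gammaPM_mul_gammaQuot {μ : ℂ} (h₁ : 0 < a₁.re + κ / 2) (h₂ : 0 < a₂.re + κ / 2)
    (h₃ : 0 < a₃.re + κ / 2) (hκ : |μ.re| < s.re - κ) :
    vint κ (fun p => gammaPM (s - p) μ * gammaQuot a₁ a₂ a₃ (s + a₁ + a₂ + a₃) p) =
      2 * (gammaPM (2 * a₁ + s) μ * gammaPM (2 * a₂ + s) μ * gammaPM (2 * a₃ + s) μ /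
        (Gamma (s + a₂ + a₃) * Gamma (s + a₁ + a₃) * Gamma (s + a₁ + a₂))) := by
  obtain ⟨hμ₁, hμ₂⟩ := abs_lt.mp hκ
  have hsum : ∀ b : ℂ, b + (s + μ) / 2 + (s - μ) / 2 = s + b := fun b => by ring
  have hB := barnes_second (a₁ := a₁) (a₂ := a₂) (a₃ := a₃) (b₁ := (s + μ) / 2)
    (b₂ := (s - μ) / 2) (c := κ / 2) h₁ h₂ h₃ (by simp; linarith) (by simp; linarith)
  have hscale := vint_comp_mul_left (b := 1 / 2) (by norm_num) κ fun z =>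
    Gamma (a₁ + z) * Gamma (a₂ + z) * Gamma (a₃ + z) * Gamma ((s + μ) / 2 - z) *
      Gamma ((s - μ) / 2 - z) / Gamma (a₁ + a₂ + a₃ + (s + μ) / 2 + (s - μ) / 2 + z)
  rw [show 1 / 2 * κ = κ / 2 by ring, hB] at hscale
  have hPM : ∀ a : ℂ, gammaPM (2 * a + s) μ = Gamma (a + (s + μ) / 2) * Gamma (a + (s - μ) / 2) :=
    fun a => by
      rw [gammaPM]
      ring_nf
  calc _ = 2 * (((1 / 2 : ℝ) : ℂ) * vint κ fun z => Gamma (a₁ + (1 / 2 : ℝ) * z) *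
        Gamma (a₂ + (1 / 2 : ℝ) * z) * Gamma (a₃ + (1 / 2 : ℝ) * z) *
        Gamma ((s + μ) / 2 - (1 / 2 : ℝ) * z) * Gamma ((s - μ) / 2 - (1 / 2 : ℝ) * z) /
        Gamma (a₁ + a₂ + a₃ + (s + μ) / 2 + (s - μ) / 2 + (1 / 2 : ℝ) * z)) := by
        rw [← mul_assoc, show (2 : ℂ) * (1 / 2 : ℝ) = 1 by norm_num, one_mul]
        refine vint_congr fun p _ => ?_
        have hp : ((1 / 2 : ℝ) : ℂ) * p = p / 2 := by
          push_cast
          ring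
        rw [hp, hsum, gammaPM, gammaQuot, ← add_assoc, ← add_assoc,
          show (s - p + μ) / 2 = (s + μ) / 2 - p / 2 by ring,
          show (s - p - μ) / 2 = (s - μ) / 2 - p / 2 by ring]
        ring
    _ = _ := by
        rw [hscale, hsum, hsum, hsum, ← add_assoc, ← add_assoc, ← add_assoc, hPM, hPM, hPM]
        ring

end BarnesSecond

lemma integrable_mul_gammaPM {X : Type*} [TopologicalSpace X] [MeasurableSpace X]
    [OpensMeasurableSpace X] [SecondCountableTopologyEither X ℂ] {m : Measure X} {g a μ : X → ℂ}
    {x : ℝ} (hg : Integrable g m) (ha : Continuous a) (hμ : Continuous μ) (hx : 0 < x)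
    (hax : ∀ v, (a v).re = x) (hμ₀ : ∀ v, (μ v).re = 0) :
    Integrable (fun v => g v * gammaPM (a v) (μ v)) m := by
  have h := integrable_mul_Gamma (integrable_mul_Gamma hg (f := fun v => (a v + μ v) / 2)
    (by fun_prop) (half_pos hx) (by simp [hax, hμ₀])) (f := fun v => (a v - μ v) / 2)
    (by fun_prop) (half_pos hx) (by simp [hax, hμ₀])
  simpa only [gammaPM, mul_assoc] using h

namespace TestClass

section FlatGammaQuot

variable {η : ℝ} {H : ℂ → ℂ} {s a₁ a₂ a₃ : ℂ} {κ : ℝ}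

lemma integrable_spectral_mul_gammaPM_mul_gammaQuot (hH : TestClass η H) (hη : 0 < η) {e : ℂ}
    (h₁ : 0 < a₁.re + κ / 2) (h₂ : 0 < a₂.re + κ / 2) (h₃ : 0 < a₃.re + κ / 2)
    (he : 0 < (e - a₃).re) (hκ : κ < s.re) :
    Integrable fun q : ℝ × ℝ => gammaQuot a₁ a₂ a₃ e (κ + q.1 * I) *
      spectral H ((0 : ℝ) + q.2 * I) * gammaPM (s - (κ + q.1 * I)) ((0 : ℝ) + q.2 * I) :=
  integrable_mul_gammaPM ((verticalIntegrable_gammaQuot h₁ h₂ h₃ he).mul_prod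
    (hH.verticalIntegrable_spectral (by simpa))) (by fun_prop) (by fun_prop) (sub_pos.mpr hκ)
    (by simp) (by simp)

theorem vint_mellin_flat_mul_gammaQuot (hH : TestClass η H) (hη : 0 < η)
    (h₁ : 0 < a₁.re + κ / 2) (h₂ : 0 < a₂.re + κ / 2) (h₃ : 0 < a₃.re + κ / 2) (hκ : κ < s.re) :
    vint κ (fun p => mellin (flat H) (s - p - 1 / 2) * (Real.pi : ℂ) ^ (-p) *
        gammaQuot a₁ a₂ a₃ (s + a₁ + a₂ + a₃) p) =
      1 / 2 * (Real.pi : ℂ) ^ (-s) * (vint 0 (fun μ => spectral H μ *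
        (gammaPM (2 * a₁ + s) μ * gammaPM (2 * a₂ + s) μ * gammaPM (2 * a₃ + s) μ)) /
        (Gamma (s + a₂ + a₃) * Gamma (s + a₁ + a₃) * Gamma (s + a₁ + a₂))) := by
  set e := s + a₁ + a₂ + a₃ with he
  have hpi : (Real.pi : ℂ) ≠ 0 := ofReal_ne_zero.mpr Real.pi_ne_zero
  calc _ = 1 / 4 * (Real.pi : ℂ) ^ (-s) * vint κ fun p => vint 0 fun μ =>
        gammaQuot a₁ a₂ a₃ e p * spectral H μ * gammaPM (s - p) μ := by
        rw [← vint_const_mul]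
        refine vint_congr fun p hp => ?_
        have hpow : (Real.pi : ℂ) ^ (-s) =
            (Real.pi : ℂ) ^ (-(s - p - 1 / 2) - 1 / 2) * (Real.pi : ℂ) ^ (-p) := by
          rw [← cpow_add _ _ hpi]
          ring_nf
        simp only [mul_assoc (gammaQuot a₁ a₂ a₃ e p)]
        rw [hH.mellin_flat hη (by simp; linarith), vint_const_mul, hpow]
        simp only [sub_add_cancel]
        ring
    _ = 1 / 4 * (Real.pi : ℂ) ^ (-s) * vint 0 fun μ => spectral H μ *
        vint κ fun p => gammaPM (s - p) μ * gammaQuot a₁ a₂ a₃ e p := by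
        rw [vint_comm (hH.integrable_spectral_mul_gammaPM_mul_gammaQuot hη h₁ h₂ h₃
          (by simp [he]; linarith) hκ)]
        refine congrArg _ (vint_congr fun μ _ => ?_)
        rw [← vint_const_mul]
        exact vint_congr fun p _ => by ring
    _ = 1 / 4 * (Real.pi : ℂ) ^ (-s) * vint 0 fun μ =>
        2 / (Gamma (s + a₂ + a₃) * Gamma (s + a₁ + a₃) * Gamma (s + a₁ + a₂)) * (spectral H μ *
          (gammaPM (2 * a₁ + s) μ * gammaPM (2 * a₂ + s) μ * gammaPM (2 * a₃ + s) μ)) := by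
        refine congrArg _ (vint_congr fun μ hμ => ?_)
        rw [vint_gammaPM_mul_gammaQuot h₁ h₂ h₃ (by rw [hμ, abs_zero]; linarith)]
        ring
    _ = _ := by
        rw [vint_const_mul]
        ring

theorem vint_mellin_flat_mul_gammaQuot_congr (hH : TestClass η H) {N : ℕ} (hN : (N : ℝ) < 2 * η)
    {c : ℝ} (h₁ : 0 < a₁.re + κ / 2) (h₂ : 0 < a₂.re + κ / 2) (h₃ : 0 < a₃.re + κ / 2) {e : ℂ}
    (he : 0 < (e - a₃).re) (hκ : κ < s.re) (hκc : κ ≤ c) (hc : c < s.re + N) :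
    vint c (fun p => mellin (flat H) (s - p - 1 / 2) * (Real.pi : ℂ) ^ (-p) *
        gammaQuot a₁ a₂ a₃ e p) =
      vint κ (fun p => mellin (flat H) (s - p - 1 / 2) * (Real.pi : ℂ) ^ (-p) *
        gammaQuot a₁ a₂ a₃ e p) := by
  obtain ⟨C, -, hquot⟩ := exists_norm_gammaQuot_le_of_strip h₁ h₂ h₃ he c
  obtain ⟨D, hmellin⟩ := exists_norm_mellin_le
    (hH.mellinConvergent_flat hN (w := (s.re - c - 1 / 2 : ℝ)) (by simp; linarith))
    (hH.mellinConvergent_flat hN (w := (s.re - κ - 1 / 2 : ℝ)) (by simp; linarith))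
  have hre : ∀ z : ℂ, (s - z - 1 / 2).re = s.re - z.re - 1 / 2 := fun z => by simp
  have hpi : (Real.pi : ℂ) ≠ 0 := ofReal_ne_zero.mpr Real.pi_ne_zero
  refine (vint_eq_vint_of_differentiableOn (C := D * Real.pi ^ (-κ) * C) hκc
    (fun z ⟨hz₁, hz₂⟩ => ?_) fun z hz₁ hz₂ => ?_).symm
  · refine (((hH.differentiableAt_mellin_flat hN (w := s - z - 1 / 2) ?_).comp z
      (f := fun p => s - p - 1 / 2) (by fun_prop)).mul (.const_cpow (by fun_prop) (.inl hpi))).mul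
      (differentiableAt_gammaQuot ?_ ?_ ?_) |>.differentiableWithinAt
    · rw [hre]
      linarith
    all_goals
      rw [re_add_div_two]
      linarith
  · have hD := hmellin (s - z - 1 / 2) (by rw [hre]; linarith) (by rw [hre]; linarith)
    have hpow : ‖(Real.pi : ℂ) ^ (-z)‖ ≤ Real.pi ^ (-κ) := by
      rw [norm_cpow_eq_rpow_re_of_pos Real.pi_pos]
      exact Real.rpow_le_rpow_of_exponent_le (by linarith [Real.pi_gt_three]) (by simpa)
    rw [norm_mul, norm_mul, mul_assoc (D * _)]
    have hD₀ := (norm_nonneg _).trans hD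
    exact mul_le_mul (mul_le_mul hD hpow (norm_nonneg _) hD₀) (hquot z hz₁ hz₂) (norm_nonneg _)
      (by positivity)

end FlatGammaQuot

end TestClass

/-! ### The one-swap identity -/

section MellinConvolution

lemma ae_prod_restrict_Ioi_snd_pos {Y : Type*} [MeasurableSpace Y] {m : Measure Y} :
    ∀ᵐ q : Y × ℝ ∂(m.prod (volume.restrict (Ioi 0))), 0 < q.2 :=
  Measure.quasiMeasurePreserving_snd.ae (ae_restrict_mem (measurableSet_Ioi (a := (0 : ℝ))))

variable {Y : Type*} [MeasurableSpace Y] {m : Measure Y} {g : Y → ℂ} {r : Y → ℝ}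
  {f W : ℝ → ℂ} {M : ℂ → ℂ} {a : ℂ} {κ : ℝ}

lemma integrable_mellin_convolution_kernel (hr : Measurable r) (hr₀ : ∀ y, 0 < r y)
    (hg : Integrable (fun y => g y * (r y : ℂ) ^ (-κ : ℂ)) m) (hf : MellinConvergent f (a - κ))
    (hM : VerticalIntegrable M κ) :
    Integrable (fun q : (Y × ℝ) × ℝ => g q.1.1 * (r q.1.1 : ℂ) ^ (-(κ + q.2 * I)) *
      ((q.1.2 : ℂ) ^ (a - (κ + q.2 * I) - 1) * f q.1.2) * M (κ + q.2 * I))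
      ((m.prod (volume.restrict (Ioi 0))).prod volume) := by
  have hpos : ∀ᵐ q : (Y × ℝ) × ℝ ∂((m.prod (volume.restrict (Ioi 0))).prod volume), 0 < q.1.2 :=
    Measure.quasiMeasurePreserving_fst.ae ae_prod_restrict_Ioi_snd_pos
  have hphase : Measurable fun q : (Y × ℝ) × ℝ =>
      (r q.1.1 : ℂ) ^ (-(q.2 * I)) * (q.1.2 : ℂ) ^ (-(q.2 * I)) := by fun_prop
  refine (((hg.mul_prod hf).mul_prod hM).mul_bdd (c := 1) hphase.aestronglyMeasurable ?_).congr ?_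
  · filter_upwards [hpos] with q hq
    rw [norm_mul, norm_cpow_eq_rpow_re_of_pos (hr₀ _), norm_cpow_eq_rpow_re_of_pos hq]
    simp
  · filter_upwards [hpos] with q hq
    rw [neg_add, cpow_add _ _ (ofReal_ne_zero.mpr (hr₀ _).ne'),
      show a - (κ + q.2 * I) - 1 = a - κ - 1 + -(q.2 * I) by ring,
      cpow_add _ _ (ofReal_ne_zero.mpr hq.ne'), smul_eq_mul]
    ring

lemma mul_comp_mul_eq_vint (hW : ∀ y, 0 < y → W y = vint κ fun z => (y : ℂ) ^ (-z) * M z)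
    {y : ℝ} (hy : 0 < y) {ρ : ℝ} (hρ : 0 < ρ) (b c : ℂ) :
    b * ((y : ℂ) ^ (a - 1) * c) * W (y * ρ) =
      vint κ fun z => b * (ρ : ℂ) ^ (-z) * ((y : ℂ) ^ (a - z - 1) * c) * M z := by
  rw [hW _ (mul_pos hy hρ), ← vint_const_mul]
  refine vint_congr fun z _ => ?_
  rw [ofReal_mul, mul_cpow_ofReal_nonneg hy.le hρ.le, show a - z - 1 = a - 1 + -z by ring,
    cpow_add _ _ (ofReal_ne_zero.mpr hy.ne')]
  ring

theorem integrable_mul_comp_mul_and_integral_eq_vint [SFinite m] (hr : Measurable r)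
    (hr₀ : ∀ y, 0 < r y)
    (hg : Integrable (fun y => g y * (r y : ℂ) ^ (-κ : ℂ)) m) (hf : MellinConvergent f (a - κ))
    (hM : VerticalIntegrable M κ)
    (hW : ∀ y, 0 < y → W y = vint κ fun z => (y : ℂ) ^ (-z) * M z) :
    Integrable (fun q : Y × ℝ => g q.1 * ((q.2 : ℂ) ^ (a - 1) * f q.2) * W (q.2 * r q.1))
      (m.prod (volume.restrict (Ioi 0))) ∧
    ∫ x in Ioi (0 : ℝ), ∫ y, g y * ((x : ℂ) ^ (a - 1) * f x) * W (x * r y) ∂m =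
      vint κ fun z => (∫ y, g y * (r y : ℂ) ^ (-z) ∂m) * mellin f (a - z) * M z := by
  have hkernel := integrable_mellin_convolution_kernel hr hr₀ hg hf hM
  have hrep : (fun q : Y × ℝ => g q.1 * ((q.2 : ℂ) ^ (a - 1) * f q.2) * W (q.2 * r q.1))
      =ᵐ[m.prod (volume.restrict (Ioi 0))] fun q => vint κ fun z =>
        g q.1 * (r q.1 : ℂ) ^ (-z) * ((q.2 : ℂ) ^ (a - z - 1) * f q.2) * M z := by
    filter_upwards [ae_prod_restrict_Ioi_snd_pos] with q hq
    exact mul_comp_mul_eq_vint hW hq (hr₀ _) _ _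
  have hint := (hkernel.integral_prod_left.const_mul (1 / (2 * Real.pi) : ℂ)).congr hrep.symm
  refine ⟨hint, ?_⟩
  rw [← integral_prod_symm _ hint, integral_congr_ae hrep, integral_vint
    (f := fun (q : Y × ℝ) z => g q.1 * (r q.1 : ℂ) ^ (-z) * ((q.2 : ℂ) ^ (a - z - 1) * f q.2) * M z)
    hkernel]
  refine vint_congr fun z _ => ?_
  rw [integral_mul_const, integral_prod_mul (fun y => g y * (r y : ℂ) ^ (-z))
    (fun x : ℝ => (x : ℂ) ^ (a - z - 1) * f x)]
  rfl

end MellinConvolution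

lemma vint_div_norm_Gamma_sq_mul (H f : ℂ → ℂ) :
    vint 0 (fun μ => H μ / ((‖Gamma μ‖ ^ 2 : ℝ) : ℂ) * f μ) =
      vint 0 (fun μ => spectral H μ * f μ) :=
  vint_congr fun μ hμ => by rw [div_norm_Gamma_sq hμ]

lemma sqrt_cpow {x : ℝ} (hx : 0 < x) (z : ℂ) : (Real.sqrt x : ℂ) ^ z = (x : ℂ) ^ (z / 2) := by
  rw [cpow_eq_exp_log (Real.sqrt_pos.mpr hx), cpow_eq_exp_log hx, Real.log_sqrt hx.le]
  push_cast
  ring_nf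

lemma hasMellin_one_add_sq_cpow_mul_sqrt_cpow {c e z : ℂ} (hc : 0 < c.re)
    (he : c.re < e.re + z.re / 2) :
    IntegrableOn (fun y : ℝ => (y : ℂ) ^ (2 * c - 1) * ((1 + y ^ 2 : ℝ) : ℂ) ^ (-e) *
      (Real.sqrt (1 + y ^ 2) : ℂ) ^ (-z)) (Ioi 0) ∧
    ∫ y in Ioi (0 : ℝ), (y : ℂ) ^ (2 * c - 1) * ((1 + y ^ 2 : ℝ) : ℂ) ^ (-e) *
      (Real.sqrt (1 + y ^ 2) : ℂ) ^ (-z) =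
        1 / 2 * (Gamma c * Gamma (e - c + z / 2) / Gamma (e + z / 2)) := by
  have hkernel : ∀ y : ℝ, (y : ℂ) ^ (2 * c - 1) * ((1 + y ^ 2 : ℝ) : ℂ) ^ (-e) *
      (Real.sqrt (1 + y ^ 2) : ℂ) ^ (-z) =
        (y : ℂ) ^ (2 * c - 1) • ((1 + y ^ 2 : ℝ) : ℂ) ^ (-(e + z / 2)) := fun y => by
    have hy : (0 : ℝ) < 1 + y ^ 2 := by positivity
    rw [sqrt_cpow hy, smul_eq_mul, mul_assoc, ← cpow_add _ _ (ofReal_ne_zero.mpr hy.ne'), neg_div,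
      neg_add]
  have h := hasMellin_one_add_sq_cpow (c := c) (q := e + z / 2) hc (by simpa)
  simp only [hkernel, sub_add_eq_add_sub]
  exact h

lemma swapIntegrand_eq (β : Fin 3 → ℂ) (h : ℝ → ℂ) (s : ℂ) {y₀ y₁ : ℝ} (hy₀ : 0 < y₀)
    (hy₁ : 0 < y₁) :
    swapIntegrand β h s y₀ y₁ = (y₀ : ℂ) ^ (2 * (s - β 2 / 2) - 1) *
      ((1 + y₀ ^ 2 : ℝ) : ℂ) ^ (-(1 / 2 - 3 / 4 * β 2 + 1 / 4)) *
      ((y₁ : ℂ) ^ (s - β 2 / 2 - 2) * h y₁) *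
      whittaker ((β 0 - β 1) / 2) (y₁ * Real.sqrt (1 + y₀ ^ 2)) := by
  have hy₀' : (y₀ : ℂ) ≠ 0 := ofReal_ne_zero.mpr hy₀.ne'
  have hy₁' : (y₁ : ℂ) ≠ 0 := ofReal_ne_zero.mpr hy₁.ne'
  rw [swapIntegrand, cpow_sub _ (1 : ℂ) hy₀', cpow_one, cpow_sub _ (2 : ℂ) hy₁', cpow_ofNat,
    show -(1 / 2 - 3 / 4 * β 2 + 1 / 4) = -(3 / 4 : ℂ) * (1 - β 2) by ring,
    show 2 * (s - β 2 / 2) = 2 * s - β 2 by ring]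
  ring

namespace TestClass

section OneSwap

variable {η : ℝ} {H : ℂ → ℂ}

theorem verticalIntegrable_mul_gammaPM (hH : TestClass η H) (hη : 0 < η) {a b c : ℂ}
    (ha : 0 < a.re) (hb : 0 < b.re) (hc : 0 < c.re) :
    VerticalIntegrable (fun μ => H μ / ((‖Gamma μ‖ ^ 2 : ℝ) : ℂ) *
      (gammaPM a μ * gammaPM b μ * gammaPM c μ)) 0 := by
  have hline : ∀ {g : ℂ → ℂ} {a : ℂ}, 0 < a.re → VerticalIntegrable g 0 →
      VerticalIntegrable (fun μ => g μ * gammaPM a μ) 0 := fun ha hg =>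
    integrable_mul_gammaPM hg continuous_const (by fun_prop) ha (by simp) (by simp)
  refine (hline hc (hline hb (hline ha (hH.verticalIntegrable_spectral (by simpa))))).congr
    (.of_forall fun v => ?_)
  beta_reduce
  rw [← div_norm_Gamma_sq (by simp)]
  ring

lemma vint_flat_mul_whittaker_kernel_eq (hH : TestClass η H) (hη : 0 < η) {c e ν : ℂ} {κ : ℝ}
    (hν : |ν.re| < κ) (hκ : κ < c.re) (he : c.re < e.re + κ / 2) :
    vint κ (fun p => 1 / 2 * (Gamma c * Gamma (e - c + p / 2) / Gamma (e + p / 2)) *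
      mellin (flat H) (c - p - 1 / 2) * (1 / 2 * (Real.pi : ℂ) ^ (-p) * gammaPM p ν)) =
    (Real.pi : ℂ) ^ (-c) / 8 * (Gamma (e - ν / 2))⁻¹ * (Gamma (e + ν / 2))⁻¹ *
      vint 0 fun μ => spectral H μ *
        (gammaPM (c + ν) μ * gammaPM (c - ν) μ * gammaPM (2 * e - c) μ) := by
  obtain ⟨hν₁, hν₂⟩ := abs_lt.mp hν
  have hΓ : Gamma c ≠ 0 := Gamma_ne_zero_of_re_pos (by linarith)
  have hquot := hH.vint_mellin_flat_mul_gammaQuot hη (s := c) (a₁ := ν / 2) (a₂ := -(ν / 2))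
    (a₃ := e - c) (κ := κ) (by simp; linarith) (by simp; linarith) (by simp; linarith) hκ
  have he' : c + ν / 2 + -(ν / 2) + (e - c) = e := by ring
  have hden₁ : c + -(ν / 2) + (e - c) = e - ν / 2 := by ring
  have hden₂ : c + ν / 2 + (e - c) = e + ν / 2 := by ring
  have hden₃ : c + ν / 2 + -(ν / 2) = c := by ring
  have hnum₁ : 2 * (ν / 2) + c = c + ν := by ring
  have hnum₂ : 2 * -(ν / 2) + c = c - ν := by ring
  have hnum₃ : 2 * (e - c) + c = 2 * e - c := by ring
  rw [he', hden₁, hden₂, hden₃, hnum₁, hnum₂, hnum₃] at hquot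
  calc _ = 1 / 4 * Gamma c * vint κ fun p => mellin (flat H) (c - p - 1 / 2) *
        (Real.pi : ℂ) ^ (-p) * gammaQuot (ν / 2) (-(ν / 2)) (e - c) e p := by
        rw [← vint_const_mul]
        refine vint_congr fun p _ => ?_
        rw [gammaQuot, gammaPM, show (p + ν) / 2 = ν / 2 + p / 2 by ring,
          show (p - ν) / 2 = -(ν / 2) + p / 2 by ring]
        ring
    _ = _ := by
        rw [hquot]
        field_simp
        ring

theorem integrable_flat_mul_whittaker_and_integral_eq (hH : TestClass η H) (hη : 0 < η)
    {c e ν : ℂ} (hν : |ν.re| < c.re) (he : c.re < 2 * e.re) :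
    IntegrableOn (fun q : ℝ × ℝ => (q.1 : ℂ) ^ (2 * c - 1) *
      ((1 + q.1 ^ 2 : ℝ) : ℂ) ^ (-(e + 1 / 4)) * ((q.2 : ℂ) ^ (c - 2) * flat H q.2) *
      whittaker ν (q.2 * Real.sqrt (1 + q.1 ^ 2))) (Ioi 0 ×ˢ Ioi 0) ∧
    ∫ y₁ in Ioi (0 : ℝ), ∫ y₀ in Ioi (0 : ℝ), (y₀ : ℂ) ^ (2 * c - 1) *
      ((1 + y₀ ^ 2 : ℝ) : ℂ) ^ (-(e + 1 / 4)) * ((y₁ : ℂ) ^ (c - 2) * flat H y₁) *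
      whittaker ν (y₁ * Real.sqrt (1 + y₀ ^ 2)) =
        (Real.pi : ℂ) ^ (-c) / 8 * (Gamma (e - ν / 2))⁻¹ * (Gamma (e + ν / 2))⁻¹ *
          vint 0 fun μ => spectral H μ *
            (gammaPM (c + ν) μ * gammaPM (c - ν) μ * gammaPM (2 * e - c) μ) := by
  obtain ⟨κ, hκ, hκc⟩ : ∃ κ, max |ν.re| (2 * c.re - 2 * e.re) < κ ∧ κ < c.re :=
    exists_between (max_lt hν (by linarith))
  obtain ⟨hκν, hκe⟩ := max_lt_iff.mp hκ
  have hc : 0 < c.re := (abs_nonneg _).trans_lt hν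
  have hline : ∀ z : ℂ, z.re = κ - 1 / 2 → c.re < (e + 1 / 4).re + z.re / 2 := fun z hz => by
    rw [hz]
    norm_num
    linarith
  obtain ⟨hint, hval⟩ := integrable_mul_comp_mul_and_integral_eq_vint
    (m := volume.restrict (Ioi (0 : ℝ))) (r := fun y => Real.sqrt (1 + y ^ 2)) (a := c - 1)
    (κ := κ - 1 / 2) (by fun_prop) (fun y => by positivity)
    (hasMellin_one_add_sq_cpow_mul_sqrt_cpow hc (hline _ (ofReal_re _))).1
    (hH.mellinConvergent_flat (N := 0) (by simpa) (by simp; linarith))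
    (verticalIntegrable_mellin_whittaker (μ := ν) (by linarith))
    fun y hy => whittaker_eq_vint (by linarith) hy
  rw [show c - 1 - 1 = c - 2 by ring] at hint hval
  refine ⟨by rwa [IntegrableOn, Measure.volume_eq_prod, ← Measure.prod_restrict], ?_⟩
  have hshift := vint_comp_add_left (κ - 1 / 2) (1 / 2 : ℂ) fun p =>
    1 / 2 * (Gamma c * Gamma (e - c + p / 2) / Gamma (e + p / 2)) *
      mellin (flat H) (c - p - 1 / 2) * (1 / 2 * (Real.pi : ℂ) ^ (-p) * gammaPM p ν)
  rw [show ((1 / 2 : ℂ)).re + (κ - 1 / 2) = κ by norm_num] at hshift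
  rw [hval, ← hH.vint_flat_mul_whittaker_kernel_eq hη hκν hκc (by linarith), ← hshift]
  refine vint_congr fun z hz => ?_
  rw [(hasMellin_one_add_sq_cpow_mul_sqrt_cpow hc (hline z hz)).2,
    (hasMellin_whittaker (by linarith)).2]
  ring_nf

theorem integrableOn_swapIntegrand_and_integral_eq (hH : TestClass η H) (hη : 0 < η)
    {β : Fin 3 → ℂ} (hβ : β 0 + β 1 + β 2 = 0) {s : ℂ} (h₀ : -(β 0).re < s.re)
    (h₁ : -(β 1).re < s.re) (h₂ : s.re < 1 - (β 2).re) :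
    IntegrableOn (fun p : ℝ × ℝ => swapIntegrand β (flat H) s p.1 p.2) (Ioi 0 ×ˢ Ioi 0) ∧
    ∫ y₁ in Ioi (0 : ℝ), ∫ y₀ in Ioi (0 : ℝ), swapIntegrand β (flat H) s y₀ y₁ =
      (Real.pi : ℂ) ^ (-(s - β 2 / 2)) / 8 * (Gamma ((1 + β 1 - β 2) / 2))⁻¹ *
        (Gamma ((1 + β 0 - β 2) / 2))⁻¹ * vint 0 (oneSwap β H s) := by
  have hβr : (β 0).re + (β 1).re + (β 2).re = 0 := by simpa using congrArg re hβ
  obtain ⟨hint, hval⟩ := hH.integrable_flat_mul_whittaker_and_integral_eq hη (c := s - β 2 / 2)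
    (e := 1 / 2 - 3 / 4 * β 2) (ν := (β 0 - β 1) / 2)
    (by simp only [sub_re, div_ofNat_re]; rw [abs_lt]; constructor <;> linarith)
    (by simp; linarith)
  refine ⟨hint.congr_fun (fun q hq => (swapIntegrand_eq β _ s hq.1 hq.2).symm)
    (measurableSet_Ioi.prod measurableSet_Ioi), ?_⟩
  have hΓ₁ : (1 : ℂ) / 2 - 3 / 4 * β 2 - (β 0 - β 1) / 2 / 2 = (1 + β 1 - β 2) / 2 := by
    linear_combination (-1 / 4 : ℂ) * hβ
  have hΓ₀ : (1 : ℂ) / 2 - 3 / 4 * β 2 + (β 0 - β 1) / 2 / 2 = (1 + β 0 - β 2) / 2 := by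
    linear_combination (-1 / 4 : ℂ) * hβ
  have hc₀ : s - β 2 / 2 + (β 0 - β 1) / 2 = s + β 0 := by linear_combination (-1 / 2 : ℂ) * hβ
  have hc₁ : s - β 2 / 2 - (β 0 - β 1) / 2 = s + β 1 := by linear_combination (-1 / 2 : ℂ) * hβ
  have hc₂ : 2 * (1 / 2 - 3 / 4 * β 2) - (s - β 2 / 2) = 1 - s - β 2 := by ring
  rw [hΓ₁, hΓ₀, hc₀, hc₁, hc₂, ← vint_div_norm_Gamma_sq_mul] at hval
  rw [setIntegral_congr_fun measurableSet_Ioi fun y₁ hy₁ => setIntegral_congr_fun measurableSet_Ioi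
    fun y₀ hy₀ => swapIntegrand_eq β (flat H) s hy₀ hy₁, hval]
  rfl

end OneSwap

end TestClass

/-! ### Continuation of the Mellin–Barnes integral -/

theorem vint_Gamma_half_barnes_second {A B₁ B₂ B₃ : ℂ} {ε : ℝ} (hε : 0 < ε)
    (hA : 0 < A.re + ε / 2) (hB₁ : ε / 2 < B₁.re) (hB₂ : ε / 2 < B₂.re) (hB₃ : ε / 2 < B₃.re) :
    vint ε (fun u => Gamma (u / 2) * Gamma (A + u / 2) * Gamma (B₁ - u / 2) * Gamma (B₂ - u / 2) *
      (Gamma (B₃ - u / 2) / Gamma (A + B₁ + B₂ + B₃ - u / 2))) =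
    2 * (Gamma B₁ * Gamma B₂ * Gamma B₃ * (Gamma (A + B₁) * Gamma (A + B₂) * Gamma (A + B₃)) /
      (Gamma (A + B₂ + B₃) * Gamma (A + B₁ + B₃) * Gamma (A + B₁ + B₂))) := by
  have hbarnes := barnes_second (a₁ := B₁) (a₂ := B₂) (a₃ := B₃) (b₁ := 0) (b₂ := A)
    (c := -(1 / 2 * ε)) (by linarith) (by linarith) (by linarith) (by simpa) (by linarith)
  rw [← vint_comp_neg, ← vint_comp_mul_left one_half_pos ε] at hbarnes
  push_cast at hbarnes
  rw [one_div, inv_mul_eq_iff_eq_mul₀ two_ne_zero] at hbarnes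
  refine (vint_congr fun u _ => ?_).trans (hbarnes.trans ?_) <;> ring_nf

lemma exists_eventually_norm_gammaQuot_le {X : Type*} [TopologicalSpace X] {a₁ a₂ a₃ e : X → ℂ}
    {x₀ : X} {c : ℝ} (k : ℕ) (hc₁ : ContinuousAt a₁ x₀) (hc₂ : ContinuousAt a₂ x₀)
    (hc₃ : ContinuousAt a₃ x₀) (hce : ContinuousAt e x₀) (h₁ : 0 < (a₁ x₀).re + c / 2)
    (h₂ : 0 < (a₂ x₀).re + c / 2) (h₃ : k < (a₃ x₀).re + c / 2)
    (he : 0 < (e x₀ - a₃ x₀).re + k) :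
    ∃ C : ℝ, ∀ᶠ x in nhds x₀, ∀ p : ℂ, p.re = c →
      ‖gammaQuot (a₁ x) (a₂ x) (a₃ x) (e x) p‖ ≤ C * (1 + p.im ^ 2)⁻¹ := by
  obtain ⟨δ, hδ, hδ'⟩ := exists_between (lt_min (lt_min h₁ h₂) (lt_min (sub_pos.mpr h₃) he))
  simp only [lt_min_iff] at hδ'
  obtain ⟨⟨hδ₁, hδ₂⟩, hδ₃, hδe⟩ := hδ'
  set M := ‖a₁ x₀‖ + ‖a₂ x₀‖ + ‖a₃ x₀‖ + ‖e x₀‖ + |c| + 1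
  obtain ⟨C, -, hC⟩ := exists_norm_gammaQuot_le k hδ (M := M) (by positivity)
  have hnorm : ∀ {a : X → ℂ}, ContinuousAt a x₀ → ∀ᶠ x in nhds x₀, ‖a x‖ < ‖a x₀‖ + 1 := fun ha =>
    ha.norm.eventually_lt_const (lt_add_one _)
  have hre : ∀ {a : X → ℂ} {y : ℝ}, ContinuousAt a x₀ → y < (a x₀).re →
      ∀ᶠ x in nhds x₀, y < (a x).re := fun ha hy =>
    (continuous_re.continuousAt.comp ha).eventually_const_lt hy
  have hn₁ := norm_nonneg (a₁ x₀)
  have hn₂ := norm_nonneg (a₂ x₀)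
  have hn₃ := norm_nonneg (a₃ x₀)
  have hne := norm_nonneg (e x₀)
  have hc := le_abs_self c
  have hc₀ := abs_nonneg c
  refine ⟨C, ?_⟩
  filter_upwards [hnorm hc₁, hnorm hc₂, hnorm hc₃, hnorm hce,
    hre (y := δ - c / 2) hc₁ (by linarith), hre (y := δ - c / 2) hc₂ (by linarith),
    hre (y := k + δ - c / 2) hc₃ (by linarith),
    hre (y := δ - k) (hce.sub hc₃) (by rw [Pi.sub_apply]; linarith)]
    with x hx₁ hx₂ hx₃ hxe hr₁ hr₂ hr₃ hre p hp
  rw [Pi.sub_apply] at hre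
  refine hC _ _ _ _ _ ?_ ?_ ?_ ?_ ?_ ?_ ?_ ?_ ?_
  all_goals
    try rw [re_add_div_two, hp]
    linarith [re_le_norm (a₁ x), re_le_norm (a₂ x)]

/-- The Mellin–Barnes integral of the Mellin transform of `H^♭` against `gammaQuot`, with the fourth
parameter tied to the others as in Barnes' second lemma. The continuations of the dual transform are
Gamma factors times such integrals. -/
noncomputable def mellinBarnes (c : ℝ) (H : ℂ → ℂ) (a₁ a₂ a₃ s : ℂ) : ℂ :=
  vint c fun p => mellin (flat H) (s - p - 1 / 2) * (Real.pi : ℂ) ^ (-p) *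
    gammaQuot a₁ a₂ a₃ (s + a₁ + a₂ + a₃) p

namespace TestClass

section MellinBarnes

variable {η c : ℝ} {H : ℂ → ℂ} {N : ℕ}

lemma exists_norm_mellin_flat_le (hH : TestClass η H) (hN : (N : ℝ) < 2 * η) {a b : ℝ}
    (ha : -((N : ℝ) + 1 / 2) < a) (hab : a ≤ b) :
    ∃ C : ℝ, ∀ w : ℂ, a ≤ w.re → w.re ≤ b → ‖mellin (flat H) w‖ ≤ C :=
  exists_norm_mellin_le (hH.mellinConvergent_flat hN (by rwa [ofReal_re]))
    (hH.mellinConvergent_flat hN (by rw [ofReal_re]; linarith))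

lemma exists_eventually_norm_mellin_flat_sub_le (hH : TestClass η H) (hN : (N : ℝ) < 2 * η)
    {s₀ : ℂ} (hs₀ : c < s₀.re + N) :
    ∃ C : ℝ, ∀ᶠ s in nhds s₀, ∀ p : ℂ, p.re = c → ‖mellin (flat H) (s - p - 1 / 2)‖ ≤ C := by
  obtain ⟨x, hx, hxs⟩ := exists_between (sub_lt_iff_lt_add.mpr hs₀)
  obtain ⟨C, hC⟩ := hH.exists_norm_mellin_flat_le hN (a := x - c - 1 / 2)
    (b := s₀.re + 1 - c - 1 / 2) (by linarith) (by linarith)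
  refine ⟨C, ?_⟩
  filter_upwards [continuous_re.continuousAt.eventually_const_lt hxs,
    continuous_re.continuousAt.eventually_lt_const (lt_add_one s₀.re)] with s h₁ h₂ p hp
  have hre : (s - p - 1 / 2).re = s.re - c - 1 / 2 := by simp [hp]
  exact hC _ (by linarith) (by linarith)

lemma continuous_mellinBarnes_integrand (hH : TestClass η H) (hN : (N : ℝ) < 2 * η)
    {a₁ a₂ a₃ e s : ℂ} (hs : c < s.re + N) (h₁ : 0 < a₁.re + c / 2) (h₂ : 0 < a₂.re + c / 2)
    (h₃ : 0 < a₃.re + c / 2) :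
    Continuous fun v : ℝ => mellin (flat H) (s - (c + v * I) - 1 / 2) *
      (Real.pi : ℂ) ^ (-(c + v * I)) * gammaQuot a₁ a₂ a₃ e (c + v * I) := by
  refine continuous_iff_continuousAt.mpr fun v => ?_
  have hmellin : DifferentiableAt ℂ (mellin (flat H)) (s - (c + v * I) - 1 / 2) :=
    hH.differentiableAt_mellin_flat hN (by simp; linarith)
  have hquot : DifferentiableAt ℂ (gammaQuot a₁ a₂ a₃ e) (c + v * I) :=
    differentiableAt_gammaQuot (by simpa) (by simpa) (by simpa)
  refine ((hmellin.continuousAt.comp (f := fun v : ℝ => s - (c + v * I) - 1 / 2)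
    (by fun_prop)).mul ?_).mul (hquot.continuousAt.comp (f := fun v : ℝ => (c + v * I : ℂ))
    (by fun_prop))
  exact (Continuous.const_cpow (by fun_prop)
    (.inl (ofReal_ne_zero.mpr Real.pi_ne_zero))).continuousAt

lemma differentiableAt_mellinBarnes_integrand (hH : TestClass η H) (hN : (N : ℝ) < 2 * η)
    {a₁ a₂ a₃ e : ℂ → ℂ} {s p : ℂ} (hd₁ : DifferentiableAt ℂ a₁ s) (hd₂ : DifferentiableAt ℂ a₂ s)
    (hd₃ : DifferentiableAt ℂ a₃ s) (hde : DifferentiableAt ℂ e s) (hs : p.re < s.re + N)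
    (h₁ : 0 < (a₁ s).re + p.re / 2) (h₂ : 0 < (a₂ s).re + p.re / 2)
    (h₃ : 0 < (a₃ s).re + p.re / 2) :
    DifferentiableAt ℂ (fun s => mellin (flat H) (s - p - 1 / 2) * (Real.pi : ℂ) ^ (-p) *
      gammaQuot (a₁ s) (a₂ s) (a₃ s) (e s) p) s := by
  have hmellin : DifferentiableAt ℂ (fun s => mellin (flat H) (s - p - 1 / 2)) s :=
    (hH.differentiableAt_mellin_flat hN (by simp; linarith)).comp s
      (f := fun s => s - p - 1 / 2) (by fun_prop)
  have hΓ : ∀ {a : ℂ → ℂ}, DifferentiableAt ℂ a s → 0 < (a s).re + p.re / 2 →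
      DifferentiableAt ℂ (fun s => Gamma (a s + p / 2)) s := fun {a} ha hre =>
    (differentiableAt_Gamma_of_re_pos (by rwa [re_add_div_two])).comp s
      (f := fun s => a s + p / 2) (by fun_prop)
  have hΓinv : DifferentiableAt ℂ (fun s => (Gamma (e s + p / 2))⁻¹) s :=
    (differentiable_one_div_Gamma _).comp s (f := fun s => e s + p / 2) (by fun_prop)
  exact (hmellin.mul_const _).mul (((hΓ hd₁ h₁).mul (hΓ hd₂ h₂)).mul ((hΓ hd₃ h₃).mul hΓinv))

theorem differentiableOn_mellinBarnes (hH : TestClass η H) (hN : (N : ℝ) < 2 * η) (k : ℕ)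
    {U : Set ℂ} (hU : IsOpen U) {a₁ a₂ a₃ : ℂ → ℂ} (hd₁ : Differentiable ℂ a₁)
    (hd₂ : Differentiable ℂ a₂) (hd₃ : Differentiable ℂ a₃) (hs : ∀ s ∈ U, c < s.re + N)
    (h₁ : ∀ s ∈ U, 0 < (a₁ s).re + c / 2) (h₂ : ∀ s ∈ U, 0 < (a₂ s).re + c / 2)
    (h₃ : ∀ s ∈ U, k < (a₃ s).re + c / 2) (h₁₂ : ∀ s ∈ U, 0 < (s + a₁ s + a₂ s).re + k) :
    DifferentiableOn ℂ (fun s => mellinBarnes c H (a₁ s) (a₂ s) (a₃ s) s) U := by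
  have hde : Differentiable ℂ fun s => s + a₁ s + a₂ s + a₃ s := by fun_prop
  have h₃' : ∀ s ∈ U, 0 < (a₃ s).re + c / 2 := fun s hsU => k.cast_nonneg.trans_lt (h₃ s hsU)
  refine (differentiableOn_integral_of_locally_dominated hU
    (fun s hsU => (hH.continuous_mellinBarnes_integrand hN (hs s hsU) (h₁ s hsU) (h₂ s hsU)
      (h₃' s hsU)).aestronglyMeasurable)
    (fun v s hsU => (hH.differentiableAt_mellinBarnes_integrand hN (hd₁ s) (hd₂ s) (hd₃ s) (hde s)
      (by simpa using hs s hsU) (by simpa using h₁ s hsU) (by simpa using h₂ s hsU)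
      (by simpa using h₃' s hsU)).differentiableWithinAt) fun s₀ hs₀ => ?_).const_mul _
  obtain ⟨D, hD⟩ := hH.exists_eventually_norm_mellin_flat_sub_le hN (hs s₀ hs₀)
  obtain ⟨C, hC⟩ := exists_eventually_norm_gammaQuot_le k (hd₁ s₀).continuousAt
    (hd₂ s₀).continuousAt (hd₃ s₀).continuousAt (hde s₀).continuousAt (h₁ s₀ hs₀) (h₂ s₀ hs₀)
    (h₃ s₀ hs₀) (by rw [add_sub_cancel_right]; exact h₁₂ s₀ hs₀)
  obtain ⟨r, hr, hball⟩ := Metric.eventually_nhds_iff_ball.mp (hD.and hC)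
  refine ⟨r, hr, fun v => D * Real.pi ^ (-c) * (C * (1 + v ^ 2)⁻¹),
    (integrable_inv_one_add_sq.const_mul C).const_mul _, fun s hs v => ?_⟩
  have hline : ((c : ℂ) + v * I).re = c ∧ ((c : ℂ) + v * I).im = v := by simp
  have hmellin := (hball s hs).1 _ hline.1
  have hquot := (hball s hs).2 _ hline.1
  rw [hline.2] at hquot
  rw [norm_mul, norm_mul, norm_cpow_eq_rpow_re_of_pos Real.pi_pos, neg_re, hline.1]
  have := Real.pi_pos
  have := (norm_nonneg _).trans hmellin
  exact mul_le_mul (by gcongr) hquot (norm_nonneg _) (by positivity)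

end MellinBarnes

end TestClass

/-! ### The dual transform -/

section FinThree

variable {M : Type*} [CommMonoid M] (f : Fin 3 → M) (i : Fin 3)

@[to_additive]
lemma prod_fin_three : ∏ l, f l = f i * (f (i + 1) * f (i + 2)) := by
  rw [Fin.prod_univ_three]
  fin_cases i
  · exact mul_assoc _ _ _
  · exact (mul_assoc _ _ _).trans ((mul_comm _ _).trans (mul_assoc _ _ _))
  · exact mul_comm _ _

lemma prod_erase_fin_three : ∏ l ∈ Finset.univ.erase i, f l = f (i + 1) * f (i + 2) := by
  have herase : Finset.univ.erase i = {i + 1, i + 2} := by fin_cases i <;> decide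
  rw [herase, Finset.prod_pair (by fin_cases i <;> decide)]

end FinThree

section DualIntegrand

variable {α : Fin 3 → ℂ} {H : ℂ → ℂ} {i : Fin 3} {s₀ s s₁ u : ℂ}

lemma Gamma_mul_Gamma_dual (hs₀ : s₀ = 1 - α i ∨ s₀ = 2 * s - 1) :
    Gamma ((s₀ - u + α i) / 2) * Gamma (s - (s₀ + u) / 2) =
      Gamma ((1 - u) / 2) * Gamma (s - 1 / 2 + α i / 2 - u / 2) := by
  rcases hs₀ with rfl | rfl
  · congr 2 <;> ring
  · rw [mul_comm]
    congr 2 <;> ring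

lemma dualIntegrand_eq (hs₀ : s₀ = 1 - α i ∨ s₀ = 2 * s - 1) (hu : u.re < 1) :
    dualIntegrand α H s₀ s s₁ u = mellin (flat H) (s - s₁ - 1 / 2) * (Real.pi : ℂ) ^ (-s₁) *
      (Gamma ((s₁ - α i) / 2) * (Gamma ((s₁ - α (i + 1)) / 2) * Gamma ((s₁ - α (i + 2)) / 2)) /
        Gamma ((1 + s₁) / 2 - s₀)) *
      (Gamma (u / 2) * Gamma (s₁ / 2 - s₀ / 2 + 1 / 2 - s + u / 2) *
        Gamma (s - 1 / 2 + α i / 2 - u / 2) * Gamma ((s₀ + α (i + 1)) / 2 - u / 2) *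
        (Gamma ((s₀ + α (i + 2)) / 2 - u / 2) / Gamma ((s₀ - u + s₁) / 2))) := by
  have hne : Gamma ((1 - u) / 2) ≠ 0 := Gamma_ne_zero_of_re_pos (by simp; linarith)
  have hA : (s₁ - (s₀ - u)) / 2 + 1 / 2 - s = s₁ / 2 - s₀ / 2 + 1 / 2 - s + u / 2 := by ring
  have hB : ∀ l, (s₀ - u + α l) / 2 = (s₀ + α l) / 2 - u / 2 := fun l => by ring
  have hcancel := Gamma_mul_Gamma_dual (u := u) hs₀
  rw [hB] at hcancel
  simp only [dualIntegrand, prod_fin_three _ i, hA, hB]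
  congr 1
  rw [mul_div_assoc']
  refine Eq.trans ?_ (mul_div_mul_left _ _ hne)
  congr 1
  linear_combination (Gamma (u / 2) * Gamma (s₁ / 2 - s₀ / 2 + 1 / 2 - s + u / 2) *
    Gamma ((s₀ + α (i + 1)) / 2 - u / 2) * Gamma ((s₀ + α (i + 2)) / 2 - u / 2)) * hcancel

lemma dual_param_re_bounds (hα : |(α i).re| < eps) (hs₀ : s₀ = 1 - α i ∨ s₀ = 2 * s - 1)
    (hs : s ∈ strip (1 / 2 + eps) 4) : 2 * eps < s₀.re ∧ s₀.re < 7 := by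
  have hs' := hs.1
  have hs'' := hs.2
  rw [abs_lt] at hα
  rw [eps] at *
  rcases hs₀ with rfl | rfl
  · simp only [sub_re, one_re]
    constructor <;> linarith
  · simp only [sub_re, mul_re, re_ofNat, im_ofNat, zero_mul, sub_zero, one_re]
    constructor <;> linarith

end DualIntegrand

section DualTransform

variable {η : ℝ} {α : Fin 3 → ℂ} {H : ℂ → ℂ} {i : Fin 3} {s₀ s s₁ : ℂ}

theorem vint_dualIntegrand (hsum : ∑ l, α l = 0) (hα : ∀ l, |(α l).re| < eps)
    (hs₀ : s₀ = 1 - α i ∨ s₀ = 2 * s - 1) (hs : s ∈ strip (1 / 2 + eps) 4) (hs₁ : 14 < s₁.re) :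
    vint eps (fun u => dualIntegrand α H s₀ s s₁ u) =
      2 * (Gamma (s - 1 / 2 + α i / 2) * Gamma ((s₀ + α (i + 1)) / 2) *
        Gamma ((s₀ + α (i + 2)) / 2)) * (mellin (flat H) (s - s₁ - 1 / 2) * (Real.pi : ℂ) ^ (-s₁) *
      (Gamma ((s₁ - α i) / 2) * Gamma ((s₁ - s₀ + α i) / 2) *
        (Gamma (1 / 2 - s + α (i + 1) / 2 + s₁ / 2) * Gamma (1 / 2 - s + α (i + 2) / 2 + s₁ / 2)) /
        (Gamma ((1 + s₁) / 2 - s₀) * Gamma ((s₁ + s₀ + 1 - α i) / 2 - s)))) := by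
  obtain ⟨hs₀₁, hs₀₂⟩ := dual_param_re_bounds (hα i) hs₀ hs
  have hs' := hs.1
  have hs'' := hs.2
  have hα' := fun l => abs_lt.mp (hα l)
  have hsum' : α i + (α (i + 1) + α (i + 2)) = 0 := by rw [← sum_fin_three, hsum]
  have heps : eps = 1 / 100 := rfl
  have hΓ : ∀ l, Gamma ((s₁ - α l) / 2) ≠ 0 := fun l =>
    Gamma_ne_zero_of_re_pos (by simp; linarith [hα' l])
  have hB : ∀ l, eps / 2 < ((s₀ + α l) / 2).re := fun l => by simp; linarith [hα' l]
  set A := s₁ / 2 - s₀ / 2 + 1 / 2 - s with hA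
  have hC : ∀ u, (s₀ - u + s₁) / 2 = A + (s - 1 / 2 + α i / 2) + (s₀ + α (i + 1)) / 2 +
      (s₀ + α (i + 2)) / 2 - u / 2 := fun u => by linear_combination (-1 / 2 : ℂ) * hsum'
  rw [vint_congr fun u hu => dualIntegrand_eq (H := H) (s₁ := s₁) hs₀
    (hu.trans_lt (by rw [heps]; norm_num)), vint_const_mul]
  simp only [← hA, hC]
  rw [vint_Gamma_half_barnes_second (by rw [heps]; norm_num)
    (by simp [hA]; linarith) (by simp; linarith [hα' i]) (hB _) (hB _),
    show A + (s - 1 / 2 + α i / 2) + (s₀ + α (i + 2)) / 2 = (s₁ - α (i + 1)) / 2 by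
      rw [hA]; linear_combination (1 / 2 : ℂ) * hsum',
    show A + (s - 1 / 2 + α i / 2) + (s₀ + α (i + 1)) / 2 = (s₁ - α (i + 2)) / 2 by
      rw [hA]; linear_combination (1 / 2 : ℂ) * hsum',
    show A + (s₀ + α (i + 1)) / 2 + (s₀ + α (i + 2)) / 2 = (s₁ + s₀ + 1 - α i) / 2 - s by
      rw [hA]; linear_combination (1 / 2 : ℂ) * hsum',
    show A + (s - 1 / 2 + α i / 2) = (s₁ - s₀ + α i) / 2 by rw [hA]; ring,
    show A + (s₀ + α (i + 1)) / 2 = 1 / 2 - s + α (i + 1) / 2 + s₁ / 2 by rw [hA]; ring,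
    show A + (s₀ + α (i + 2)) / 2 = 1 / 2 - s + α (i + 2) / 2 + s₁ / 2 by rw [hA]; ring]
  have hcancel : ∀ {x y : ℂ}, x ≠ 0 → y ≠ 0 → ∀ m a b c d e g h : ℂ,
      m * (a * (x * y) / d) * (2 * (b * (c * g * h) / (e * x * y))) =
        2 * b * (m * (a * c * (g * h) / (d * e))) := fun hx hy m a b c d e g h => by
    field_simp
  exact hcancel (hΓ _) (hΓ _) _ _ _ _ _ _ _ _

theorem dualTransform_one_sub_eq (hη : 16 < η) (hsum : ∑ l, α l = 0) (hα : ∀ l, |(α l).re| < eps)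
    (i : Fin 3) (hs : s ∈ strip (1 / 2 + eps) 4) :
    dualTransform η α H (1 - α i) s = Gamma (s - 1 / 2 + α i / 2) *
      (2 * (Real.sqrt Real.pi : ℂ) *
        (Gamma ((1 - α i + α (i + 1)) / 2) * Gamma ((1 - α i + α (i + 2)) / 2)) *
        mellinBarnes (η - 1 / 2) H (-α i / 2) (1 / 2 - s + α (i + 1) / 2)
          (1 / 2 - s + α (i + 2) / 2) s) := by
  have hsum' : α i + (α (i + 1) + α (i + 2)) = 0 := by rw [← sum_fin_three, hsum]
  have hα' := abs_lt.mp (hα i)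
  have heps : eps = 1 / 100 := rfl
  rw [dualTransform, vint_congr fun s₁ hs₁ => vint_dualIntegrand hsum hα (.inl rfl) hs
    (by linarith), vint_const_mul, mellinBarnes]
  rw [vint_congr (g := fun p => mellin (flat H) (s - p - 1 / 2) * (Real.pi : ℂ) ^ (-p) *
    gammaQuot (-α i / 2) (1 / 2 - s + α (i + 1) / 2) (1 / 2 - s + α (i + 2) / 2)
      (s + -α i / 2 + (1 / 2 - s + α (i + 1) / 2) + (1 / 2 - s + α (i + 2) / 2)) p)
    fun p hp => ?_]
  · ring
  have hne : Gamma ((1 + p) / 2 - (1 - α i)) ≠ 0 :=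
    Gamma_ne_zero_of_re_pos (by simp [hp]; linarith)
  rw [gammaQuot, show (p - (1 - α i) + α i) / 2 = (1 + p) / 2 - (1 - α i) by ring,
    show (p - α i) / 2 = -α i / 2 + p / 2 by ring,
    show (p + (1 - α i) + 1 - α i) / 2 - s = s + -α i / 2 + (1 / 2 - s + α (i + 1) / 2) +
      (1 / 2 - s + α (i + 2) / 2) + p / 2 by linear_combination (-1 / 2 : ℂ) * hsum']
  generalize Gamma ((1 + p) / 2 - (1 - α i)) = X at hne ⊢
  field_simp

theorem dualTransform_two_mul_sub_one_eq (hη : 16 < η) (hsum : ∑ l, α l = 0)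
    (hα : ∀ l, |(α l).re| < eps) (hs : s ∈ strip (1 / 2 + eps) 4) :
    dualTransform η α H (2 * s - 1) s = (∏ l, Gamma (s - 1 / 2 + α l / 2)) *
      (2 * (Real.sqrt Real.pi : ℂ) * mellinBarnes (η - 1 / 2) H (1 / 2 - s + α 0 / 2)
        (1 / 2 - s + α 1 / 2) (1 / 2 - s + α 2 / 2) s) := by
  have hα' := abs_lt.mp (hα 0)
  have heps : eps = 1 / 100 := rfl
  rw [dualTransform, vint_congr fun s₁ hs₁ => vint_dualIntegrand hsum hα (i := 0) (.inr rfl) hs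
    (by linarith), vint_const_mul, mellinBarnes, Fin.prod_univ_three]
  simp only [zero_add]
  rw [Fin.sum_univ_three] at hsum
  rw [vint_congr (g := fun p => mellin (flat H) (s - p - 1 / 2) * (Real.pi : ℂ) ^ (-p) *
    gammaQuot (1 / 2 - s + α 0 / 2) (1 / 2 - s + α 1 / 2) (1 / 2 - s + α 2 / 2)
      (s + (1 / 2 - s + α 0 / 2) + (1 / 2 - s + α 1 / 2) + (1 / 2 - s + α 2 / 2)) p)
    fun p hp => ?_, show s - 1 / 2 + α 1 / 2 = (2 * s - 1 + α 1) / 2 by ring,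
    show s - 1 / 2 + α 2 / 2 = (2 * s - 1 + α 2) / 2 by ring]
  · ring
  have hne : Gamma ((p - α 0) / 2) ≠ 0 := Gamma_ne_zero_of_re_pos (by simp [hp]; linarith)
  rw [gammaQuot, show (p + (2 * s - 1) + 1 - α 0) / 2 - s = (p - α 0) / 2 by ring,
    show (p - (2 * s - 1) + α 0) / 2 = 1 / 2 - s + α 0 / 2 + p / 2 by ring,
    show (1 + p) / 2 - (2 * s - 1) = s + (1 / 2 - s + α 0 / 2) + (1 / 2 - s + α 1 / 2) +
      (1 / 2 - s + α 2 / 2) + p / 2 by linear_combination (-1 / 2 : ℂ) * hsum]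
  field_simp

end DualTransform

section MellinFlatGammaQuot

variable {a₁ a₃ e : ℂ} {c r : ℝ}

lemma exists_norm_gammaQuot_le_of_re_eq (k : ℕ) (h₁ : 0 < a₁.re + c / 2) (h₂ : 0 < r + c / 2)
    (h₃ : k < a₃.re + c / 2) (he : 0 < (e - a₃).re + k) :
    ∃ C : ℝ, ∀ a₂ p : ℂ, a₂.re = r → p.re = c →
      ‖gammaQuot a₁ a₂ a₃ e p‖ ≤ C * (1 + p.im ^ 2)⁻¹ := by
  obtain ⟨δ, hδ, hδ'⟩ := exists_between (lt_min (lt_min h₁ h₂) (lt_min (sub_pos.mpr h₃) he))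
  simp only [lt_min_iff] at hδ'
  obtain ⟨⟨hδ₁, hδ₂⟩, hδ₃, hδe⟩ := hδ'
  obtain ⟨C, -, hC⟩ := exists_norm_gammaQuot_le k hδ
    (M := ‖a₁‖ + ‖a₃‖ + ‖e‖ + |r| + |c|) (by positivity)
  have hn₁ := norm_nonneg a₁
  have hn₃ := norm_nonneg a₃
  have hne := norm_nonneg e
  have hr := le_abs_self r
  have hc := le_abs_self c
  have hc₀ := abs_nonneg c
  refine ⟨C, fun a₂ p ha₂ hp => hC a₁ a₂ a₃ e p ?_ ?_ ?_ ?_ ?_ ?_ ?_ ?_ ?_⟩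
  all_goals
    try rw [re_add_div_two, hp]
    linarith [re_le_norm a₁]

theorem TestClass.integrable_mellin_flat_mul_gammaQuot_mul_Gamma {η ε : ℝ} {H : ℂ → ℂ} {A s : ℂ}
    (hH : TestClass η H) {N : ℕ} (hN : (N : ℝ) < 2 * η) (k : ℕ) (hs : c < s.re + N)
    (h₁ : 0 < a₁.re + c / 2) (hA : 0 < A.re + ε / 2 + c / 2) (h₃ : k < a₃.re + c / 2)
    (he : 0 < (e - a₃).re + k) (hε : 0 < ε) :
    Integrable fun z : ℝ × ℝ => mellin (flat H) (s - (c + z.1 * I) - 1 / 2) *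
      (Real.pi : ℂ) ^ (-(c + z.1 * I : ℂ)) *
      gammaQuot a₁ (A + (ε + z.2 * I) / 2) a₃ e (c + z.1 * I) * Gamma ((ε + z.2 * I) / 2) := by
  obtain ⟨D, hD⟩ := hH.exists_norm_mellin_flat_le hN (a := s.re - c - 1 / 2) (by linarith) le_rfl
  obtain ⟨C, hC⟩ := exists_norm_gammaQuot_le_of_re_eq k h₁ hA h₃ he
  have hΓ : Integrable fun w : ℝ => Gamma ((ε + w * I : ℂ) / 2) := by
    refine (integrable_Gamma_line (a := (ε / 2 : ℝ)) (b := 1 / 2) (by norm_num)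
      (by simpa using hε)).congr (.of_forall fun w => ?_)
    push_cast
    ring_nf
  have hcont : Continuous fun z : ℝ × ℝ => mellin (flat H) (s - (c + z.1 * I) - 1 / 2) *
      (Real.pi : ℂ) ^ (-(c + z.1 * I : ℂ)) *
      gammaQuot a₁ (A + (ε + z.2 * I) / 2) a₃ e (c + z.1 * I) * Gamma ((ε + z.2 * I) / 2) := by
    refine (((continuous_iff_continuousAt.mpr fun z => ?_).mul ?_).mul ?_).mul ?_
    · exact (hH.differentiableAt_mellin_flat hN (by simp; linarith)).continuousAt.comp
        (f := fun z : ℝ × ℝ => s - (c + z.1 * I) - 1 / 2) (by fun_prop)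
    · exact Continuous.const_cpow (by fun_prop) (.inl (ofReal_ne_zero.mpr Real.pi_ne_zero))
    · refine ((continuous_Gamma_comp (by fun_prop) (by simpa)).mul
        (continuous_Gamma_comp (by fun_prop) (by simpa))).mul
        ((continuous_Gamma_comp (by fun_prop) fun z => ?_).mul
          (differentiable_one_div_Gamma.continuous.comp (by fun_prop)))
      simpa using k.cast_nonneg.trans_lt h₃
    · exact continuous_Gamma_comp (by fun_prop) (by simpa)
  refine ((integrable_inv_one_add_sq.mul_prod hΓ.norm).const_mul
    (D * Real.pi ^ (-c) * C)).mono' hcont.aestronglyMeasurable (.of_forall fun z => ?_)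
  have hline : ((c : ℂ) + z.1 * I).re = c ∧ ((c : ℂ) + z.1 * I).im = z.1 := by simp
  have hmellin := hD (s - (c + z.1 * I) - 1 / 2) (by simp) (by simp)
  have hquot := hC (A + (ε + z.2 * I) / 2) _ (by simp) hline.1
  rw [hline.2] at hquot
  rw [norm_mul, norm_mul, norm_mul, norm_cpow_eq_rpow_re_of_pos Real.pi_pos, neg_re, hline.1]
  have := Real.pi_pos
  have := (norm_nonneg _).trans hmellin
  calc _ ≤ D * Real.pi ^ (-c) * (C * (1 + z.1 ^ 2)⁻¹) * ‖Gamma ((ε + z.2 * I : ℂ) / 2)‖ := by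
        gcongr
    _ = _ := by ring

lemma integrable_mul_betaIntegral {X : Type*} [TopologicalSpace X] [MeasurableSpace X]
    [OpensMeasurableSpace X] [SecondCountableTopologyEither X ℂ] {m : Measure X} {g u v : X → ℂ}
    {δ : ℝ} (hg : Integrable g m) (hu : Continuous u) (hv : Continuous v) (hδ : 0 < δ)
    (hu₀ : ∀ x, δ ≤ (u x).re) (hv₀ : ∀ x, δ ≤ (v x).re) :
    Integrable (fun x => g x * (Gamma (u x) * Gamma (v x) / Gamma (u x + v x))) m := by
  have hu₁ : ∀ x, 0 < (u x).re := fun x => hδ.trans_le (hu₀ x)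
  have hv₁ : ∀ x, 0 < (v x).re := fun x => hδ.trans_le (hv₀ x)
  have huv : ∀ x, 0 < (u x + v x).re := fun x => add_pos (hu₁ x) (hv₁ x)
  have hcont : Continuous fun x => Gamma (u x) * Gamma (v x) / Gamma (u x + v x) :=
    ((continuous_Gamma_comp hu hu₁).mul (continuous_Gamma_comp hv hv₁)).div
      (continuous_Gamma_comp (hu.add hv) huv) fun x => Gamma_ne_zero_of_re_pos (huv x)
  refine hg.mul_bdd (c := ∫ x : ℝ in (0 : ℝ)..1, ‖(x : ℂ) ^ ((δ : ℂ) - 1) *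
    (1 - (x : ℂ)) ^ ((δ : ℂ) - 1)‖) hcont.aestronglyMeasurable (.of_forall fun x => ?_)
  rw [← betaIntegral_eq_Gamma_mul_div _ _ (hu₁ x) (hv₁ x)]
  exact norm_betaIntegral_le hδ (hu₀ x) (hv₀ x)

end MellinFlatGammaQuot

lemma exists_nat_between {η : ℝ} (hη : 1 < η) : ∃ N : ℕ, η ≤ N ∧ (N : ℝ) < 2 * η :=
  ⟨⌈η⌉₊, Nat.le_ceil η, (Nat.ceil_lt_add_one (by linarith)).trans (by linarith)⟩

section DualConverges

variable {α : Fin 3 → ℂ} {H : ℂ → ℂ} {i : Fin 3} {s₀ s : ℂ}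

lemma dualIntegrand_eq_mul_gammaQuot {p u : ℂ} (hs₀ : s₀ = 1 - α i ∨ s₀ = 2 * s - 1)
    (hu : u.re < 1) :
    dualIntegrand α H s₀ s p u = mellin (flat H) (s - p - 1 / 2) * (Real.pi : ℂ) ^ (-p) *
      gammaQuot (-α i / 2) (1 / 2 - s - s₀ / 2 + u / 2) (-α (i + 1) / 2) (1 / 2 - s₀) p *
      Gamma (u / 2) * Gamma (s - 1 / 2 + α i / 2 - u / 2) *
      Gamma ((s₀ + α (i + 1)) / 2 - u / 2) *
      (Gamma ((p - α (i + 2)) / 2) * Gamma ((s₀ + α (i + 2)) / 2 - u / 2) /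
        Gamma ((p - α (i + 2)) / 2 + ((s₀ + α (i + 2)) / 2 - u / 2))) := by
  rw [dualIntegrand_eq hs₀ hu, gammaQuot,
    show 1 / 2 - s - s₀ / 2 + u / 2 + p / 2 = p / 2 - s₀ / 2 + 1 / 2 - s + u / 2 by ring,
    show -α i / 2 + p / 2 = (p - α i) / 2 by ring,
    show -α (i + 1) / 2 + p / 2 = (p - α (i + 1)) / 2 by ring,
    show 1 / 2 - s₀ + p / 2 = (1 + p) / 2 - s₀ by ring,
    show (p - α (i + 2)) / 2 + ((s₀ + α (i + 2)) / 2 - u / 2) = (s₀ - u + p) / 2 by ring]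
  ring

theorem TestClass.dualConverges {η : ℝ} (hH : TestClass η H) (hη : 16 < η)
    (hα : ∀ l, |(α l).re| < eps) (hs₀ : s₀ = 1 - α i ∨ s₀ = 2 * s - 1)
    (hs : s ∈ strip (1 / 2 + eps) 4) : DualConverges η α H s₀ s := by
  obtain ⟨N, hηN, hN⟩ := exists_nat_between (η := η) (by linarith)
  obtain ⟨hs₀₁, hs₀₂⟩ := dual_param_re_bounds (hα i) hs₀ hs
  have hs' := hs.1
  have hs'' := hs.2
  have hα' := fun l => abs_lt.mp (hα l)
  have heps : eps = 1 / 100 := rfl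
  have hBre : ∀ l, eps / 2 < ((s₀ + α l) / 2).re := fun l => by simp; linarith [hα' l]
  have hmain := hH.integrable_mellin_flat_mul_gammaQuot_mul_Gamma (a₁ := -α i / 2)
    (a₃ := -α (i + 1) / 2) (e := 1 / 2 - s₀) (c := η - 1 / 2) (ε := eps)
    (A := 1 / 2 - s - s₀ / 2) (s := s) hN 7
    (by linarith) (by simp; linarith [hα' i]) (by simp; linarith)
    (by simp; linarith [hα' (i + 1)]) (by simp; linarith [hα' (i + 1)]) (by rw [heps]; norm_num)
  have hmain₁ := integrable_mul_Gamma hmain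
    (f := fun z : ℝ × ℝ => s - 1 / 2 + α i / 2 - (eps + z.2 * I) / 2)
    (x := (s - 1 / 2 + α i / 2).re - eps / 2) (by fun_prop)
    (by simp; linarith [hα' i]) (by simp)
  have hmain₂ := integrable_mul_Gamma hmain₁
    (f := fun z : ℝ × ℝ => (s₀ + α (i + 1)) / 2 - (eps + z.2 * I) / 2)
    (x := ((s₀ + α (i + 1)) / 2).re - eps / 2) (by fun_prop) (by linarith [hBre (i + 1)]) (by simp)
  have hmain₃ := integrable_mul_betaIntegral hmain₂
    (u := fun z : ℝ × ℝ => (((η - 1 / 2 : ℝ) : ℂ) + z.1 * I - α (i + 2)) / 2)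
    (v := fun z : ℝ × ℝ => (s₀ + α (i + 2)) / 2 - (eps + z.2 * I) / 2)
    (δ := ((s₀ + α (i + 2)) / 2).re - eps / 2) (by fun_prop) (by fun_prop)
    (by linarith [hBre (i + 2)]) (fun z => by simp; linarith [hα' (i + 2)]) (by simp)
  exact hmain₃.congr (.of_forall fun z =>
    (dualIntegrand_eq_mul_gammaQuot hs₀ (by simp [heps]; norm_num)).symm)

end DualConverges

section GammaSub

lemma differentiableAt_Gamma_of_neg_one_lt_re {z : ℂ} (hz : -1 < z.re) (hz₀ : z ≠ 0) :
    DifferentiableAt ℂ Gamma z := by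
  refine differentiableAt_Gamma z fun m hm => ?_
  have hre : z.re = -m := by simp [hm]
  have hm₀ : m = 0 := Nat.lt_one_iff.mp (by exact_mod_cast (by linarith : (m : ℝ) < 1))
  exact hz₀ (by simp [hm, hm₀])

lemma differentiableOn_Gamma_sub {V : Set ℂ} {p : ℂ} (hp : ∀ s ∈ V, p.re - 1 < s.re) :
    DifferentiableOn ℂ (fun s => Gamma (s - p)) (V \ {p}) := fun s hs =>
  ((differentiableAt_Gamma_of_neg_one_lt_re (by rw [sub_re]; linarith [hp s hs.1])
    (sub_ne_zero.mpr hs.2)).comp s (f := fun s => s - p) (by fun_prop)).differentiableWithinAt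

theorem meromorphicAt_Gamma_sub_mul {p : ℂ} {g : ℂ → ℂ} (hg : AnalyticAt ℂ g p) :
    MeromorphicAt (fun s => Gamma (s - p) * g s) p ∧
      (-1 : WithTop ℤ) ≤ meromorphicOrderAt (fun s => Gamma (s - p) * g s) p := by
  have hΓ : AnalyticAt ℂ (fun s => Gamma (s - p + 1)) p := by
    refine DifferentiableOn.analyticAt (s := {s : ℂ | p.re - 1 < s.re}) (fun s hs => ?_)
      ((isOpen_lt continuous_const continuous_re).mem_nhds (by simp))
    have hre : 0 < (s - p + 1).re := by simp only [add_re, sub_re, one_re]; linarith [hs.out]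
    exact ((differentiableAt_Gamma_of_re_pos hre).comp s
      (f := fun s => s - p + 1) (by fun_prop)).differentiableWithinAt
  have hG : AnalyticAt ℂ (fun s => Gamma (s - p + 1) * g s) p := hΓ.mul hg
  have hsub : MeromorphicAt (fun s : ℂ => s - p) p := by fun_prop
  have heq : (fun s => Gamma (s - p) * g s) =ᶠ[nhdsWithin p {p}ᶜ]
      ((fun s : ℂ => s - p)⁻¹ * fun s => Gamma (s - p + 1) * g s) := by
    filter_upwards [self_mem_nhdsWithin] with s hs
    have hsp : s - p ≠ 0 := sub_ne_zero.mpr hs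
    rw [Pi.mul_apply, Pi.inv_apply, Gamma_add_one _ hsp]
    field_simp
  have horder : meromorphicOrderAt (fun s : ℂ => s - p) p = 1 := meromorphicOrderAt_id_sub_const
  refine ⟨(hsub.inv.mul hG.meromorphicAt).congr heq.symm, ?_⟩
  rw [meromorphicOrderAt_congr heq, meromorphicOrderAt_mul hsub.inv hG.meromorphicAt,
    meromorphicOrderAt_inv, horder]
  exact le_add_of_nonneg_right hG.meromorphicOrderAt_nonneg

theorem isContinuation_prod_Gamma_sub_mul {ι : Type*} {S : Finset ι} {p : ι → ℂ} {f g : ℂ → ℂ}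
    {U V : Set ℂ} (hUV : U ⊆ V) (hV : IsOpen V) (hinj : InjOn p S) (hpV : ∀ i ∈ S, p i ∈ V)
    (hp : ∀ i ∈ S, ∀ s ∈ V, (p i).re - 1 < s.re) (hg : DifferentiableOn ℂ g V)
    (hf : ∀ s ∈ U, f s = (∏ i ∈ S, Gamma (s - p i)) * g s) :
    IsContinuation f (fun s => (∏ i ∈ S, Gamma (s - p i)) * g s) U V (p '' S) where
  subset := hUV
  eqOn s hs := (hf s hs).symm
  holo := (DifferentiableOn.fun_finsetProd fun i hi => (differentiableOn_Gamma_sub (hp i hi)).mono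
    (sdiff_subset_sdiff_right (singleton_subset_iff.mpr (mem_image_of_mem p hi)))).mul
    (hg.mono sdiff_subset)
  pole := by
    classical
    rintro _ ⟨i, hi, rfl⟩
    simp only [← Finset.mul_prod_erase S _ hi, mul_assoc]
    refine meromorphicAt_Gamma_sub_mul (.mul (Finset.analyticAt_fun_prod _ fun j hj => ?_)
      (hg.analyticAt (hV.mem_nhds (hpV i hi))))
    obtain ⟨hji, hj⟩ := Finset.mem_erase.mp hj
    exact (differentiableOn_Gamma_sub (hp j hj)).analyticAt ((hV.sdiff isClosed_singleton).mem_nhds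
      ⟨hpV i hi, fun h => hji (hinj hj hi h.symm)⟩)

end GammaSub

/-! ### Continuation of the dual transform -/

section Evaluation

variable {η c : ℝ} {H : ℂ → ℂ}

theorem TestClass.mellinBarnes_eq (hH : TestClass η H) {N : ℕ} (hN : (N : ℝ) < 2 * η)
    {a₁ a₂ a₃ s : ℂ} (h₁ : -2 * a₁.re < s.re) (h₂ : -2 * a₂.re < s.re) (h₃ : -2 * a₃.re < s.re)
    (h₁₂ : 0 < (s + a₁ + a₂).re) (hsc : s.re ≤ c) (hc : c < s.re + N) :
    mellinBarnes c H a₁ a₂ a₃ s = 1 / 2 * (Real.pi : ℂ) ^ (-s) *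
      (vint 0 (fun μ => H μ / ((‖Gamma μ‖ ^ 2 : ℝ) : ℂ) *
        (gammaPM (2 * a₁ + s) μ * gammaPM (2 * a₂ + s) μ * gammaPM (2 * a₃ + s) μ)) /
        (Gamma (s + a₂ + a₃) * Gamma (s + a₁ + a₃) * Gamma (s + a₁ + a₂))) := by
  have hη : 0 < η := by linarith [(N.cast_nonneg : (0 : ℝ) ≤ N)]
  obtain ⟨κ, hκ', hκ⟩ := exists_between (max_lt h₁ (max_lt h₂ h₃))
  simp only [max_lt_iff] at hκ'
  obtain ⟨hκ₁, hκ₂, hκ₃⟩ := hκ'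
  rw [mellinBarnes, hH.vint_mellin_flat_mul_gammaQuot_congr hN (κ := κ) (by linarith)
    (by linarith) (by linarith) (by rwa [add_sub_cancel_right]) hκ (hκ.le.trans hsc) hc,
    hH.vint_mellin_flat_mul_gammaQuot hη (by linarith) (by linarith) (by linarith) hκ,
    vint_div_norm_Gamma_sq_mul]

lemma sqrt_pi_mul_pi_cpow_neg (s : ℂ) :
    (Real.sqrt Real.pi : ℂ) * (Real.pi : ℂ) ^ (-s) = (Real.pi : ℂ) ^ (1 / 2 - s) := by
  rw [sub_eq_add_neg, cpow_add _ _ (ofReal_ne_zero.mpr Real.pi_ne_zero), Real.sqrt_eq_rpow,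
    ofReal_cpow Real.pi_pos.le]
  norm_num

lemma isOpen_strip (a b : ℝ) : IsOpen (strip a b) :=
  (isOpen_lt continuous_const continuous_re).inter (isOpen_lt continuous_re continuous_const)

end Evaluation

/-- The continuation of `s ↦ (ℱ_α H)(1 - αᵢ, s)`. -/
noncomputable def dualTwo (η : ℝ) (α : Fin 3 → ℂ) (H : ℂ → ℂ) (i : Fin 3) (s : ℂ) : ℂ :=
  Gamma (s - (1 - α i) / 2) * (2 * (Real.sqrt Real.pi : ℂ) *
    (Gamma ((1 - α i + α (i + 1)) / 2) * Gamma ((1 - α i + α (i + 2)) / 2)) *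
    mellinBarnes (η - 1 / 2) H (-α i / 2) (1 / 2 - s + α (i + 1) / 2)
      (1 / 2 - s + α (i + 2) / 2) s)

/-- The continuation of `s ↦ (ℱ_α H)(2s - 1, s)`. -/
noncomputable def dualThree (η : ℝ) (α : Fin 3 → ℂ) (H : ℂ → ℂ) (s : ℂ) : ℂ :=
  (∏ i, Gamma (s - (1 - α i) / 2)) * (2 * (Real.sqrt Real.pi : ℂ) *
    mellinBarnes (η - 1 / 2) H (1 / 2 - s + α 0 / 2) (1 / 2 - s + α 1 / 2)
      (1 / 2 - s + α 2 / 2) s)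

lemma sub_one_sub_div_two (s a : ℂ) : s - (1 - a) / 2 = s - 1 / 2 + a / 2 := by ring

namespace TestClass

variable {η : ℝ} {H : ℂ → ℂ} {α : Fin 3 → ℂ}

theorem isContinuation_dualTwo (hH : TestClass η H) (hη : 16 < η) (hsum : ∑ l, α l = 0)
    (hα : ∀ l, |(α l).re| < eps) (i : Fin 3) :
    IsContinuation (fun s => dualTransform η α H (1 - α i) s) (dualTwo η α H i)
      (strip (1 / 2 + eps) 4) (strip (max 0 (α i).re) 4) {(1 - α i) / 2} := by
  obtain ⟨N, hηN, hN⟩ := exists_nat_between (η := η) (by linarith)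
  have hα' := fun l => abs_lt.mp (hα l)
  have heps : eps = 1 / 100 := rfl
  have hpos : ∀ s ∈ strip (max 0 (α i).re) 4, 0 < s.re := fun s hs =>
    (le_max_left _ _).trans_lt hs.1
  have hlt : ∀ s ∈ strip (max 0 (α i).re) 4, s.re < 4 := fun s hs => hs.2
  have hdiff : DifferentiableOn ℂ (fun s => mellinBarnes (η - 1 / 2) H (-α i / 2)
      (1 / 2 - s + α (i + 1) / 2) (1 / 2 - s + α (i + 2) / 2) s) (strip (max 0 (α i).re) 4) :=
    hH.differentiableOn_mellinBarnes hN 4 (isOpen_strip _ _) (by fun_prop) (by fun_prop)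
      (by fun_prop) (fun s hs => by linarith [hpos s hs]) (fun s _ => by simp; linarith [hα' i])
      (fun s hs => by simp; linarith [hlt s hs, hα' (i + 1)])
      (fun s hs => by simp; linarith [hlt s hs, hα' (i + 2)])
      (fun s _ => by simp; linarith [hα' i, hα' (i + 1)])
  have hp : ((1 - α i) / 2).re = (1 - (α i).re) / 2 := by simp
  have hsub : strip (1 / 2 + eps) 4 ⊆ strip (max 0 (α i).re) 4 := fun s hs =>
    ⟨max_lt (by linarith [hs.1]) (by linarith [hs.1, hα' i]), hs.2⟩
  have hpole : (1 - α i) / 2 ∈ strip (max 0 (α i).re) 4 :=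
    ⟨by rw [hp]; exact max_lt (by linarith [hα' i]) (by linarith [hα' i]),
      by rw [hp]; linarith [hα' i]⟩
  have hcont := isContinuation_prod_Gamma_sub_mul (S := {i}) (p := fun l => (1 - α l) / 2)
    (f := fun s => dualTransform η α H (1 - α i) s) hsub (isOpen_strip _ _) (by simp)
    (by simpa using hpole) (by simpa [hp] using fun s hs => by linarith [hpos s hs, hα' i])
    (hdiff.const_mul (2 * (Real.sqrt Real.pi : ℂ) *
      (Gamma ((1 - α i + α (i + 1)) / 2) * Gamma ((1 - α i + α (i + 2)) / 2)))) fun s hs => by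
        rw [Finset.prod_singleton, sub_one_sub_div_two]
        exact dualTransform_one_sub_eq hη hsum hα i hs
  simp only [Finset.prod_singleton, Finset.coe_singleton, image_singleton] at hcont
  exact hcont

theorem isContinuation_dualThree (hH : TestClass η H) (hη : 16 < η) (hsum : ∑ l, α l = 0)
    (hα : ∀ l, |(α l).re| < eps) (hdist : Function.Injective α) :
    IsContinuation (fun s => dualTransform η α H (2 * s - 1) s) (dualThree η α H)
      (strip (1 / 2 + eps) 4) (strip 0 4) {p : ℂ | ∃ i : Fin 3, p = (1 - α i) / 2} := by
  obtain ⟨N, hηN, hN⟩ := exists_nat_between (η := η) (by linarith)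
  have hα' := fun l => abs_lt.mp (hα l)
  have heps : eps = 1 / 100 := rfl
  have hdiff : DifferentiableOn ℂ (fun s => mellinBarnes (η - 1 / 2) H (1 / 2 - s + α 0 / 2)
      (1 / 2 - s + α 1 / 2) (1 / 2 - s + α 2 / 2) s) (strip 0 4) :=
    hH.differentiableOn_mellinBarnes hN 4 (isOpen_strip _ _) (by fun_prop) (by fun_prop)
      (by fun_prop) (fun s hs => by linarith [hs.1])
      (fun s hs => by simp; linarith [hs.2, hα' 0]) (fun s hs => by simp; linarith [hs.2, hα' 1])
      (fun s hs => by simp; linarith [hs.2, hα' 2])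
      (fun s hs => by simp; linarith [hs.2, hα' 0, hα' 1])
  have hp : ∀ l, ((1 - α l) / 2).re = (1 - (α l).re) / 2 := by simp
  have hP : {p : ℂ | ∃ i : Fin 3, p = (1 - α i) / 2} =
      (fun l => (1 - α l) / 2) '' (Finset.univ : Finset (Fin 3)) := by
    ext p
    simp [eq_comm]
  rw [hP]
  refine isContinuation_prod_Gamma_sub_mul (fun s hs => ⟨?_, hs.2⟩) (isOpen_strip _ _)
    (fun l _ m _ h => hdist ?_) (fun l _ => ?_) (fun l _ s hs => ?_) (hdiff.const_mul _)
    fun s hs => ?_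
  · linarith [hs.1]
  · linear_combination -2 * h
  · exact ⟨by rw [hp]; linarith [hα' l], by rw [hp]; linarith [hα' l]⟩
  · rw [hp]
    linarith [hs.1, hα' l]
  · simp only [sub_one_sub_div_two]
    exact dualTransform_two_mul_sub_one_eq hη hsum hα hs

variable {s : ℂ}

theorem verticalIntegrable_oneSwap (hH : TestClass η H) (hη : 0 < η) {β : Fin 3 → ℂ}
    (h₀ : -(β 0).re < s.re) (h₁ : -(β 1).re < s.re) (h₂ : s.re < 1 - (β 2).re) :
    VerticalIntegrable (oneSwap β H s) 0 :=
  hH.verticalIntegrable_mul_gammaPM hη (by simp; linarith) (by simp; linarith)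
    (by simp; linarith)

lemma twoSwap_eq (α : Fin 3 → ℂ) (i : Fin 3) (H : ℂ → ℂ) (s : ℂ) :
    twoSwap α i H s = fun μ => H μ / ((‖Gamma μ‖ ^ 2 : ℝ) : ℂ) * (gammaPM (s - α i) μ *
      gammaPM (1 - s + α (i + 1)) μ * gammaPM (1 - s + α (i + 2)) μ) := by
  funext μ
  simp only [twoSwap, prod_erase_fin_three, mul_assoc]

lemma threeSwap_eq (α : Fin 3 → ℂ) (H : ℂ → ℂ) (s : ℂ) :
    threeSwap α H s = fun μ => H μ / ((‖Gamma μ‖ ^ 2 : ℝ) : ℂ) * (gammaPM (1 - s + α 0) μ *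
      gammaPM (1 - s + α 1) μ * gammaPM (1 - s + α 2) μ) := by
  funext μ
  rw [threeSwap, Fin.prod_univ_three]

theorem verticalIntegrable_twoSwap (hH : TestClass η H) (hη : 0 < η) {i : Fin 3}
    (hi : (α i).re < s.re) (hl : ∀ l, l ≠ i → s.re < 1 + (α l).re) :
    VerticalIntegrable (twoSwap α i H s) 0 := by
  have hl₁ := hl (i + 1) (by simp)
  have hl₂ := hl (i + 2) (by simp)
  rw [twoSwap_eq]
  exact hH.verticalIntegrable_mul_gammaPM hη (by simpa) (by simp; linarith) (by simp; linarith)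

theorem verticalIntegrable_threeSwap (hH : TestClass η H) (hη : 0 < η)
    (hl : ∀ l, s.re < 1 + (α l).re) : VerticalIntegrable (threeSwap α H s) 0 := by
  have hre : ∀ l, 0 < (1 - s + α l).re := fun l => by simp; linarith [hl l]
  rw [threeSwap_eq]
  exact hH.verticalIntegrable_mul_gammaPM hη (hre 0) (hre 1) (hre 2)

theorem dualTwo_eq (hH : TestClass η H) (hη : 2 ≤ η) (hsum : ∑ l, α l = 0)
    (hα : ∀ l, |(α l).re| < eps) {i : Fin 3} (hs₀ : 0 < s.re)
    (hi : (α i).re < s.re) (hl : ∀ l, l ≠ i → s.re < 1 + (α l).re) :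
    dualTwo η α H i s = (Real.pi : ℂ) ^ (1 / 2 - s) *
      (Gamma (s - 1 / 2 + α i / 2) / Gamma (1 - s - α i / 2)) * vint 0 (twoSwap α i H s) := by
  obtain ⟨N, hηN, hN⟩ := exists_nat_between (η := η) (by linarith)
  have hα' := fun l => abs_lt.mp (hα l)
  have heps : eps = 1 / 100 := rfl
  have hl₁ := hl (i + 1) (by simp)
  have hl₂ := hl (i + 2) (by simp)
  have hsum' : α i + (α (i + 1) + α (i + 2)) = 0 := by rw [← sum_fin_three, hsum]
  have hΓ : ∀ l, Gamma ((1 - α i + α l) / 2) ≠ 0 := fun l =>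
    Gamma_ne_zero_of_re_pos (by simp; linarith [hα' i, hα' l])
  rw [dualTwo, sub_one_sub_div_two, hH.mellinBarnes_eq hN (by simp; linarith) (by simp; linarith)
    (by simp; linarith) (by simp; linarith [hα' i, hα' (i + 1)]) (by linarith [hα' (i + 1)])
    (by linarith), ← sqrt_pi_mul_pi_cpow_neg, twoSwap_eq]
  have hgamma : ∀ l, 2 * (1 / 2 - s + α l / 2) + s = 1 - s + α l := fun l => by ring
  have hquot : ∀ l, s + -α i / 2 + (1 / 2 - s + α l / 2) = (1 - α i + α l) / 2 := fun l => by ring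
  simp only [hgamma, hquot, show 2 * (-α i / 2) + s = s - α i by ring,
    show s + (1 / 2 - s + α (i + 1) / 2) + (1 / 2 - s + α (i + 2) / 2) = 1 - s - α i / 2 by
      linear_combination (1 / 2 : ℂ) * hsum', mul_assoc]
  have hcancel : ∀ {x y : ℂ}, x ≠ 0 → y ≠ 0 → ∀ w p q v z : ℂ,
      w * (2 * (p * (x * (y * (1 / 2 * (q * (v / (z * (y * x))))))))) = p * (q * (w / z * v)) :=
    fun hx hy w p q v z => by field_simp
  exact hcancel (hΓ _) (hΓ _) _ _ _ _ _

theorem dualThree_eq (hH : TestClass η H) (hη : 3 / 2 ≤ η) (hsum : ∑ l, α l = 0)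
    (hs₀ : 0 < s.re) (hl : ∀ l, s.re < 1 + (α l).re) :
    dualThree η α H s = (Real.pi : ℂ) ^ (1 / 2 - s) *
      (∏ i, Gamma (s - 1 / 2 + α i / 2) / Gamma (1 - s - α i / 2)) *
        vint 0 (threeSwap α H s) := by
  obtain ⟨N, hηN, hN⟩ := exists_nat_between (η := η) (by linarith)
  rw [Fin.sum_univ_three] at hsum
  have hs₁ : s.re < 1 := by
    have hsum_re := congrArg re hsum
    simp only [add_re, zero_re] at hsum_re
    linarith [hl 0, hl 1, hl 2]
  have hre : ∀ l, -2 * (1 / 2 - s + α l / 2).re < s.re := fun l => by simp; linarith [hl l]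
  have hgamma : ∀ l, 2 * (1 / 2 - s + α l / 2) + s = 1 - s + α l := fun l => by ring
  rw [dualThree, hH.mellinBarnes_eq hN (hre 0) (hre 1) (hre 2) (by simp; linarith [hl 0, hl 1])
    (by linarith) (by linarith), ← sqrt_pi_mul_pi_cpow_neg, Finset.prod_div_distrib, threeSwap_eq]
  simp only [hgamma, sub_one_sub_div_two, Fin.prod_univ_three,
    show s + (1 / 2 - s + α 1 / 2) + (1 / 2 - s + α 2 / 2) = 1 - s - α 0 / 2 by
      linear_combination (1 / 2 : ℂ) * hsum,
    show s + (1 / 2 - s + α 0 / 2) + (1 / 2 - s + α 2 / 2) = 1 - s - α 1 / 2 by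
      linear_combination (1 / 2 : ℂ) * hsum,
    show s + (1 / 2 - s + α 0 / 2) + (1 / 2 - s + α 1 / 2) = 1 - s - α 2 / 2 by
      linear_combination (1 / 2 : ℂ) * hsum]
  ring

end TestClass

lemma Weyl.sum_act (w : Weyl) (α : Fin 3 → ℂ) :
    w.act α 0 + w.act α 1 + w.act α 2 = ∑ l, α l := by
  rw [Fin.sum_univ_three]
  cases w <;> simp [Weyl.act] <;> ring

lemma abs_re_lt_of_sum_eq_zero {α : Fin 3 → ℂ} {δ : ℝ} (hsum : ∑ l, α l = 0)
    (h₀ : |(α 0).re| < δ) (h₁ : |(α 1).re| < δ) (l : Fin 3) : |(α l).re| < 2 * δ := by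
  have hsum_re := congrArg re (Fin.sum_univ_three α ▸ hsum)
  simp only [add_re, zero_re] at hsum_re
  rw [abs_lt] at h₀ h₁ ⊢
  fin_cases l <;> dsimp only [Fin.reduceFinMk] <;> constructor <;> linarith

end MellinBarnesSwap

open MellinBarnesSwap in
theorem theorem2_general {η : ℝ} (hη : 16 < η) {H : ℂ → ℂ} (hH : TestClass η H)
    {α : Fin 3 → ℂ} (hsum : ∑ l, α l = 0) (hdist : Function.Injective α)
    (hα : ∀ l, |(α l).re| < eps) :
    (∀ (w : Weyl) (s : ℂ),
      -(w.act α 0).re < s.re → -(w.act α 1).re < s.re → s.re < 1 - (w.act α 2).re →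
      IntegrableOn (fun p : ℝ × ℝ => swapIntegrand (w.act α) (flat H) s p.1 p.2)
        (Ioi 0 ×ˢ Ioi 0) ∧
      VerticalIntegrable (oneSwap (w.act α) H s) 0 ∧
      swapJ α (flat H) s w =
        (Real.pi : ℂ) ^ (-(s - w.act α 2 / 2)) / 8 * (Gamma ((1 + w.act α 1 - w.act α 2) / 2))⁻¹ *
          (Gamma ((1 + w.act α 0 - w.act α 2) / 2))⁻¹ * vint 0 (oneSwap (w.act α) H s)) ∧
    (∀ i : Fin 3,
      (∀ s ∈ strip (1 / 2 + eps) 4, DualConverges η α H (1 - α i) s) ∧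
      ∃ F : ℂ → ℂ,
        IsContinuation (fun s => dualTransform η α H (1 - α i) s) F (strip (1 / 2 + eps) 4)
          (strip (max 0 (α i).re) 4) {(1 - α i) / 2} ∧
        ∀ s : ℂ, 0 < s.re → (α i).re < s.re → (∀ j, j ≠ i → s.re < 1 + (α j).re) →
          s ≠ (1 - α i) / 2 →
          VerticalIntegrable (twoSwap α i H s) 0 ∧
          F s = (Real.pi : ℂ) ^ (1 / 2 - s) *
            (Gamma (s - 1 / 2 + α i / 2) / Gamma (1 - s - α i / 2)) *
              vint 0 (twoSwap α i H s)) ∧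
    ((∀ s ∈ strip (1 / 2 + eps) 4, DualConverges η α H (2 * s - 1) s) ∧
      ∃ F : ℂ → ℂ,
        IsContinuation (fun s => dualTransform η α H (2 * s - 1) s) F (strip (1 / 2 + eps) 4)
          (strip 0 4) {p : ℂ | ∃ i : Fin 3, p = (1 - α i) / 2} ∧
        ∀ s : ℂ, 0 < s.re → (∀ i, s.re < 1 + (α i).re) → (∀ i, s ≠ (1 - α i) / 2) →
          VerticalIntegrable (threeSwap α H s) 0 ∧
          F s = (Real.pi : ℂ) ^ (1 / 2 - s) *
            (∏ i, Gamma (s - 1 / 2 + α i / 2) / Gamma (1 - s - α i / 2)) *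
              vint 0 (threeSwap α H s)) := by
  have hη₀ : 0 < η := by linarith
  refine ⟨fun w s h₀ h₁ h₂ => ?_,
    fun i => ⟨fun s hs => hH.dualConverges hη hα (.inl rfl) hs, dualTwo η α H i,
      hH.isContinuation_dualTwo hη hsum hα i, fun s hs hi hl _ =>
        ⟨hH.verticalIntegrable_twoSwap hη₀ hi hl, hH.dualTwo_eq (by linarith) hsum hα hs hi hl⟩⟩,
    fun s hs => hH.dualConverges (i := 0) hη hα (.inr rfl) hs, dualThree η α H,
    hH.isContinuation_dualThree hη hsum hα hdist, fun s hs hl _ =>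
      ⟨hH.verticalIntegrable_threeSwap hη₀ hl, hH.dualThree_eq (by linarith) hsum hs hl⟩⟩
  obtain ⟨hint, hval⟩ := hH.integrableOn_swapIntegrand_and_integral_eq hη₀
    ((w.sum_act α).trans hsum) h₀ h₁ h₂
  exact ⟨hint, hH.verticalIntegrable_oneSwap hη₀ h₀ h₁ h₂, hval⟩

theorem theorem2 (η : ℝ) (hη : 40 < η) (H : ℂ → ℂ) (hH : MellinBarnesSwap.TestClass η H)
    (α : Fin 3 → ℂ) (hsum : α 0 + α 1 + α 2 = 0) (hdist : Function.Injective α)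
    (hα₀ : |(α 0).re| < MellinBarnesSwap.eps / 1000)
    (hα₁ : |(α 1).re| < MellinBarnesSwap.eps / 1000) :
    -- the 1-swap identity
    (∀ w : MellinBarnesSwap.Weyl, (w = .w2 ∨ w = .w4 ∨ w = .wl) →
      ∀ s : ℂ, 0 < s.re → s.re < 1 →
        -(w.act α 0).re < s.re → -(w.act α 1).re < s.re → s.re < 1 - (w.act α 2).re →
        IntegrableOn (fun p : ℝ × ℝ =>
            MellinBarnesSwap.swapIntegrand (w.act α) (MellinBarnesSwap.flat H) s p.1 p.2)
          (Ioi 0 ×ˢ Ioi 0) ∧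
        VerticalIntegrable (MellinBarnesSwap.oneSwap (w.act α) H s) 0 ∧
        MellinBarnesSwap.swapJ α (MellinBarnesSwap.flat H) s w =
          (Real.pi : ℂ) ^ (-(s - w.act α 2 / 2)) / 8
            * (Gamma ((1 + w.act α 1 - w.act α 2) / 2))⁻¹
            * (Gamma ((1 + w.act α 0 - w.act α 2) / 2))⁻¹
            * MellinBarnesSwap.vint 0 (MellinBarnesSwap.oneSwap (w.act α) H s)) ∧
    -- the 2-swap identities
    (∀ i : Fin 3,
      (∀ s ∈ MellinBarnesSwap.strip (1 / 2 + MellinBarnesSwap.eps) 4,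
        MellinBarnesSwap.DualConverges η α H (1 - α i) s) ∧
      ∃ F : ℂ → ℂ,
        MellinBarnesSwap.IsContinuation
          (fun s => MellinBarnesSwap.dualTransform η α H (1 - α i) s) F
          (MellinBarnesSwap.strip (1 / 2 + MellinBarnesSwap.eps) 4)
          (MellinBarnesSwap.strip (max 0 (α i).re) 4)
          {(1 - α i) / 2} ∧
        ∀ s : ℂ, 0 < s.re → s.re < 1 → (α i).re < s.re →
          (∀ j : Fin 3, j ≠ i → s.re < 1 + (α j).re) → s ≠ (1 - α i) / 2 →
          VerticalIntegrable (MellinBarnesSwap.twoSwap α i H s) 0 ∧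
          F s = (Real.pi : ℂ) ^ (1 / 2 - s)
            * (Gamma (s - 1 / 2 + α i / 2) / Gamma (1 - s - α i / 2))
            * MellinBarnesSwap.vint 0 (MellinBarnesSwap.twoSwap α i H s)) ∧
    -- the 3-swap identity
    ((∀ s ∈ MellinBarnesSwap.strip (1 / 2 + MellinBarnesSwap.eps) 4,
        MellinBarnesSwap.DualConverges η α H (2 * s - 1) s) ∧
      ∃ F : ℂ → ℂ,
        MellinBarnesSwap.IsContinuation
          (fun s => MellinBarnesSwap.dualTransform η α H (2 * s - 1) s) F
          (MellinBarnesSwap.strip (1 / 2 + MellinBarnesSwap.eps) 4)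
          (MellinBarnesSwap.strip 0 4)
          {p : ℂ | ∃ i : Fin 3, p = (1 - α i) / 2} ∧
        ∀ s : ℂ, 0 < s.re → s.re < 1 → (∀ i : Fin 3, s.re < 1 + (α i).re) →
          (∀ i : Fin 3, s ≠ (1 - α i) / 2) →
          VerticalIntegrable (MellinBarnesSwap.threeSwap α H s) 0 ∧
          F s = (Real.pi : ℂ) ^ (1 / 2 - s)
            * (∏ i, Gamma (s - 1 / 2 + α i / 2) / Gamma (1 - s - α i / 2))
            * MellinBarnesSwap.vint 0 (MellinBarnesSwap.threeSwap α H s)) := by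
  rw [← Fin.sum_univ_three] at hsum
  obtain ⟨hone, htwo, hthree⟩ := theorem2_general (by linarith) hH hsum hdist fun l =>
    (MellinBarnesSwap.abs_re_lt_of_sum_eq_zero hsum hα₀ hα₁ l).trans
      (by rw [MellinBarnesSwap.eps]; norm_num)
  exact ⟨fun w _ s _ _ => hone w s,
    fun i => (htwo i).imp_right fun ⟨F, hF, h⟩ => ⟨F, hF, fun s h₀ _ => h s h₀⟩,
    hthree.imp_right fun ⟨F, hF, h⟩ => ⟨F, hF, fun s h₀ _ => h s h₀⟩⟩
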